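/- Let $\mathbb I=[t_1,t_2]$ with $t_1<t_2$, and consider the linear differential-algebraic equation (DAE) $E(t)\dot x=A(t)x+f(t)$ on $\mathbb I$ with $E,A:\mathbb I\to\mathbb R^{n,n}$ and $f:\mathbb I\to\mathbb R^n$. For $\mu\ge 0$ let $M_\mu$ be the $(\mu+1)\times(\mu+1)$ block matrix function with blocks $\binom{i}{j}E^{(i-j)}-\binom{i}{j+1}A^{(i-j-1)}$ ($0\le i,j\le\mu$; terms with a vanishing binomial coefficient are zero), and put $N=[A;\dot A;\dots;A^{(\mu)}]$ and $g_\mu=[f;\dot f;\dots;f^{(\mu)}]$ (stacked). *Hypothesis $(\mu,a,d)$.* $d+a=n$ and, for every $t\in\mathbb I$: (1) $\operatorname{rank}M_\mu=(\mu+1)n-a$, so that there is $Z_2$ of size $(\mu+1)n\times a$ and full rank with $Z_2^TM_\mu=0$; (2) $\hat A_2=Z_2^TN$ has rank $a$, so that there is $T$ of size $n\times d$ and full rank with $\hat A_2T=0$; (3) $\operatorname{rank}(ET)=d$, so that there is $Z_1$ of size $n\times d$ and full rank with $\operatorname{rank}(Z_1^TET)=d$. A *choice of class $C^m$ along the hypothesis*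 consists of $C^m$ functions $Z_2,T,Z_1$ on $\mathbb I$ with these properties at every $t$. *Inherent ODE.* Given a choice $Z_2,T,Z_1$ and a pointwise nonsingular $C^1$ function $Q=[\,T_2\ T_2'\,]$ with blocks of $d$ and $a$ columns such that $\hat A_{22}=\hat A_2T_2'$ is pointwise nonsingular, insert $x=Q\begin{bmatrix}x_1\\x_2\end{bmatrix}$ into the reduced DAE $$Z_1^TE\,\dot x=Z_1^TA\,x+Z_1^Tf,\qquad 0=\hat A_2x+Z_2^Tg_\mu ,$$ solve the second equation for $x_2=Rx_1+\rho$, where $R=-\hat A_{22}^{-1}\hat A_2T_2$ and $\rho=-\hat A_{22}^{-1}Z_2^Tg_\mu$, differentiate, and eliminate $x_2,\dot x_2$ from the first equation. If the resulting coefficient $Z_1^TE(T_2+T_2'R)$ of $\dot x_1$ is pointwise nonsingular, solving for $\dot x_1$ gives the inherent ODE $\dot x_1=L(t)x_1+\tilde f_1(t)$ fixed by $Q$. **Theorem.** For all $n,\mu$ there is $k\in\mathbb N$ such that the following holds for every $s\in\{0,1,2,\dots,\infty\}$. Let $E,A\in C^{s+k}(\mathbb I,\mathbb R^{n,n})$ be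 such that $(E,A)$ satisfies Hypothesis $(\mu,a,d)$ and is self-adjoint, i.e. $E^T=-E$ and $A^T=A+\dot E$. Then $d=2p$ is even, and with $J=\begin{bmatrix}0&I_p\\-I_p&0\end{bmatrix}$ there is a pointwise nonsingular $Q=[\,T_2\ T_2'\,]\in C^{s+1}(\mathbb I,\mathbb R^{n,n})$ such that: 1. (Restricted class.) $Q=O\begin{bmatrix}W_2&0\\0&I_a\end{bmatrix}$ with $O$ pointwise orthogonal and $W_2=\begin{bmatrix}I_p&0\\-\frac12G^{-1}H&G^{-1}\end{bmatrix}$, where $H$ is pointwise skew-symmetric, $G$ is pointwise nonsingular, and $O,H,G$ are of class $C^{s+1}$. Moreover $T_2^TET_2=J$, and for some $Z_2$ the functions $Z_2,\ T=T_2,\ Z_1=T_2$ are a choice of class $C^{s+1}$ along the hypothesis. 2. There is a pointwise symmetric $C\in C^s(\mathbb I,\mathbb R^{2p,2p})$ such that for every choice $Z_2,T,Z_1$ of class $C^1$ along the hypothesis the matrices $\hat A_{22}$ and $Z_1^TE(T_2+T_2'R)$ are pointwise nonsingular and the inherent ODE fixed by $Q$ is $$\dot x_1=J^{-1}C(t)x_1+\tilde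 f_1(t),$$ where, for every $f\in C^{s+k}(\mathbb I,\mathbb R^n)$, $\tilde f_1$ is of class $C^s$ and does not depend on the choice. 3. The flow of the inherent ODE is symplectic: for every $t_0\in\mathbb I$ the problem $\dot\Phi=J^{-1}C(t)\Phi$, $\Phi(t_0)=I_{2p}$ has a solution on $\mathbb I$, and every solution satisfies $\Phi(t)^TJ\Phi(t)=J$ for all $t\in\mathbb I$. -/

import Mathlib

open scoped Matrix

namespace LinDAE

noncomputable section

/-- Entrywise `C^m` regularity of a matrix function on the interval `I` (one-sided at end points). -/
def MatSmoothOn {ι κ : Type*} (m : ℕ∞) (I : Set ℝ) (X : ℝ → Matrix ι κ ℝ) : Prop :=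
  ∀ i j, ContDiffOn ℝ (m : WithTop ℕ∞) (fun t => X t i j) I

/-- Componentwise `C^m` regularity of a vector function on `I`. -/
def VecSmoothOn {ι : Type*} (m : ℕ∞) (I : Set ℝ) (f : ℝ → ι → ℝ) : Prop :=
  ∀ i, ContDiffOn ℝ (m : WithTop ℕ∞) (fun t => f t i) I

/-- The `k`-th derivative of a matrix function on `I`, taken entrywise. -/
def matIterDeriv {ι κ : Type*} (I : Set ℝ) (k : ℕ) (X : ℝ → Matrix ι κ ℝ) (t : ℝ) :
    Matrix ι κ ℝ :=
  Matrix.of fun i j => iteratedDerivWithin k (fun s => X s i j) I t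

/-- The first derivative of a matrix function on `I`, taken entrywise. -/
def matDeriv {ι κ : Type*} (I : Set ℝ) (X : ℝ → Matrix ι κ ℝ) (t : ℝ) : Matrix ι κ ℝ :=
  Matrix.of fun i j => derivWithin (fun s => X s i j) I t

/-- The first derivative of a vector function on `I`, taken componentwise. -/
def vecDeriv {ι : Type*} (I : Set ℝ) (f : ℝ → ι → ℝ) (t : ℝ) : ι → ℝ :=
  fun i => derivWithin (fun s => f s i) I t

/-- A (possibly differently indexed) matrix is nonsingular if it has a two-sided inverse. -/
def IsNonsingular {ι κ : Type*} [Fintype ι] [Fintype κ] [DecidableEq ι] [DecidableEq κ]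
    (X : Matrix ι κ ℝ) : Prop :=
  ∃ Y : Matrix κ ι ℝ, X * Y = 1 ∧ Y * X = 1

/-- Orthogonality of a (possibly differently indexed) matrix. -/
def IsOrthogonal {ι κ : Type*} [Fintype ι] [Fintype κ] [DecidableEq ι] [DecidableEq κ]
    (X : Matrix ι κ ℝ) : Prop :=
  Xᵀ * X = 1 ∧ X * Xᵀ = 1

/-- Self-adjointness of the pair `(E, A)` on `I`: `Eᵀ = -E` and `Aᵀ = A + Ė`. -/
def IsSelfAdjointPair {n : ℕ} (I : Set ℝ) (E A : ℝ → Matrix (Fin n) (Fin n) ℝ) : Prop :=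
  ∀ t ∈ I, (E t)ᵀ = -E t ∧ (A t)ᵀ = A t + matDeriv I E t

/-! ### Derivative array of `E ẋ = A x + f` -/

/-- The matrix `M_μ`. Block row `i` contains the coefficients of `x⁽¹⁾, …, x⁽μ⁺¹⁾` in
`(d/dt)ⁱ (E ẋ - A x)`; the coefficient of `x⁽ʲ⁺¹⁾` is
`(i choose j) E⁽ⁱ⁻ʲ⁾ - (i choose (j+1)) A⁽ⁱ⁻ʲ⁻¹⁾`, the binomials vanishing when the order
of differentiation would be negative. -/
def inflM {n : ℕ} (I : Set ℝ) (E A : ℝ → Matrix (Fin n) (Fin n) ℝ) (μ : ℕ) (t : ℝ) :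
    Matrix (Fin (μ + 1) × Fin n) (Fin (μ + 1) × Fin n) ℝ :=
  Matrix.of fun r c =>
    ((r.1 : ℕ).choose (c.1 : ℕ) : ℝ) * matIterDeriv I ((r.1 : ℕ) - (c.1 : ℕ)) E t r.2 c.2
      - ((r.1 : ℕ).choose ((c.1 : ℕ) + 1) : ℝ)
        * matIterDeriv I ((r.1 : ℕ) - (c.1 : ℕ) - 1) A t r.2 c.2

/-- The only nonzero block column `N_μ [I 0 ⋯ 0]ᵀ = [A; Ȧ; …; A⁽μ⁾]` of `N_μ`. -/
def inflN {n : ℕ} (I : Set ℝ) (A : ℝ → Matrix (Fin n) (Fin n) ℝ) (μ : ℕ) (t : ℝ) :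
    Matrix (Fin (μ + 1) × Fin n) (Fin n) ℝ :=
  Matrix.of fun r c => matIterDeriv I (r.1 : ℕ) A t r.2 c

/-- The vector `g_μ = [f; ḟ; …; f⁽μ⁾]`. -/
def inflg {n : ℕ} (I : Set ℝ) (f : ℝ → Fin n → ℝ) (μ : ℕ) (t : ℝ) : Fin (μ + 1) × Fin n → ℝ :=
  fun r => iteratedDerivWithin (r.1 : ℕ) (fun s => f s r.2) I t

/-! ### The regularity hypothesis -/

/-- The conditions on the values `Z₂, T₂, Z₁` at the time `t` in the three parts of the
regularity hypothesis. -/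
structure HypMatrices {n : ℕ} {α δ : Type*} [Fintype α] [Fintype δ]
    (I : Set ℝ) (E A : ℝ → Matrix (Fin n) (Fin n) ℝ) (μ : ℕ) (t : ℝ)
    (Z₂ : Matrix (Fin (μ + 1) × Fin n) α ℝ) (T₂ Z₁ : Matrix (Fin n) δ ℝ) : Prop where
  rank_Z₂ : Z₂.rank = Fintype.card α
  Z₂_M : Z₂ᵀ * inflM I E A μ t = 0
  rank_A₂ : (Z₂ᵀ * inflN I A μ t).rank = Fintype.card α
  rank_T₂ : T₂.rank = Fintype.card δ
  A₂_T₂ : (Z₂ᵀ * inflN I A μ t) * T₂ = 0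
  rank_E_T₂ : (E t * T₂).rank = Fintype.card δ
  rank_Z₁ : Z₁.rank = Fintype.card δ
  rank_E₁_T₂ : (Z₁ᵀ * E t * T₂).rank = Fintype.card δ

/-- The regularity hypothesis for the linear time-varying DAE with pair `(E, A)` and
characteristic values `μ, a, d`. Only the rank conditions are demanded, at each `t ∈ I`; smooth
dependence of `Z₂, T₂, Z₁` on `t` is not assumed here, since it can be achieved by the constancy
of the ranks. -/
def SatisfiesHyp {n : ℕ} (I : Set ℝ) (E A : ℝ → Matrix (Fin n) (Fin n) ℝ) (μ a d : ℕ) : Prop :=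
  d + a = n ∧ ∀ t ∈ I, (inflM I E A μ t).rank + a = (μ + 1) * n ∧
    ∃ (Z₂ : Matrix (Fin (μ + 1) × Fin n) (Fin a) ℝ) (T₂ Z₁ : Matrix (Fin n) (Fin d) ℝ),
      HypMatrices I E A μ t Z₂ T₂ Z₁

/-- A choice of `C^m` matrix functions `Z₂, T₂, Z₁` on `I` along the regularity hypothesis. -/
structure IsHypChoice {n : ℕ} {α δ : Type*} [Fintype α] [Fintype δ] (m : ℕ∞)
    (I : Set ℝ) (E A : ℝ → Matrix (Fin n) (Fin n) ℝ) (μ : ℕ)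
    (Z₂ : ℝ → Matrix (Fin (μ + 1) × Fin n) α ℝ) (T₂ Z₁ : ℝ → Matrix (Fin n) δ ℝ) : Prop where
  smooth_Z₂ : MatSmoothOn m I Z₂
  smooth_T₂ : MatSmoothOn m I T₂
  smooth_Z₁ : MatSmoothOn m I Z₁
  matrices : ∀ t ∈ I, HypMatrices I E A μ t (Z₂ t) (T₂ t) (Z₁ t)

/-! ### Inherent ODE

The reduced DAE given by `Z₁, Z₂` is `Z₁ᵀE ẋ = Z₁ᵀA x + Z₁ᵀf`, `0 = Â₂ x + f̂₂` with
`Â₂ = Z₂ᵀ N_μ [I 0 ⋯ 0]ᵀ`, `f̂₂ = Z₂ᵀ g_μ`. Inserting `x = Q [x₁; x₂]` gives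
`Ê₁₁ẋ₁ + Ê₁₂ẋ₂ = Â₁₁x₁ + Â₁₂x₂ + f̂₁`, `0 = Â₂₁x₁ + Â₂₂x₂ + f̂₂`. The second equation yields
`x₂ = R x₁ + ρ`, and eliminating `x₂` and `ẋ₂ = Ṙ x₁ + R ẋ₁ + ρ̇` yields
`(Ê₁₁ + Ê₁₂R) ẋ₁ = (Â₁₁ + Â₁₂R - Ê₁₂Ṙ) x₁ + f̂₁ + Â₁₂ρ - Ê₁₂ρ̇`. -/

section Inherent

variable {n : ℕ} {α δ : Type*} [Fintype α] [Fintype δ] [DecidableEq α] [DecidableEq δ]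

/-- `Â₂₁ = Â₂ T₂`, where `T₂` is the first block of columns of `Q`. -/
def hatA₂₁ (I : Set ℝ) (A : ℝ → Matrix (Fin n) (Fin n) ℝ) (μ : ℕ)
    (Z₂ : ℝ → Matrix (Fin (μ + 1) × Fin n) α ℝ) (Q : ℝ → Matrix (Fin n) (δ ⊕ α) ℝ) (t : ℝ) :
    Matrix α δ ℝ :=
  (Z₂ t)ᵀ * inflN I A μ t * (Q t).toCols₁

/-- `Â₂₂ = Â₂ T₂'`, where `T₂'` is the second block of columns of `Q`. -/
def hatA₂₂ (I : Set ℝ) (A : ℝ → Matrix (Fin n) (Fin n) ℝ) (μ : ℕ)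
    (Z₂ : ℝ → Matrix (Fin (μ + 1) × Fin n) α ℝ) (Q : ℝ → Matrix (Fin n) (δ ⊕ α) ℝ) (t : ℝ) :
    Matrix α α ℝ :=
  (Z₂ t)ᵀ * inflN I A μ t * (Q t).toCols₂

/-- `R = -Â₂₂⁻¹ Â₂₁` in `x₂ = R x₁ + ρ`. -/
def elimR (I : Set ℝ) (A : ℝ → Matrix (Fin n) (Fin n) ℝ) (μ : ℕ)
    (Z₂ : ℝ → Matrix (Fin (μ + 1) × Fin n) α ℝ) (Q : ℝ → Matrix (Fin n) (δ ⊕ α) ℝ) (t : ℝ) :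
    Matrix α δ ℝ :=
  -((hatA₂₂ I A μ Z₂ Q t)⁻¹ * hatA₂₁ I A μ Z₂ Q t)

/-- `ρ = -Â₂₂⁻¹ f̂₂` in `x₂ = R x₁ + ρ`. -/
def elimρ (I : Set ℝ) (A : ℝ → Matrix (Fin n) (Fin n) ℝ) (f : ℝ → Fin n → ℝ) (μ : ℕ)
    (Z₂ : ℝ → Matrix (Fin (μ + 1) × Fin n) α ℝ) (Q : ℝ → Matrix (Fin n) (δ ⊕ α) ℝ) (t : ℝ) :
    α → ℝ :=
  -((hatA₂₂ I A μ Z₂ Q t)⁻¹ *ᵥ ((Z₂ t)ᵀ *ᵥ inflg I f μ t))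

/-- The coefficient `Ê₁₁ + Ê₁₂ R` of `ẋ₁` after the elimination of `x₂`. -/
def elimE (I : Set ℝ) (E A : ℝ → Matrix (Fin n) (Fin n) ℝ) (μ : ℕ)
    (Z₂ : ℝ → Matrix (Fin (μ + 1) × Fin n) α ℝ) (Z₁ : ℝ → Matrix (Fin n) δ ℝ)
    (Q : ℝ → Matrix (Fin n) (δ ⊕ α) ℝ) (t : ℝ) : Matrix δ δ ℝ :=
  (Z₁ t)ᵀ * E t * (Q t).toCols₁ + (Z₁ t)ᵀ * E t * (Q t).toCols₂ * elimR I A μ Z₂ Q t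

/-- `Â₁₁ = Z₁ᵀ A T₂ - Z₁ᵀ E Ṫ₂`. -/
def hatA₁₁ (I : Set ℝ) (E A : ℝ → Matrix (Fin n) (Fin n) ℝ) (Z₁ : ℝ → Matrix (Fin n) δ ℝ)
    (Q : ℝ → Matrix (Fin n) (δ ⊕ α) ℝ) (t : ℝ) : Matrix δ δ ℝ :=
  (Z₁ t)ᵀ * A t * (Q t).toCols₁ - (Z₁ t)ᵀ * E t * (matDeriv I Q t).toCols₁

/-- `Â₁₂ = Z₁ᵀ A T₂' - Z₁ᵀ E Ṫ₂'`. -/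
def hatA₁₂ (I : Set ℝ) (E A : ℝ → Matrix (Fin n) (Fin n) ℝ) (Z₁ : ℝ → Matrix (Fin n) δ ℝ)
    (Q : ℝ → Matrix (Fin n) (δ ⊕ α) ℝ) (t : ℝ) : Matrix δ α ℝ :=
  (Z₁ t)ᵀ * A t * (Q t).toCols₂ - (Z₁ t)ᵀ * E t * (matDeriv I Q t).toCols₂

/-- The coefficient matrix of the inherent ODE `ẋ₁ = L x₁ + f̃₁` fixed by `Q`. -/
def inherentCoeff (I : Set ℝ) (E A : ℝ → Matrix (Fin n) (Fin n) ℝ) (μ : ℕ)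
    (Z₂ : ℝ → Matrix (Fin (μ + 1) × Fin n) α ℝ) (Z₁ : ℝ → Matrix (Fin n) δ ℝ)
    (Q : ℝ → Matrix (Fin n) (δ ⊕ α) ℝ) (t : ℝ) : Matrix δ δ ℝ :=
  (elimE I E A μ Z₂ Z₁ Q t)⁻¹ *
    (hatA₁₁ I E A Z₁ Q t + hatA₁₂ I E A Z₁ Q t * elimR I A μ Z₂ Q t
      - (Z₁ t)ᵀ * E t * (Q t).toCols₂ * matDeriv I (elimR I A μ Z₂ Q) t)

/-- The inhomogeneity `f̃₁` of the inherent ODE `ẋ₁ = L x₁ + f̃₁` fixed by `Q`. -/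
def inherentInhom (I : Set ℝ) (E A : ℝ → Matrix (Fin n) (Fin n) ℝ) (f : ℝ → Fin n → ℝ) (μ : ℕ)
    (Z₂ : ℝ → Matrix (Fin (μ + 1) × Fin n) α ℝ) (Z₁ : ℝ → Matrix (Fin n) δ ℝ)
    (Q : ℝ → Matrix (Fin n) (δ ⊕ α) ℝ) (t : ℝ) : δ → ℝ :=
  (elimE I E A μ Z₂ Z₁ Q t)⁻¹ *ᵥ
    ((Z₁ t)ᵀ *ᵥ f t + hatA₁₂ I E A Z₁ Q t *ᵥ elimρ I A f μ Z₂ Q t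
      - ((Z₁ t)ᵀ * E t * (Q t).toCols₂) *ᵥ vecDeriv I (elimρ I A f μ Z₂ Q) t)

end Inherent

/-! ### Flow and symplecticity -/

/-- `Φ` is the flow on `I` of `ẋ = L(t) x` with base point `t₀`: `Φ̇ = L Φ`, `Φ(t₀) = 1`. -/
def IsFlow {δ : Type*} [Fintype δ] [DecidableEq δ] (I : Set ℝ) (L : ℝ → Matrix δ δ ℝ) (t₀ : ℝ)
    (Φ : ℝ → Matrix δ δ ℝ) : Prop :=
  Φ t₀ = 1 ∧ ∀ t ∈ I, ∀ i j, HasDerivWithinAt (fun s => Φ s i j) ((L t * Φ t) i j) I t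

/-- `J = [0 I; -I 0]`. -/
def sympJ (p : ℕ) : Matrix (Fin p ⊕ Fin p) (Fin p ⊕ Fin p) ℝ := Matrix.fromBlocks 0 1 (-1) 0

/-- A matrix is symplectic if `GᵀJG = J` (in particular it is invertible). -/
def IsSymplectic {p : ℕ} (G : Matrix (Fin p ⊕ Fin p) (Fin p ⊕ Fin p) ℝ) : Prop :=
  Gᵀ * sympJ p * G = sympJ p

/-- The restricted class of transformations: `Q = O · diag(W₂, I_a)` with `O` pointwise orthogonal
and `W₂ = [I_p 0; -½ G⁻¹H  G⁻¹]`, where `H` is pointwise skew-symmetric and `G` is pointwise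
nonsingular, all of class `C^m`. The non-orthogonal factor `W₂` is block lower triangular with
identity in its first diagonal block. -/
def IsRestrictedTransformation {n p a : ℕ} (m : ℕ∞) (I : Set ℝ)
    (Q : ℝ → Matrix (Fin n) ((Fin p ⊕ Fin p) ⊕ Fin a) ℝ) : Prop :=
  ∃ (O : ℝ → Matrix (Fin n) ((Fin p ⊕ Fin p) ⊕ Fin a) ℝ) (H G : ℝ → Matrix (Fin p) (Fin p) ℝ),
    MatSmoothOn m I O ∧ MatSmoothOn m I H ∧ MatSmoothOn m I G ∧
    ∀ t ∈ I, IsOrthogonal (O t) ∧ (H t)ᵀ = -H t ∧ IsNonsingular (G t) ∧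
      Q t = O t * Matrix.fromBlocks
        (Matrix.fromBlocks 1 0 (-((1 / 2 : ℝ) • ((G t)⁻¹ * H t))) (G t)⁻¹) 0 0 1

end

end LinDAE

/-! Write `D x = E ẋ - A x`. Self-adjointness of the pair is Green's identity `(yᵀE x)˙ = y·Dx -
x·Dy`, and the theorem is linear algebra built on it. A smooth row `ζ` with `ζ M_μ = 0` is a
differential operator `P = ∑ ζᵢ (d/dt)ⁱ` for which `P D` is multiplication by `-ζN`: it produces a
hidden constraint. Taking formal adjoints, `y = P*1 = ∑ (-1)ⁱ ζᵢ⁽ⁱ⁾` solves `D y = -(ζN)ᵀ`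
(`IsNullRow.resid_adjointOp`). Thus every constraint has a companion function `y`, and integration
by parts against it gives two facts. The value `y(t)` is `E`-orthogonal to all consistent values
(`IsNullRow.boundary_add_eq_zero` with `f = 0`), and `y(t)` is orthogonal to `Dx - f` whenever `x`
satisfies all constraints for `f` (`IsNullRow.dotProduct_resid_sub_eq_zero`).

Let the columns of `T` span the consistent values. A jet argument (`eq_zero_of_forall_isNullRow`)
shows that the values `y(t)` are mapped onto `ℝᵃ` by `Â₂ = Z₂ᵀN`. They lie in `ker TᵀE`, which has
dimension `a`; hence they fill it and `Â₂` is injective there. Since `ker Â₂ = range T`, the form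
`TᵀE T` is nondegenerate. It is skew, so `d` is even, and orthogonality to `ker TᵀE` means that `Dx
- f` lies in `range (E T)` (`IsSelfAdjointRegular.exists_resid_sub_eq`).

A smooth orthonormal frame of `ker Â₂`, rotated so that its second half is Lagrangian for `TᵀE T`,
is brought to `T₂ᵀE T₂ = J` by the block triangular factor `W₂`. Since `Â₂T₂ = 0`, the elimination
has `R = 0`. The columns of `T₂` satisfy the constraints, so `A T₂ - E Ṫ₂ = E T₂ J⁻¹ C` with `C =
T₂ᵀ(A T₂ - E Ṫ₂)`, and `Z₁ᵀE T₂` cancels for every admissible `Z₁`. Differentiating `T₂ᵀE T₂ = J`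
shows that `C` is symmetric, which makes the flow symplectic. The same cancellation, applied to the
algebraic part `T₂'ρ`, gives the inhomogeneity. -/

namespace LinDAE

noncomputable section

/-! ### Entrywise calculus -/

/-- The entrywise `i`-th derivative of a vector function on `I`. -/
def jet {ι : Type*} (I : Set ℝ) (i : ℕ) (w : ℝ → ι → ℝ) (t : ℝ) : ι → ℝ :=
  fun c => iteratedDerivWithin i (fun s => w s c) I t

/-- `X'` is the entrywise derivative of the matrix function `X` within `I` at `t`. -/
def MatHasDeriv {ι κ : Type*} (I : Set ℝ) (X : ℝ → Matrix ι κ ℝ) (X' : Matrix ι κ ℝ) (t : ℝ) :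
    Prop :=
  ∀ i j, HasDerivWithinAt (fun s => X s i j) (X' i j) I t

/-- `x'` is the componentwise derivative of the vector function `x` within `I` at `t`. -/
def VecHasDeriv {ι : Type*} (I : Set ℝ) (x : ℝ → ι → ℝ) (x' : ι → ℝ) (t : ℝ) : Prop :=
  ∀ i, HasDerivWithinAt (fun s => x s i) (x' i) I t

section Calculus

variable {ι κ σ : Type*} {I : Set ℝ} {m : ℕ∞} {t : ℝ}

theorem contDiffOn_iteratedDerivWithin {f : ℝ → ℝ} (hI : UniqueDiffOn ℝ I) {i : ℕ}
    (hf : ContDiffOn ℝ ((m + i : ℕ∞) : WithTop ℕ∞) f I) :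
    ContDiffOn ℝ (m : WithTop ℕ∞) (iteratedDerivWithin i f I) I := by
  induction i generalizing f with
  | zero => simpa using hf
  | succ i ih =>
    rw [iteratedDerivWithin_succ']
    apply ih
    apply hf.derivWithin hI
    norm_cast
    rw [Nat.cast_succ, add_assoc]

theorem VecSmoothOn.mono {k : ℕ∞} {x : ℝ → ι → ℝ} (hx : VecSmoothOn m I x) (h : k ≤ m) :
    VecSmoothOn k I x := fun i => (hx i).of_le (by exact_mod_cast h)

theorem MatSmoothOn.mono {k : ℕ∞} {X : ℝ → Matrix ι κ ℝ} (hX : MatSmoothOn m I X) (h : k ≤ m) :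
    MatSmoothOn k I X := fun i j => (hX i j).of_le (by exact_mod_cast h)

theorem VecSmoothOn.jet (hI : UniqueDiffOn ℝ I) {i : ℕ} {x : ℝ → ι → ℝ}
    (hx : VecSmoothOn (m + i) I x) : VecSmoothOn m I (jet I i x) :=
  fun c => contDiffOn_iteratedDerivWithin hI (hx c)

theorem MatSmoothOn.matIterDeriv (hI : UniqueDiffOn ℝ I) {i : ℕ} {X : ℝ → Matrix ι κ ℝ}
    (hX : MatSmoothOn (m + i) I X) : MatSmoothOn m I (matIterDeriv I i X) :=
  fun r c => contDiffOn_iteratedDerivWithin hI (hX r c)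

theorem MatSmoothOn.matDeriv (hI : UniqueDiffOn ℝ I) {X : ℝ → Matrix ι κ ℝ}
    (hX : MatSmoothOn (m + 1) I X) : MatSmoothOn m I (matDeriv I X) :=
  fun r c => (hX r c).derivWithin hI (by norm_cast)

theorem VecSmoothOn.vecDeriv (hI : UniqueDiffOn ℝ I) {x : ℝ → ι → ℝ}
    (hx : VecSmoothOn (m + 1) I x) : VecSmoothOn m I (vecDeriv I x) :=
  fun r => (hx r).derivWithin hI (by norm_cast)

theorem MatSmoothOn.transpose {X : ℝ → Matrix ι κ ℝ} (hX : MatSmoothOn m I X) :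
    MatSmoothOn m I fun t => (X t)ᵀ := fun i j => hX j i

theorem MatSmoothOn.sub {X Y : ℝ → Matrix ι κ ℝ} (hX : MatSmoothOn m I X)
    (hY : MatSmoothOn m I Y) : MatSmoothOn m I fun t => X t - Y t :=
  fun i j => (hX i j).sub (hY i j)

theorem MatSmoothOn.neg {X : ℝ → Matrix ι κ ℝ} (hX : MatSmoothOn m I X) :
    MatSmoothOn m I fun t => -X t := fun i j => (hX i j).neg

theorem MatSmoothOn.smul {f : ℝ → ℝ} {X : ℝ → Matrix ι κ ℝ}
    (hf : ContDiffOn ℝ (m : WithTop ℕ∞) f I) (hX : MatSmoothOn m I X) :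
    MatSmoothOn m I fun t => f t • X t := fun i j => hf.mul (hX i j)

theorem MatSmoothOn.const (X : Matrix ι κ ℝ) : MatSmoothOn m I fun _ => X :=
  fun _ _ => contDiffOn_const

theorem MatSmoothOn.mul [Fintype κ] {X : ℝ → Matrix ι κ ℝ} {Y : ℝ → Matrix κ σ ℝ}
    (hX : MatSmoothOn m I X) (hY : MatSmoothOn m I Y) : MatSmoothOn m I fun t => X t * Y t :=
  fun i j => by
    simp only [Matrix.mul_apply]
    exact ContDiffOn.sum fun k _ => (hX i k).mul (hY k j)

theorem MatSmoothOn.mulVec [Fintype κ] {X : ℝ → Matrix ι κ ℝ} {x : ℝ → κ → ℝ}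
    (hX : MatSmoothOn m I X) (hx : VecSmoothOn m I x) : VecSmoothOn m I fun t => X t *ᵥ x t :=
  fun i => by
    simp only [Matrix.mulVec, dotProduct]
    exact ContDiffOn.sum fun k _ => (hX i k).mul (hx k)

theorem MatSmoothOn.vecMul [Fintype ι] {X : ℝ → Matrix ι κ ℝ} {x : ℝ → ι → ℝ}
    (hX : MatSmoothOn m I X) (hx : VecSmoothOn m I x) : VecSmoothOn m I fun t => x t ᵥ* X t :=
  fun i => by
    simp only [Matrix.vecMul, dotProduct]
    exact ContDiffOn.sum fun k _ => (hx k).mul (hX k i)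

theorem VecSmoothOn.add {x y : ℝ → ι → ℝ} (hx : VecSmoothOn m I x) (hy : VecSmoothOn m I y) :
    VecSmoothOn m I fun t => x t + y t := fun i => (hx i).add (hy i)

theorem VecSmoothOn.sub {x y : ℝ → ι → ℝ} (hx : VecSmoothOn m I x) (hy : VecSmoothOn m I y) :
    VecSmoothOn m I fun t => x t - y t := fun i => (hx i).sub (hy i)

theorem VecSmoothOn.neg {x : ℝ → ι → ℝ} (hx : VecSmoothOn m I x) :
    VecSmoothOn m I fun t => -x t := fun i => (hx i).neg

theorem VecSmoothOn.smul {f : ℝ → ℝ} {x : ℝ → ι → ℝ}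
    (hf : ContDiffOn ℝ (m : WithTop ℕ∞) f I) (hx : VecSmoothOn m I x) :
    VecSmoothOn m I fun t => f t • x t := fun i => hf.mul (hx i)

theorem contDiffOn_det [Fintype ι] [DecidableEq ι] {X : ℝ → Matrix ι ι ℝ}
    (hX : MatSmoothOn m I X) : ContDiffOn ℝ (m : WithTop ℕ∞) (fun t => (X t).det) I := by
  simp only [Matrix.det_apply']
  exact ContDiffOn.sum fun p _ => contDiffOn_const.mul (contDiffOn_prod fun i _ => hX _ _)

theorem MatSmoothOn.inv [Fintype ι] [DecidableEq ι] {X : ℝ → Matrix ι ι ℝ}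
    (hX : MatSmoothOn m I X) (h : ∀ t ∈ I, (X t).det ≠ 0) : MatSmoothOn m I fun t => (X t)⁻¹ := by
  have h1 : MatSmoothOn m I fun t => (X t).adjugate := by
    intro i j
    simp only [Matrix.adjugate_apply]
    apply contDiffOn_det
    intro a b
    by_cases hab : a = j
    · subst hab; simp only [Matrix.updateRow_self]; exact contDiffOn_const
    · simp only [Matrix.updateRow_ne hab]; exact hX a b
  simp only [Matrix.inv_def, Ring.inverse_eq_inv']
  exact MatSmoothOn.smul ((contDiffOn_det hX).inv h) h1

theorem MatSmoothOn.hasDeriv {X : ℝ → Matrix ι κ ℝ} (hX : MatSmoothOn m I X) (hm : 1 ≤ m)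
    (ht : t ∈ I) : MatHasDeriv I X (LinDAE.matDeriv I X t) t := fun i j =>
  (((hX i j).differentiableOn
    (by intro h; norm_cast at h; subst h; simp at hm)) t ht).hasDerivWithinAt

theorem VecSmoothOn.hasDeriv {x : ℝ → ι → ℝ} (hx : VecSmoothOn m I x) (hm : 1 ≤ m)
    (ht : t ∈ I) : VecHasDeriv I x (LinDAE.vecDeriv I x t) t := fun i =>
  (((hx i).differentiableOn
    (by intro h; norm_cast at h; subst h; simp at hm)) t ht).hasDerivWithinAt

theorem MatHasDeriv.matDeriv_eq (hI : UniqueDiffOn ℝ I) (ht : t ∈ I) {X : ℝ → Matrix ι κ ℝ}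
    {X' : Matrix ι κ ℝ} (h : MatHasDeriv I X X' t) : matDeriv I X t = X' := by
  ext i j; exact (h i j).derivWithin (hI t ht)

theorem VecHasDeriv.vecDeriv_eq (hI : UniqueDiffOn ℝ I) (ht : t ∈ I) {x : ℝ → ι → ℝ}
    {x' : ι → ℝ} (h : VecHasDeriv I x x' t) : vecDeriv I x t = x' := by
  ext i; exact (h i).derivWithin (hI t ht)

theorem MatHasDeriv.transpose {X : ℝ → Matrix ι κ ℝ} {X' : Matrix ι κ ℝ}
    (h : MatHasDeriv I X X' t) : MatHasDeriv I (fun s => (X s)ᵀ) X'ᵀ t := fun i j => h j i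

theorem MatHasDeriv.mul [Fintype κ] {X : ℝ → Matrix ι κ ℝ} {X' : Matrix ι κ ℝ}
    {Y : ℝ → Matrix κ σ ℝ} {Y' : Matrix κ σ ℝ} (hX : MatHasDeriv I X X' t)
    (hY : MatHasDeriv I Y Y' t) :
    MatHasDeriv I (fun s => X s * Y s) (X' * Y t + X t * Y') t := fun i j => by
  simp only [Matrix.mul_apply, Matrix.add_apply, ← Finset.sum_add_distrib]
  exact HasDerivWithinAt.fun_sum fun k _ => (hX i k).mul (hY k j)

theorem MatHasDeriv.mulVec [Fintype κ] {X : ℝ → Matrix ι κ ℝ} {X' : Matrix ι κ ℝ}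
    {x : ℝ → κ → ℝ} {x' : κ → ℝ} (hX : MatHasDeriv I X X' t)
    (hx : VecHasDeriv I x x' t) :
    VecHasDeriv I (fun s => X s *ᵥ x s) (X' *ᵥ x t + X t *ᵥ x') t := fun i => by
  simp only [Matrix.mulVec, dotProduct, Pi.add_apply, ← Finset.sum_add_distrib]
  exact HasDerivWithinAt.fun_sum fun k _ => (hX i k).mul (hx k)

theorem VecHasDeriv.dotProduct [Fintype ι] {x y : ℝ → ι → ℝ} {x' y' : ι → ℝ}
    (hx : VecHasDeriv I x x' t) (hy : VecHasDeriv I y y' t) :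
    HasDerivWithinAt (fun s => x s ⬝ᵥ y s) (x' ⬝ᵥ y t + x t ⬝ᵥ y') I t := by
  simp only [_root_.dotProduct, ← Finset.sum_add_distrib]
  exact HasDerivWithinAt.fun_sum fun k _ => (hx k).mul (hy k)

/-- Leibniz rule for the higher derivatives of a matrix-vector product. -/
theorem jet_mulVec [Fintype κ] (hI : UniqueDiffOn ℝ I) (ht : t ∈ I) {i : ℕ}
    {X : ℝ → Matrix ι κ ℝ} {x : ℝ → κ → ℝ}
    (hX : MatSmoothOn i I X) (hx : VecSmoothOn i I x) :
    jet I i (fun s => X s *ᵥ x s) t = ∑ j ∈ Finset.range (i + 1),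
      (i.choose j : ℝ) • (matIterDeriv I (i - j) X t *ᵥ jet I j x t) := by
  ext r
  simp only [jet, Matrix.mulVec, dotProduct, Finset.sum_apply, Pi.smul_apply, smul_eq_mul,
    Finset.mul_sum, matIterDeriv, Matrix.of_apply]
  rw [iteratedDerivWithin_fun_sum ht hI fun c _ => ((hX r c).mul (hx c)) t ht, Finset.sum_comm]
  refine Finset.sum_congr rfl fun c _ => ?_
  have := iteratedDerivWithin_mul ht hI (hx c t ht) (hX r c t ht)
  rw [show (fun s => X s r c * x s c) = (fun s => x s c) * (fun s => X s r c) by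
    ext s; simp [mul_comm], this]
  exact Finset.sum_congr rfl fun j _ => by ring

theorem jet_sub (hI : UniqueDiffOn ℝ I) (ht : t ∈ I) {i : ℕ} {x y : ℝ → ι → ℝ}
    (hx : VecSmoothOn i I x) (hy : VecSmoothOn i I y) :
    jet I i (fun s => x s - y s) t = jet I i x t - jet I i y t := by
  ext r
  exact iteratedDerivWithin_sub ht hI (hx r t ht) (hy r t ht)

theorem jet_zero (x : ℝ → ι → ℝ) : jet I 0 x t = x t := by
  ext; simp [jet]

theorem jet_vecDeriv (i : ℕ) (x : ℝ → ι → ℝ) : jet I i (vecDeriv I x) t = jet I (i + 1) x t := by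
  ext r
  simp only [jet, iteratedDerivWithin_succ']
  rfl

end Calculus

/-! ### The differential operator `E d/dt - A` and its formal adjoint -/

section Operator

variable {n μ : ℕ} {I : Set ℝ} {E A : ℝ → Matrix (Fin n) (Fin n) ℝ} {t : ℝ}

/-- The residual `E ẋ - A x`. -/
def resid (I : Set ℝ) (E A : ℝ → Matrix (Fin n) (Fin n) ℝ) (x : ℝ → Fin n → ℝ) (t : ℝ) :
    Fin n → ℝ :=
  E t *ᵥ vecDeriv I x t - A t *ᵥ x t

/-- The stacked derivatives `[ẋ; ẍ; …; x⁽μ⁺¹⁾]`. -/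
def derivStack (I : Set ℝ) (μ : ℕ) (x : ℝ → Fin n → ℝ) (t : ℝ) : Fin (μ + 1) × Fin n → ℝ :=
  fun q => jet I ((q.1 : ℕ) + 1) x t q.2

theorem VecSmoothOn.resid (hI : UniqueDiffOn ℝ I) {m : ℕ∞} {x : ℝ → Fin n → ℝ}
    (hE : MatSmoothOn m I E) (hA : MatSmoothOn m I A) (hx : VecSmoothOn (m + 1) I x) :
    VecSmoothOn m I (resid I E A x) :=
  (hE.mulVec (hx.vecDeriv hI)).sub (hA.mulVec (hx.mono le_self_add))

/-- The derivatives of the residual in terms of the derivative array. -/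
theorem inflg_resid (hI : UniqueDiffOn ℝ I) (ht : t ∈ I) {x : ℝ → Fin n → ℝ}
    (hE : MatSmoothOn μ I E) (hA : MatSmoothOn μ I A) (hx : VecSmoothOn (μ + 1) I x) :
    inflg I (resid I E A x) μ t
      = inflM I E A μ t *ᵥ derivStack I μ x t - inflN I A μ t *ᵥ x t := by
  ext ⟨i, r⟩
  have hi : (i : ℕ) ≤ μ := Nat.lt_succ_iff.mp i.2
  have hi' : ((i : ℕ) : ℕ∞) ≤ μ := by exact_mod_cast hi
  have hx1 : VecSmoothOn i I (vecDeriv I x) := (hx.vecDeriv hI).mono hi'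
  have hx0 : VecSmoothOn i I x := hx.mono (hi'.trans le_self_add)
  have e1 : inflg I (resid I E A x) μ t (i, r) = jet I i (resid I E A x) t r := rfl
  have e2 : jet I i (resid I E A x) t = _ :=
    jet_sub hI ht ((hE.mono hi').mulVec hx1) ((hA.mono hi').mulVec hx0)
  rw [e1, e2, jet_mulVec hI ht (hE.mono hi') hx1, jet_mulVec hI ht (hA.mono hi') hx0]
  simp only [jet_vecDeriv]
  set F : ℕ → Fin n → ℝ := fun j =>
    (((i : ℕ).choose j : ℝ) • matIterDeriv I (i - j) E t
      - ((i : ℕ).choose (j + 1) : ℝ) • matIterDeriv I (i - j - 1) A t) *ᵥ jet I (j + 1) x t with hF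
  have e3 : (inflM I E A μ t *ᵥ derivStack I μ x t) (i, r) = ∑ j ∈ Finset.range (μ + 1), F j r := by
    rw [Finset.sum_range fun j => F j r]
    simp only [Matrix.mulVec, dotProduct, Fintype.sum_prod_type, hF, inflM, derivStack,
      Matrix.of_apply, Matrix.sub_apply, Matrix.smul_apply, smul_eq_mul]
  -- Block row `i` of `M_μ` stops at column `i`: both binomials vanish for `j > i`.
  have e4 : ∑ j ∈ Finset.range (μ + 1), F j r = ∑ j ∈ Finset.range (i + 1), F j r := by
    symm
    apply Finset.sum_subset
    · intro j hj; simp only [Finset.mem_range] at hj ⊢; omega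
    · intro j _ hj
      have hj : (i : ℕ) < j := by simp only [Finset.mem_range] at hj; omega
      simp [hF, Nat.choose_eq_zero_of_lt hj,
        Nat.choose_eq_zero_of_lt (hj.trans (Nat.lt_succ_self j))]
  have e5 : (inflN I A μ t *ᵥ x t) (i, r) = (matIterDeriv I i A t *ᵥ jet I 0 x t) r := by
    rw [jet_zero]; rfl
  -- Index shift in the Leibniz sum for `A x`: the term with the undifferentiated `x` is the `N_μ`
  -- part, and the surplus top term on the right carries `i.choose (i + 1) = 0`.
  have e6 : ∑ j ∈ Finset.range ((i : ℕ) + 1),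
      (((i : ℕ).choose j : ℝ) • (matIterDeriv I (i - j) A t *ᵥ jet I j x t)) r
      = ∑ j ∈ Finset.range ((i : ℕ) + 1),
      (((i : ℕ).choose (j + 1) : ℝ) • (matIterDeriv I (i - j - 1) A t *ᵥ jet I (j + 1) x t)) r
      + (matIterDeriv I i A t *ᵥ jet I 0 x t) r := by
    rw [Finset.sum_range_succ']
    conv_rhs => rw [Finset.sum_range_succ]
    simp [Nat.sub_sub]
  simp only [Pi.sub_apply, Finset.sum_apply]
  rw [e3, e4, e5, e6, ← sub_sub, ← Finset.sum_sub_distrib]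
  congr 1
  refine Finset.sum_congr rfl fun j _ => ?_
  simp [hF, Matrix.sub_mulVec, Matrix.smul_mulVec]

/-- The formal adjoint `y = ∑ᵢ (-1)ⁱ (d/dt)ⁱ ζᵢ` of the operator with coefficient row `ζ`. -/
def adjointOp (I : Set ℝ) (ζ : ℝ → Fin (μ + 1) × Fin n → ℝ) (t : ℝ) : Fin n → ℝ :=
  ∑ i : Fin (μ + 1), (-1 : ℝ) ^ (i : ℕ) • jet I i (fun s c => ζ s (i, c)) t

/-- The scalar boundary term in `i`-fold integration by parts. -/
def lagrangeTerm (I : Set ℝ) (i : ℕ) (z w : ℝ → ℝ) (t : ℝ) : ℝ :=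
  ∑ k ∈ Finset.range i,
    (-1 : ℝ) ^ k * (iteratedDerivWithin k z I t * iteratedDerivWithin (i - 1 - k) w I t)

/-- Lagrange's identity for `(d/dt)ⁱ`: the alternating signs make the derivative of the boundary
term telescope. -/
theorem hasDerivWithinAt_lagrangeTerm (hI : UniqueDiffOn ℝ I) (ht : t ∈ I) {i : ℕ} {z w : ℝ → ℝ}
    (hz : ContDiffOn ℝ i z I) (hw : ContDiffOn ℝ i w I) :
    HasDerivWithinAt (lagrangeTerm I i z w)
      (z t * iteratedDerivWithin i w I t - (-1) ^ i * iteratedDerivWithin i z I t * w t) I t := by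
  have hD : ∀ {f : ℝ → ℝ}, ContDiffOn ℝ i f I → ∀ k < i,
      HasDerivWithinAt (iteratedDerivWithin k f I) (iteratedDerivWithin (k + 1) f I t) I t := by
    intro f hf k hk
    rw [iteratedDerivWithin_succ]
    exact (hf.differentiableOn_iteratedDerivWithin (by exact_mod_cast hk) hI t ht).hasDerivWithinAt
  have h1 : HasDerivWithinAt (lagrangeTerm I i z w)
      (∑ k ∈ Finset.range i, (-1 : ℝ) ^ k *
        (iteratedDerivWithin (k + 1) z I t * iteratedDerivWithin (i - 1 - k) w I t
          + iteratedDerivWithin k z I t * iteratedDerivWithin (i - 1 - k + 1) w I t)) I t := by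
    unfold lagrangeTerm
    apply HasDerivWithinAt.fun_sum
    intro k hk
    have hk := Finset.mem_range.mp hk
    exact ((hD hz k hk).mul (hD hw (i - 1 - k) (by omega))).const_mul _
  convert h1 using 1
  set a : ℕ → ℝ := fun k =>
    (-1 : ℝ) ^ k * (iteratedDerivWithin k z I t * iteratedDerivWithin (i - k) w I t) with ha
  have h2 := Finset.sum_range_sub' a i
  rw [show z t * iteratedDerivWithin i w I t - (-1) ^ i * iteratedDerivWithin i z I t * w t
    = a 0 - a i by simp [ha, mul_assoc], ← h2]
  refine Finset.sum_congr rfl fun k hk => ?_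
  have hk := Finset.mem_range.mp hk
  simp only [ha]
  rw [show i - 1 - k + 1 = i - k by omega, show i - (k + 1) = i - 1 - k by omega, pow_succ]
  ring

/-- The boundary term in the integration by parts for the operator with coefficient row `ζ`. -/
def boundary (I : Set ℝ) (ζ : ℝ → Fin (μ + 1) × Fin n → ℝ) (w : ℝ → Fin n → ℝ) (t : ℝ) : ℝ :=
  ∑ q : Fin (μ + 1) × Fin n, lagrangeTerm I q.1 (fun s => ζ s q) (fun s => w s q.2) t

theorem hasDerivWithinAt_boundary (hI : UniqueDiffOn ℝ I) (ht : t ∈ I)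
    {ζ : ℝ → Fin (μ + 1) × Fin n → ℝ} {w : ℝ → Fin n → ℝ}
    (hζ : VecSmoothOn μ I ζ) (hw : VecSmoothOn μ I w) :
    HasDerivWithinAt (boundary I ζ w) (ζ t ⬝ᵥ inflg I w μ t - adjointOp I ζ t ⬝ᵥ w t) I t := by
  have h1 : HasDerivWithinAt (boundary I ζ w)
      (∑ q : Fin (μ + 1) × Fin n, (ζ t q * iteratedDerivWithin q.1 (fun s => w s q.2) I t
        - (-1) ^ (q.1 : ℕ) * iteratedDerivWithin q.1 (fun s => ζ s q) I t * w t q.2)) I t := by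
    unfold boundary
    apply HasDerivWithinAt.fun_sum
    intro q _
    have hq : (((q.1 : ℕ) : ℕ∞) : WithTop ℕ∞) ≤ ((μ : ℕ∞) : WithTop ℕ∞) := by
      exact_mod_cast Nat.lt_succ_iff.mp q.1.2
    exact hasDerivWithinAt_lagrangeTerm hI ht ((hζ q).of_le hq) ((hw q.2).of_le hq)
  convert h1 using 1
  rw [Finset.sum_sub_distrib]
  congr 1
  simp only [adjointOp, dotProduct, Finset.sum_apply, Pi.smul_apply, smul_eq_mul,
    Fintype.sum_prod_type, Finset.sum_mul, jet]
  rw [Finset.sum_comm]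

/-- The boundary term sees `w` only through its derivatives of order below `μ` at `t`, all of which
are recorded in `inflg`. -/
theorem boundary_congr {ζ : ℝ → Fin (μ + 1) × Fin n → ℝ} {w w' : ℝ → Fin n → ℝ}
    (h : inflg I w μ t = inflg I w' μ t) : boundary I ζ w t = boundary I ζ w' t := by
  unfold boundary lagrangeTerm
  refine Finset.sum_congr rfl fun q _ => Finset.sum_congr rfl fun k hk => ?_
  have hk := Finset.mem_range.mp hk
  have hq := q.1.2
  have := congrFun h (⟨(q.1 : ℕ) - 1 - k, by omega⟩, q.2)
  simp only [inflg] at this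
  rw [this]

theorem boundary_eq_zero {ζ : ℝ → Fin (μ + 1) × Fin n → ℝ} {w : ℝ → Fin n → ℝ}
    (h : inflg I w μ t = 0) : boundary I ζ w t = 0 := by
  rw [boundary_congr (w' := fun _ _ => 0) (h.trans ?_)]
  · simp [boundary, lagrangeTerm, iteratedDerivWithin_fun_const_zero]
  · ext q; simp [inflg, iteratedDerivWithin_fun_const_zero]

/-- Green's identity. This is where self-adjointness of the pair enters: `Eᵀ = -E` exchanges the
derivative terms, and `Aᵀ = A + Ė` absorbs the derivative of `E`. -/
theorem hasDerivWithinAt_dotProduct_mulVec_of_selfAdjoint (ht : t ∈ I)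
    (hE : MatSmoothOn 1 I E) (hEA : IsSelfAdjointPair I E A) {x y : ℝ → Fin n → ℝ}
    (hx : VecSmoothOn 1 I x) (hy : VecSmoothOn 1 I y) :
    HasDerivWithinAt (fun s => y s ⬝ᵥ E s *ᵥ x s)
      (y t ⬝ᵥ resid I E A x t - x t ⬝ᵥ resid I E A y t) I t := by
  have h1 := (hy.hasDeriv le_rfl ht).dotProduct
    ((hE.hasDeriv le_rfl ht).mulVec (hx.hasDeriv le_rfl ht))
  convert h1 using 1
  obtain ⟨hs, ha⟩ := hEA t ht
  have e1 : x t ⬝ᵥ E t *ᵥ vecDeriv I y t = -(vecDeriv I y t ⬝ᵥ E t *ᵥ x t) := by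
    rw [Matrix.dotProduct_mulVec, ← Matrix.mulVec_transpose, hs, dotProduct_comm,
      Matrix.neg_mulVec, dotProduct_neg]
  have e2 : x t ⬝ᵥ A t *ᵥ y t = y t ⬝ᵥ A t *ᵥ x t + y t ⬝ᵥ matDeriv I E t *ᵥ x t := by
    rw [Matrix.dotProduct_mulVec, ← Matrix.mulVec_transpose, ha, dotProduct_comm,
      Matrix.add_mulVec, dotProduct_add]
  simp only [resid, dotProduct_sub, e1, e2, dotProduct_add]
  ring

end Operator

/-! ### Functions with prescribed jets -/

section Jets

variable {I : Set ℝ}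

/-- The derivative again has the form power times cofactor, with the exponent lowered by one, so
that inductions on the order can run over arbitrary cofactors. At `e` the new cofactor is `(L + 1) *
g e`, the source of the factorial. -/
theorem derivWithin_pow_succ_mul (hI : UniqueDiffOn ℝ I) {e : ℝ} {L : ℕ} {g : ℝ → ℝ}
    (hg : DifferentiableOn ℝ g I) :
    Set.EqOn (derivWithin (fun s => (s - e) ^ (L + 1) * g s) I)
      (fun s => (s - e) ^ L * ((L + 1) * g s + (s - e) * derivWithin g I s)) I := by
  intro s hs
  have h1 : HasDerivWithinAt g (derivWithin g I s) I s := (hg s hs).hasDerivWithinAt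
  have h2 : HasDerivWithinAt (fun s : ℝ => (s - e) ^ (L + 1)) ((L + 1) * (s - e) ^ L) I s := by
    simpa using ((((hasDerivAt_id s).sub_const e).fun_pow (L + 1)).hasDerivWithinAt (s := I))
  rw [(h2.fun_mul h1).derivWithin (hI s hs)]
  ring

/-- A function with an `L`-fold zero has vanishing derivatives of order less than `L`. -/
theorem iteratedDerivWithin_pow_mul_eq_zero (hI : UniqueDiffOn ℝ I) {e : ℝ} (he : e ∈ I) {L j : ℕ}
    (hj : j < L) {g : ℝ → ℝ} (hg : ContDiffOn ℝ j g I) :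
    iteratedDerivWithin j (fun s => (s - e) ^ L * g s) I e = 0 := by
  induction j generalizing L g with
  | zero => simp [Nat.ne_of_gt hj]
  | succ j ih =>
    obtain ⟨L, rfl⟩ : ∃ L', L = L' + 1 := ⟨L - 1, by omega⟩
    have hg' : ContDiffOn ℝ j (derivWithin g I) I := hg.derivWithin hI (by norm_cast)
    rw [iteratedDerivWithin_succ', iteratedDerivWithin_congr
      (derivWithin_pow_succ_mul hI (hg.differentiableOn (by norm_cast))) he]
    apply ih (by omega)
    apply ContDiffOn.add
    · exact contDiffOn_const.mul (hg.of_le (by norm_cast; omega))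
    · exact (contDiffOn_id.sub contDiffOn_const).mul hg'

/-- The first derivative of a function at an `L`-fold zero that need not vanish. -/
theorem iteratedDerivWithin_pow_mul_self (hI : UniqueDiffOn ℝ I) {e : ℝ} (he : e ∈ I) {L : ℕ}
    {g : ℝ → ℝ} (hg : ContDiffOn ℝ L g I) :
    iteratedDerivWithin L (fun s => (s - e) ^ L * g s) I e = L.factorial * g e := by
  induction L generalizing g with
  | zero => simp
  | succ L ih =>
    have hg' : ContDiffOn ℝ L (derivWithin g I) I := hg.derivWithin hI (by norm_cast)
    rw [iteratedDerivWithin_succ', iteratedDerivWithin_congr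
      (derivWithin_pow_succ_mul hI (hg.differentiableOn (by norm_cast))) he, ih]
    · simp [Nat.factorial_succ]; ring
    · apply ContDiffOn.add
      · exact contDiffOn_const.mul (hg.of_le (by norm_cast; omega))
      · exact (contDiffOn_id.sub contDiffOn_const).mul hg'

/-- Hermite interpolation with prescribed derivatives at one point and a zero at another. -/
theorem exists_contDiff_iteratedDerivWithin_eq (hI : UniqueDiffOn ℝ I) {e t₀ : ℝ} (he : e ∈ I)
    (ht₀ : t₀ ∈ I) (hne : t₀ ≠ e) (L : ℕ) (c : ℕ → ℝ) (m : ℕ) :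
    ∃ p : ℝ → ℝ, ContDiff ℝ (⊤ : ℕ∞) p ∧ (∀ j < m, iteratedDerivWithin j p I t₀ = c j) ∧
      ∀ j < L, iteratedDerivWithin j p I e = 0 := by
  induction m with
  | zero =>
    exact ⟨fun _ => 0, contDiff_const, by simp, fun j _ => by
      rw [iteratedDerivWithin_fun_const_zero]⟩
  | succ m ih =>
    obtain ⟨p, hp, h1, h2⟩ := ih
    -- The correction `α (s - t₀)ᵐ (s - e)ᴸ` leaves the lower derivatives at `t₀` and the zero at
    -- `e` untouched; `α` is the value that repairs the derivative of order `m`.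
    set α : ℝ := (c m - iteratedDerivWithin m p I t₀) / (m.factorial * (t₀ - e) ^ L) with hα
    have hpow : ∀ (a : ℝ) (k : ℕ), ContDiff ℝ (⊤ : ℕ∞) fun s : ℝ => (s - a) ^ k := fun a k =>
      (contDiff_id.sub contDiff_const).pow k
    set r : ℝ → ℝ := fun s => α * ((s - t₀) ^ m * (s - e) ^ L) with hr
    have hrs : ContDiff ℝ (⊤ : ℕ∞) r := contDiff_const.mul ((hpow _ _).mul (hpow _ _))
    have fin : ∀ {f : ℝ → ℝ}, ContDiff ℝ (⊤ : ℕ∞) f → ∀ j : ℕ, ContDiffOn ℝ j f I := fun hf j =>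
      (hf.of_le (by exact_mod_cast le_top)).contDiffOn
    have hadd : ∀ (j : ℕ) {s : ℝ}, s ∈ I → iteratedDerivWithin j (fun s => p s + r s) I s =
        iteratedDerivWithin j p I s + iteratedDerivWithin j r I s := fun j s hs =>
      iteratedDerivWithin_fun_add hs hI (fin hp j s hs) (fin hrs j s hs)
    have hr1 : r = fun s => (s - t₀) ^ m * (α * (s - e) ^ L) := by ext s; simp only [hr]; ring
    have hr2 : r = fun s => (s - e) ^ L * (α * (s - t₀) ^ m) := by ext s; simp only [hr]; ring
    refine ⟨fun s => p s + r s, hp.add hrs, fun j hj => ?_, fun j hj => ?_⟩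
    · rw [hadd j ht₀]
      rcases Nat.lt_succ_iff_lt_or_eq.mp hj with hj | rfl
      · rw [h1 j hj, hr1, iteratedDerivWithin_pow_mul_eq_zero hI ht₀ hj
          (fin (contDiff_const.mul (hpow _ _)) j), add_zero]
      · rw [hr1, iteratedDerivWithin_pow_mul_self hI ht₀ (fin (contDiff_const.mul (hpow _ _)) j),
          hα]
        have : (t₀ - e) ^ L ≠ 0 := pow_ne_zero _ (sub_ne_zero.mpr hne)
        have : (j.factorial : ℝ) ≠ 0 := by positivity
        field_simp
        ring
    · rw [hadd j he, h2 j hj, hr2, iteratedDerivWithin_pow_mul_eq_zero hI he hj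
        (fin (contDiff_const.mul (hpow _ _)) j), add_zero]

end Jets

/-! ### Null rows, adjoint solutions and integration by parts -/

section Core

variable {n μ : ℕ} {I : Set ℝ} {E A : ℝ → Matrix (Fin n) (Fin n) ℝ} {t t₁ t₂ : ℝ}
  {ζ : ℝ → Fin (μ + 1) × Fin n → ℝ}

theorem VecSmoothOn.adjointOp (hI : UniqueDiffOn ℝ I) {m : ℕ∞}
    (hζ : VecSmoothOn (m + μ) I ζ) : VecSmoothOn m I (adjointOp I ζ) := by
  intro c
  simp only [LinDAE.adjointOp, Finset.sum_apply, Pi.smul_apply, smul_eq_mul]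
  refine ContDiffOn.sum fun i _ => contDiffOn_const.mul ?_
  have hi : ((i : ℕ) : ℕ∞) ≤ μ := by exact_mod_cast Nat.lt_succ_iff.mp i.2
  exact VecSmoothOn.jet (m := m) (i := i) hI
    (fun c => (hζ (i, c)).of_le (by exact_mod_cast add_le_add_right hi m)) c

theorem MatSmoothOn.inflN (hI : UniqueDiffOn ℝ I) {m : ℕ∞} (hA : MatSmoothOn (m + μ) I A) :
    MatSmoothOn m I (inflN I A μ) := by
  intro q c
  have hi : ((q.1 : ℕ) : ℕ∞) ≤ μ := by exact_mod_cast Nat.lt_succ_iff.mp q.1.2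
  exact MatSmoothOn.matIterDeriv (m := m) (i := q.1) hI (hA.mono (add_le_add_right hi m)) q.2 c

theorem MatSmoothOn.inflM (hI : UniqueDiffOn ℝ I) {m : ℕ∞} (hE : MatSmoothOn (m + μ) I E)
    (hA : MatSmoothOn (m + μ) I A) : MatSmoothOn m I (inflM I E A μ) := by
  intro q c
  have hi : ∀ k : ℕ, k ≤ (q.1 : ℕ) → (k : ℕ∞) ≤ μ := fun k hk => by
    exact_mod_cast hk.trans (Nat.lt_succ_iff.mp q.1.2)
  refine ContDiffOn.sub (contDiffOn_const.mul ?_) (contDiffOn_const.mul ?_)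
  · exact MatSmoothOn.matIterDeriv (m := m) hI
      (hE.mono (add_le_add_right (hi _ (Nat.sub_le _ _)) m)) q.2 c.2
  · exact MatSmoothOn.matIterDeriv (m := m) hI
      (hA.mono (add_le_add_right (hi _ ((Nat.sub_le _ _).trans (Nat.sub_le _ _))) m)) q.2 c.2

/-- A smooth row function annihilating `M_μ`. -/
structure IsNullRow (I : Set ℝ) (E A : ℝ → Matrix (Fin n) (Fin n) ℝ)
    (ζ : ℝ → Fin (μ + 1) × Fin n → ℝ) : Prop where
  smooth : VecSmoothOn ((2 * μ + 2 : ℕ) : ℕ∞) I ζ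
  null : ∀ t ∈ I, ζ t ᵥ* inflM I E A μ t = 0

/-- The concomitant of `x` and the adjoint solution belonging to `ζ`. -/
def concomitant (I : Set ℝ) (E A : ℝ → Matrix (Fin n) (Fin n) ℝ)
    (ζ : ℝ → Fin (μ + 1) × Fin n → ℝ) (x : ℝ → Fin n → ℝ) (t : ℝ) : ℝ :=
  adjointOp I ζ t ⬝ᵥ E t *ᵥ x t + boundary I ζ (resid I E A x) t

theorem IsNullRow.adjointOp_smooth (hζ : IsNullRow I E A ζ) (hI : UniqueDiffOn ℝ I) :
    VecSmoothOn ((μ + 2 : ℕ) : ℕ∞) I (adjointOp I ζ) :=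
  VecSmoothOn.adjointOp hI (hζ.smooth.mono (by norm_cast; omega))

/-- Add Green's identity for `x, y` to the integration by parts of `ζ` against the jets of `D x`.
The terms `y·Dx` cancel, and `ζ M_μ = 0` removes all derivatives of `x`, so only the value `x t`
remains. -/
theorem IsNullRow.hasDerivWithinAt_concomitant (hζ : IsNullRow I E A ζ) (hI : UniqueDiffOn ℝ I)
    (ht : t ∈ I) (hE : MatSmoothOn ((2 * μ + 2 : ℕ) : ℕ∞) I E)
    (hA : MatSmoothOn ((2 * μ + 2 : ℕ) : ℕ∞) I A)
    (hEA : IsSelfAdjointPair I E A) {x : ℝ → Fin n → ℝ} (hx : VecSmoothOn ((μ + 1 : ℕ) : ℕ∞) I x) :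
    HasDerivWithinAt (concomitant I E A ζ x)
      (-(x t ⬝ᵥ (resid I E A (adjointOp I ζ) t + ζ t ᵥ* inflN I A μ t))) I t := by
  have c1 : ((μ : ℕ) : ℕ∞) ≤ ((2 * μ + 2 : ℕ) : ℕ∞) := by norm_cast; omega
  have c2 : (1 : ℕ∞) ≤ ((2 * μ + 2 : ℕ) : ℕ∞) := by norm_cast; omega
  have h1 := hasDerivWithinAt_dotProduct_mulVec_of_selfAdjoint ht (hE.mono c2) hEA
    (hx.mono (by norm_cast; omega)) ((hζ.adjointOp_smooth hI).mono (by norm_cast; omega))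
  have hres : VecSmoothOn μ I (resid I E A x) :=
    VecSmoothOn.resid hI (hE.mono c1) (hA.mono c1) (by exact_mod_cast hx)
  have h2 := hasDerivWithinAt_boundary hI ht (hζ.smooth.mono c1) hres
  refine (h1.add h2).congr_deriv ?_
  rw [inflg_resid hI ht (hE.mono c1) (hA.mono c1) (by exact_mod_cast hx), dotProduct_sub,
    Matrix.dotProduct_mulVec, hζ.null t ht, Matrix.dotProduct_mulVec, dotProduct_add,
    dotProduct_comm (x t) (ζ t ᵥ* _)]
  simp
  ring

/-- The order `μ + 1` must be included because the last block column of `M_μ` multiplies `x⁽μ⁺¹⁾`.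
-/
theorem concomitant_eq_zero (hI : UniqueDiffOn ℝ I) (ht : t ∈ I)
    (hE : MatSmoothOn μ I E) (hA : MatSmoothOn μ I A) {x : ℝ → Fin n → ℝ}
    (hx : VecSmoothOn (μ + 1) I x) (h0 : ∀ j < μ + 2, jet I j x t = 0) :
    concomitant I E A ζ x t = 0 := by
  have hx0 : x t = 0 := by rw [← jet_zero (I := I) x]; exact h0 0 (by omega)
  have hxd : derivStack I μ x t = 0 := by
    ext q
    simp only [derivStack]
    rw [h0 _ (by omega)]
    rfl
  rw [concomitant, boundary_eq_zero, hx0]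
  · simp
  · rw [inflg_resid hI ht hE hA hx, hx0, hxd]; simp

/-- The adjoint operator produces solutions of the self-adjoint DAE with inhomogeneity
`-ζ N_μ`. -/
theorem IsNullRow.resid_adjointOp (h12 : t₁ < t₂) (hζ : IsNullRow (Set.Icc t₁ t₂) E A ζ)
    (hE : MatSmoothOn ((2 * μ + 2 : ℕ) : ℕ∞) (Set.Icc t₁ t₂) E)
    (hA : MatSmoothOn ((2 * μ + 2 : ℕ) : ℕ∞) (Set.Icc t₁ t₂) A)
    (hEA : IsSelfAdjointPair (Set.Icc t₁ t₂) E A) (ht : t ∈ Set.Icc t₁ t₂) :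
    resid (Set.Icc t₁ t₂) E A (adjointOp (Set.Icc t₁ t₂) ζ) t
      = -(ζ t ᵥ* inflN (Set.Icc t₁ t₂) A μ t) := by
  set I := Set.Icc t₁ t₂ with hIdef
  have hI : UniqueDiffOn ℝ I := uniqueDiffOn_Icc h12
  -- The defect to be shown zero. Regularity count: `ζ` of class `C^(2μ+2)` gives `y` of class
  -- `C^(μ+2)` and `q` of class `C^(μ+1)`, just enough to use a multiple of `q` as the test function
  -- `x`.
  set q : ℝ → Fin n → ℝ := fun t =>
    resid I E A (adjointOp I ζ) t + ζ t ᵥ* inflN I A μ t with hq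
  have c1 : ((μ : ℕ) : ℕ∞) ≤ ((2 * μ + 2 : ℕ) : ℕ∞) := by norm_cast; omega
  have c2 : ((μ + 1 : ℕ) : ℕ∞) ≤ ((2 * μ + 2 : ℕ) : ℕ∞) := by norm_cast; omega
  have hqs : VecSmoothOn ((μ + 1 : ℕ) : ℕ∞) I q := by
    refine VecSmoothOn.add (VecSmoothOn.resid hI (hE.mono c2) (hA.mono c2)
      (by exact_mod_cast hζ.adjointOp_smooth hI)) ?_
    exact (MatSmoothOn.inflN hI (hA.mono (by norm_cast; omega))).vecMul (hζ.smooth.mono c2)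
  set h : ℝ → ℝ := fun s => (s - t₁) ^ (μ + 2) * (t₂ - s) ^ (μ + 2) with hh
  have hpow : ∀ a : ℝ, ContDiffOn ℝ (((μ + 1 : ℕ) : ℕ∞) : WithTop ℕ∞)
      (fun s : ℝ => (s - a) ^ (μ + 2)) I :=
    fun a => ((contDiff_id.sub contDiff_const).pow _).contDiffOn
  have hpow' : ContDiffOn ℝ (((μ + 1 : ℕ) : ℕ∞) : WithTop ℕ∞)
      (fun s : ℝ => (t₂ - s) ^ (μ + 2)) I :=
    ((contDiff_const.sub contDiff_id).pow _).contDiffOn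
  have hhs : ContDiffOn ℝ (((μ + 1 : ℕ) : ℕ∞) : WithTop ℕ∞) h I := (hpow t₁).mul hpow'
  set x : ℝ → Fin n → ℝ := fun s => h s • q s with hx
  have hxs : VecSmoothOn ((μ + 1 : ℕ) : ℕ∞) I x := VecSmoothOn.smul hhs hqs
  have hlow : ∀ {f : ℝ → ℝ}, ContDiffOn ℝ (((μ + 1 : ℕ) : ℕ∞) : WithTop ℕ∞) f I →
      ∀ j < μ + 2, ContDiffOn ℝ j f I := fun hf j hj => hf.of_le (by norm_cast; omega)
  have ht1 : t₁ ∈ I := Set.left_mem_Icc.mpr h12.le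
  have ht2 : t₂ ∈ I := Set.right_mem_Icc.mpr h12.le
  have hG1 : concomitant I E A ζ x t₁ = 0 := by
    refine concomitant_eq_zero hI ht1 (hE.mono c1) (hA.mono c1) (by exact_mod_cast hxs) ?_
    intro j hj
    ext c
    have : (fun s => x s c) = fun s => (s - t₁) ^ (μ + 2) * ((t₂ - s) ^ (μ + 2) * q s c) := by
      ext s; simp [hx, hh, mul_assoc]
    simp only [jet, this]
    exact iteratedDerivWithin_pow_mul_eq_zero hI ht1 hj (hlow (hpow'.mul (hqs c)) j hj)
  have hG2 : concomitant I E A ζ x t₂ = 0 := by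
    refine concomitant_eq_zero hI ht2 (hE.mono c1) (hA.mono c1) (by exact_mod_cast hxs) ?_
    intro j hj
    ext c
    have : (fun s => x s c)
        = fun s => (s - t₂) ^ (μ + 2) * ((-1) ^ (μ + 2) * ((s - t₁) ^ (μ + 2) * q s c)) := by
      ext s
      simp only [hx, hh, Pi.smul_apply, smul_eq_mul]
      rw [show t₂ - s = (-1) * (s - t₂) by ring, mul_pow]
      ring
    simp only [jet, this]
    exact iteratedDerivWithin_pow_mul_eq_zero hI ht2 hj
      (hlow (contDiffOn_const.mul ((hpow t₁).mul (hqs c))) j hj)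
  have hD : ∀ s ∈ I, HasDerivWithinAt (concomitant I E A ζ x) (-(h s * (q s ⬝ᵥ q s))) I s := by
    intro s hs
    have := hζ.hasDerivWithinAt_concomitant hI hs hE hA hEA hxs
    rwa [show x s = h s • q s from rfl, smul_dotProduct, smul_eq_mul] at this
  have hnn : ∀ s ∈ I, 0 ≤ h s := fun s hs =>
    mul_nonneg (pow_nonneg (sub_nonneg.mpr hs.1) _) (pow_nonneg (sub_nonneg.mpr hs.2) _)
  have hqq : ∀ s, 0 ≤ q s ⬝ᵥ q s := fun s => Finset.sum_nonneg fun i _ => mul_self_nonneg _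
  -- The concomitant has derivative `-h |q|² ≤ 0` and equal end values, so it is constant. This
  -- replaces the integral in the usual variational argument.
  have hanti : AntitoneOn (concomitant I E A ζ x) I := by
    apply antitoneOn_of_hasDerivWithinAt_nonpos (convex_Icc t₁ t₂)
      (f' := fun s => -(h s * (q s ⬝ᵥ q s)))
    · exact fun s hs => (hD s hs).continuousWithinAt
    · exact fun s hs => (hD s (interior_subset hs)).mono interior_subset
    · exact fun s hs => neg_nonpos.mpr (mul_nonneg (hnn s (interior_subset hs)) (hqq s))
  have hzero : ∀ s ∈ I, concomitant I E A ζ x s = 0 := fun s hs => le_antisymm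
    (hG1 ▸ hanti ht1 hs hs.1) (hG2 ▸ hanti hs ht2 hs.2)
  have hq0 : Set.EqOn q 0 (Set.Ioo t₁ t₂) := by
    intro s hs
    have hsI : s ∈ I := Set.Ioo_subset_Icc_self hs
    have e1 := (hD s hsI).derivWithin (hI s hsI)
    rw [derivWithin_congr (f := fun _ => (0 : ℝ)) hzero (hzero s hsI)] at e1
    have hpos : 0 < h s := mul_pos (pow_pos (sub_pos.mpr hs.1) _) (pow_pos (sub_pos.mpr hs.2) _)
    have e2 : q s ⬝ᵥ q s = 0 := by
      rw [derivWithin_fun_const] at e1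
      have : h s * (q s ⬝ᵥ q s) = 0 := by simpa using e1.symm
      exact (mul_eq_zero.mp this).resolve_left hpos.ne'
    exact dotProduct_self_eq_zero.mp e2
  have hqc : ContinuousOn q I := continuousOn_pi.mpr fun i => (hqs i).continuousOn
  have hq1 : Set.EqOn q 0 I := hq0.of_subset_closure hqc continuousOn_const
    Set.Ioo_subset_Icc_self (by rw [closure_Ioo h12.ne])
  exact eq_neg_of_add_eq_zero_left (hq1 ht)

/-- The value of the boundary term at consistent data. -/
theorem IsNullRow.boundary_add_eq_zero (h12 : t₁ < t₂) (hζ : IsNullRow (Set.Icc t₁ t₂) E A ζ)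
    (hE : MatSmoothOn ((2 * μ + 2 : ℕ) : ℕ∞) (Set.Icc t₁ t₂) E)
    (hA : MatSmoothOn ((2 * μ + 2 : ℕ) : ℕ∞) (Set.Icc t₁ t₂) A)
    (hEA : IsSelfAdjointPair (Set.Icc t₁ t₂) E A) (ht : t ∈ Set.Icc t₁ t₂)
    {f : ℝ → Fin n → ℝ} {x₀ : Fin n → ℝ} {Y : Fin (μ + 1) × Fin n → ℝ}
    (hY : inflM (Set.Icc t₁ t₂) E A μ t *ᵥ Y
      = inflN (Set.Icc t₁ t₂) A μ t *ᵥ x₀ + inflg (Set.Icc t₁ t₂) f μ t) :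
    adjointOp (Set.Icc t₁ t₂) ζ t ⬝ᵥ E t *ᵥ x₀ + boundary (Set.Icc t₁ t₂) ζ f t = 0 := by
  set I := Set.Icc t₁ t₂ with hIdef
  have hI : UniqueDiffOn ℝ I := uniqueDiffOn_Icc h12
  have c1 : ((μ : ℕ) : ℕ∞) ≤ ((2 * μ + 2 : ℕ) : ℕ∞) := by norm_cast; omega
  -- The concomitant is now constant in time for every `x`. An `x` with the given jet at `t` that
  -- vanishes to high order at a second point `e` shows that the constant is zero.
  obtain ⟨e, he, hne⟩ : ∃ e ∈ I, t ≠ e := by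
    by_cases h : t = t₁
    · exact ⟨t₂, Set.right_mem_Icc.mpr h12.le, by rw [h]; exact h12.ne⟩
    · exact ⟨t₁, Set.left_mem_Icc.mpr h12.le, h⟩
  -- Block `j` of `Y` is the derivative of order `j + 1`, hence the shift `j - 1`; order `0` is
  -- given by `x₀`.
  choose p hp hp1 hp2 using fun c : Fin n =>
    exists_contDiff_iteratedDerivWithin_eq hI he ht hne (μ + 2)
      (fun j => if h : 1 ≤ j ∧ j < μ + 2 then Y (⟨j - 1, by omega⟩, c) else x₀ c) (μ + 2)
  set x : ℝ → Fin n → ℝ := fun s c => p c s with hx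
  have hxs : VecSmoothOn ((μ + 1 : ℕ) : ℕ∞) I x := fun c =>
    ((hp c).of_le (by exact_mod_cast le_top)).contDiffOn
  have hxt : x t = x₀ := by
    ext c; simpa using hp1 c 0 (by omega)
  have hxd : derivStack I μ x t = Y := by
    ext ⟨j, c⟩
    have := hp1 c (j + 1) (by omega)
    rw [dif_pos (by omega)] at this
    simpa [derivStack, jet, hx] using this
  have hG : ∀ s ∈ I, HasDerivWithinAt (concomitant I E A ζ x) 0 I s := by
    intro s hs
    have := hζ.hasDerivWithinAt_concomitant hI hs hE hA hEA hxs
    rwa [hζ.resid_adjointOp h12 hE hA hEA hs, neg_add_cancel, dotProduct_zero, neg_zero] at this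
  have hconst : ∀ s ∈ I, concomitant I E A ζ x s = concomitant I E A ζ x t₁ := fun s hs =>
    constant_of_derivWithin_zero (fun s hs => (hG s hs).differentiableWithinAt)
      (fun s hs => (hG s (Set.Ico_subset_Icc_self hs)).derivWithin
        (hI s (Set.Ico_subset_Icc_self hs))) s hs
  have hz : concomitant I E A ζ x t = 0 := by
    rw [hconst t ht, ← hconst e he]
    refine concomitant_eq_zero hI he (hE.mono c1) (hA.mono c1) (by exact_mod_cast hxs) ?_
    intro j hj
    ext c
    exact hp2 c j hj
  rw [concomitant, hxt] at hz
  rw [← hz]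
  congr 1
  apply boundary_congr
  rw [inflg_resid hI ht (hE.mono c1) (hA.mono c1) (by exact_mod_cast hxs), hxt, hxd, hY]
  simp

/-- By `IsNullRow.boundary_add_eq_zero` the function `yᵀE x + boundary ζ f` vanishes identically. In
its derivative, `-x·Dy` and `ζ·g_μ` cancel, because `D y = -ζN` and consistency gives `ζ·g_μ = -ζN
x`. What remains is `y·(Dx - f)`. -/
theorem IsNullRow.dotProduct_resid_sub_eq_zero (h12 : t₁ < t₂)
    (hζ : IsNullRow (Set.Icc t₁ t₂) E A ζ)
    (hE : MatSmoothOn ((2 * μ + 2 : ℕ) : ℕ∞) (Set.Icc t₁ t₂) E)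
    (hA : MatSmoothOn ((2 * μ + 2 : ℕ) : ℕ∞) (Set.Icc t₁ t₂) A)
    (hEA : IsSelfAdjointPair (Set.Icc t₁ t₂) E A)
    {f x : ℝ → Fin n → ℝ} (hf : VecSmoothOn μ (Set.Icc t₁ t₂) f)
    (hx : VecSmoothOn 1 (Set.Icc t₁ t₂) x)
    (hY : ∀ t ∈ Set.Icc t₁ t₂, ∃ Y, inflM (Set.Icc t₁ t₂) E A μ t *ᵥ Y
      = inflN (Set.Icc t₁ t₂) A μ t *ᵥ x t + inflg (Set.Icc t₁ t₂) f μ t)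
    (ht : t ∈ Set.Icc t₁ t₂) :
    adjointOp (Set.Icc t₁ t₂) ζ t ⬝ᵥ (resid (Set.Icc t₁ t₂) E A x t - f t) = 0 := by
  set I := Set.Icc t₁ t₂ with hIdef
  have hI : UniqueDiffOn ℝ I := uniqueDiffOn_Icc h12
  have c1 : ((μ : ℕ) : ℕ∞) ≤ ((2 * μ + 2 : ℕ) : ℕ∞) := by norm_cast; omega
  have c2 : (1 : ℕ∞) ≤ ((2 * μ + 2 : ℕ) : ℕ∞) := by norm_cast; omega
  have h1 := (hasDerivWithinAt_dotProduct_mulVec_of_selfAdjoint ht (hE.mono c2) hEA hx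
    ((hζ.adjointOp_smooth hI).mono (by norm_cast; omega))).add
    (hasDerivWithinAt_boundary hI ht (hζ.smooth.mono c1) hf)
  have hz : ∀ s ∈ I,
      ((fun s => adjointOp I ζ s ⬝ᵥ E s *ᵥ x s) + boundary I ζ f) s = 0 := fun s hs => by
    obtain ⟨Y, hY⟩ := hY s hs
    exact hζ.boundary_add_eq_zero h12 hE hA hEA hs hY
  have e1 := h1.derivWithin (hI t ht)
  rw [derivWithin_congr (f := fun _ => (0 : ℝ)) hz (hz t ht), derivWithin_fun_const] at e1
  obtain ⟨Y, hY⟩ := hY t ht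
  have e2 : ζ t ⬝ᵥ inflg I f μ t = -(x t ⬝ᵥ (ζ t ᵥ* inflN I A μ t)) := by
    have := congrArg (fun v => ζ t ⬝ᵥ v) hY
    simp only [dotProduct_add, Matrix.dotProduct_mulVec, hζ.null t ht, zero_dotProduct] at this
    rw [dotProduct_comm (x t)]
    linarith
  rw [hζ.resid_adjointOp h12 hE hA hEA ht, e2, dotProduct_neg] at e1
  rw [dotProduct_sub]
  simp only [Pi.zero_apply] at e1
  linarith

end Core

/-! ### Rank conditions as statements about vectors -/

section Rank

variable {ι κ σ : Type*} [Fintype σ]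

theorem mulVec_injective_of_rank_eq_card {Y : Matrix κ σ ℝ} (h : Y.rank = Fintype.card σ) :
    Function.Injective Y.mulVec := by
  have h1 := Y.mulVecLin.finrank_range_add_finrank_ker
  rw [Module.finrank_fintype_fun_eq_card] at h1
  have h2 : Module.finrank ℝ (LinearMap.ker Y.mulVecLin) = 0 := by
    have : Module.finrank ℝ (LinearMap.range Y.mulVecLin) = Y.rank := rfl
    omega
  exact LinearMap.ker_eq_bot.mp (Submodule.finrank_eq_zero.mp h2)

theorem eq_zero_of_mulVec_eq_zero_of_rank {Y : Matrix κ σ ℝ} (h : Y.rank = Fintype.card σ)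
    {v : σ → ℝ} (hv : Y *ᵥ v = 0) : v = 0 :=
  mulVec_injective_of_rank_eq_card h (by simpa using hv)

theorem rank_eq_card_of_mulVec {Y : Matrix κ σ ℝ} (h : ∀ v, Y *ᵥ v = 0 → v = 0) :
    Y.rank = Fintype.card σ := by
  have h1 := Y.mulVecLin.finrank_range_add_finrank_ker
  rw [Module.finrank_fintype_fun_eq_card] at h1
  have h2 : LinearMap.ker Y.mulVecLin = ⊥ := LinearMap.ker_eq_bot'.mpr fun v hv => h v hv
  rw [h2, finrank_bot, add_zero] at h1
  exact h1

/-- Exactness of `X * Y = 0` by a dimension count. -/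
theorem exists_mulVec_eq_of_mulVec_eq_zero [Fintype κ] {X : Matrix ι κ ℝ}
    {Y : Matrix κ σ ℝ} (h : X * Y = 0) (hr : X.rank + Y.rank = Fintype.card κ) {v : κ → ℝ}
    (hv : X *ᵥ v = 0) :
    ∃ u, Y *ᵥ u = v := by
  have h1 := X.mulVecLin.finrank_range_add_finrank_ker
  rw [Module.finrank_fintype_fun_eq_card] at h1
  have hle : LinearMap.range Y.mulVecLin ≤ LinearMap.ker X.mulVecLin := by
    rintro _ ⟨u, rfl⟩
    simp [Matrix.mulVec_mulVec, h]
  have heq := Submodule.eq_of_le_of_finrank_eq hle (by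
    have e1 : Module.finrank ℝ (LinearMap.range Y.mulVecLin) = Y.rank := rfl
    have e2 : Module.finrank ℝ (LinearMap.range X.mulVecLin) = X.rank := rfl
    omega)
  have hmem : v ∈ LinearMap.range Y.mulVecLin := by rw [heq]; exact hv
  exact hmem

end Rank

/-! ### Consistent values and the left null space of the derivative array -/

section Core

variable {n μ a : ℕ} {I : Set ℝ} {E A : ℝ → Matrix (Fin n) (Fin n) ℝ} {t t₁ t₂ : ℝ}

/-- `v` is a consistent value of the homogeneous DAE at `t`. -/
def IsConsistent (I : Set ℝ) (E A : ℝ → Matrix (Fin n) (Fin n) ℝ) (μ : ℕ) (t : ℝ)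
    (v : Fin n → ℝ) : Prop :=
  ∀ z, z ᵥ* inflM I E A μ t = 0 → z ⬝ᵥ inflN I A μ t *ᵥ v = 0

/-- The rank conditions of the hypothesis at `t` without reference to a choice of bases. -/
structure IsRegularAt (I : Set ℝ) (E A : ℝ → Matrix (Fin n) (Fin n) ℝ) (μ a : ℕ) (t : ℝ) :
    Prop where
  rank : (inflM I E A μ t).rank + a = (μ + 1) * n
  eq_zero_of_null : ∀ z, z ᵥ* inflM I E A μ t = 0 → z ᵥ* inflN I A μ t = 0 → z = 0
  eq_zero_of_consistent : ∀ v, IsConsistent I E A μ t v → E t *ᵥ v = 0 → v = 0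

/-- The columns of `Z` form a basis of the left null space of `M_μ`. -/
structure IsNullBasis (I : Set ℝ) (E A : ℝ → Matrix (Fin n) (Fin n) ℝ) (μ : ℕ) (t : ℝ)
    (Z : Matrix (Fin (μ + 1) × Fin n) (Fin a) ℝ) : Prop where
  rank : Z.rank = a
  mul_eq_zero : Zᵀ * inflM I E A μ t = 0

variable {Z : Matrix (Fin (μ + 1) × Fin n) (Fin a) ℝ}

theorem IsNullBasis.exists_eq (hZ : IsNullBasis I E A μ t Z)
    (hr : (inflM I E A μ t).rank + a = (μ + 1) * n) {z : Fin (μ + 1) × Fin n → ℝ}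
    (hz : z ᵥ* inflM I E A μ t = 0) : ∃ β, Z *ᵥ β = z := by
  apply exists_mulVec_eq_of_mulVec_eq_zero (X := (inflM I E A μ t)ᵀ)
  · rw [← Matrix.transpose_transpose Z, ← Matrix.transpose_mul, hZ.mul_eq_zero,
      Matrix.transpose_zero]
  · rw [Matrix.rank_transpose, hZ.rank, hr]; simp
  · rw [Matrix.mulVec_transpose, hz]

theorem IsNullBasis.exists_mulVec_eq (hZ : IsNullBasis I E A μ t Z)
    (hr : (inflM I E A μ t).rank + a = (μ + 1) * n) {w : Fin (μ + 1) × Fin n → ℝ}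
    (hw : Zᵀ *ᵥ w = 0) : ∃ Y, inflM I E A μ t *ᵥ Y = w := by
  apply exists_mulVec_eq_of_mulVec_eq_zero hZ.mul_eq_zero _ hw
  rw [Matrix.rank_transpose, hZ.rank, add_comm, hr]; simp

theorem IsNullBasis.vecMul_eq_zero (hZ : IsNullBasis I E A μ t Z) (β : Fin a → ℝ) :
    (Z *ᵥ β) ᵥ* inflM I E A μ t = 0 := by
  rw [← Matrix.vecMul_transpose, Matrix.vecMul_vecMul, hZ.mul_eq_zero, Matrix.vecMul_zero]

theorem IsNullBasis.isConsistent_iff (hZ : IsNullBasis I E A μ t Z)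
    (hr : (inflM I E A μ t).rank + a = (μ + 1) * n) {v : Fin n → ℝ} :
    IsConsistent I E A μ t v ↔ (Zᵀ * inflN I A μ t) *ᵥ v = 0 := by
  constructor
  · intro h
    ext i
    have := h (Z *ᵥ Pi.single i 1) (hZ.vecMul_eq_zero _)
    rw [← Matrix.vecMul_transpose, ← Matrix.dotProduct_mulVec, Matrix.mulVec_mulVec] at this
    simpa using this
  · intro h z hz
    obtain ⟨β, rfl⟩ := hZ.exists_eq hr hz
    rw [← Matrix.vecMul_transpose, ← Matrix.dotProduct_mulVec, Matrix.mulVec_mulVec, h,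
      dotProduct_zero]

theorem IsConsistent.exists_mulVec_eq {v : Fin n → ℝ} (hv : IsConsistent I E A μ t v)
    (hZ : IsNullBasis I E A μ t Z) (hr : (inflM I E A μ t).rank + a = (μ + 1) * n) :
    ∃ Y, inflM I E A μ t *ᵥ Y = inflN I A μ t *ᵥ v :=
  hZ.exists_mulVec_eq hr (by rw [Matrix.mulVec_mulVec]; exact (hZ.isConsistent_iff hr).mp hv)

/-- The leading coefficient of a functional annihilating the derivative array is annihilated
by `E`. -/
theorem leading_vecMul_eq_zero {z : Fin (μ + 1) × Fin n → ℝ} (hz : z ᵥ* inflM I E A μ t = 0)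
    {m : Fin (μ + 1)} (hm : ∀ i, m < i → ∀ c, z (i, c) = 0) :
    (fun c => z (m, c)) ᵥ* E t = 0 := by
  ext c
  have h1 := congrFun hz (m, c)
  simp only [Matrix.vecMul, dotProduct, Fintype.sum_prod_type, Pi.zero_apply] at h1 ⊢
  -- Read off block column `m` of `z M_μ = 0`: `M_μ` is block lower triangular with diagonal blocks
  -- `E`, and `z` has no blocks beyond `m`.
  rw [Finset.sum_eq_single m] at h1
  · rw [← h1]
    refine Finset.sum_congr rfl fun r _ => ?_
    simp [inflM, matIterDeriv]
  · intro i _ hi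
    rcases lt_or_gt_of_ne hi with h | h
    · have h' : (i : ℕ) < m := h
      simp [inflM, Nat.choose_eq_zero_of_lt h',
        Nat.choose_eq_zero_of_lt (h'.trans (Nat.lt_succ_self _))]
    · simp [hm i h]
  · simp

/-- A null functional is determined by its values on the functions `ζ N_μ`. -/
theorem eq_zero_of_forall_isNullRow (hI : UniqueDiffOn ℝ I) (ht : t ∈ I)
    (hA : MatSmoothOn ((2 * μ + 2 : ℕ) : ℕ∞) I A) (hEA : IsSelfAdjointPair I E A)
    (hreg : IsRegularAt I E A μ a t)
    {Z : ℝ → Matrix (Fin (μ + 1) × Fin n) (Fin a) ℝ}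
    (hZs : MatSmoothOn ((2 * μ + 2 : ℕ) : ℕ∞) I Z) (hZ : ∀ s ∈ I, IsNullBasis I E A μ s (Z s))
    {z : Fin (μ + 1) × Fin n → ℝ} (hz : z ᵥ* inflM I E A μ t = 0)
    (h : ∀ ζ : ℝ → Fin (μ + 1) × Fin n → ℝ, IsNullRow I E A ζ →
      z ⬝ᵥ inflg I (fun s => ζ s ᵥ* inflN I A μ s) μ t = 0) : z = 0 := by
  by_contra hne
  -- The last nonzero block of `z` will turn out to be a consistent value in the kernel of `E`,
  -- which regularity forbids.
  have hex : ∃ m : Fin (μ + 1), (fun c => z (m, c)) ≠ 0 ∧ ∀ i, m < i → ∀ c, z (i, c) = 0 := by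
    obtain ⟨q, hq⟩ := Function.ne_iff.mp hne
    set S : Finset (Fin (μ + 1)) := Finset.univ.filter fun m => ∃ c, z (m, c) ≠ 0 with hS
    have hSn : S.Nonempty := ⟨q.1, by simpa [hS] using ⟨q.2, hq⟩⟩
    have hmem := S.max'_mem hSn
    obtain ⟨c, hc⟩ := (Finset.mem_filter.mp hmem).2
    refine ⟨S.max' hSn, fun h0 => hc (congrFun h0 c), fun i hi c => ?_⟩
    by_contra hic
    exact absurd (S.le_max' i (by simpa [hS] using ⟨c, hic⟩)) (not_le.mpr hi)
  obtain ⟨m, hm0, hm⟩ := hex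
  apply hm0
  apply hreg.eq_zero_of_consistent
  · rw [(hZ t ht).isConsistent_iff hreg.rank]
    apply dotProduct_self_eq_zero.mp
    -- With this `β` and `ζ₀ = Z β`, the pairing of block `m` with `ζ₀N` at `t` is `|β|²`.
    set β : Fin a → ℝ := ((Z t)ᵀ * inflN I A μ t) *ᵥ (fun c => z (m, c)) with hβ
    set ζ₀ : ℝ → Fin (μ + 1) × Fin n → ℝ := fun s => Z s *ᵥ β with hζ₀
    have hζ₀s : VecSmoothOn ((2 * μ + 2 : ℕ) : ℕ∞) I ζ₀ := hZs.mulVec fun _ => contDiffOn_const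
    have hpow : ContDiffOn ℝ (((2 * μ + 2 : ℕ) : ℕ∞) : WithTop ℕ∞)
        (fun s : ℝ => (s - t) ^ (m : ℕ)) I := ((contDiff_id.sub contDiff_const).pow _).contDiffOn
    -- Null rows may be multiplied by scalar functions. The factor `(s - t)ᵐ` kills the derivatives
    -- of order below `m` at `t`, and `z` kills those above, so only order `m` is tested.
    have hζ : IsNullRow I E A fun s => (s - t) ^ (m : ℕ) • ζ₀ s := by
      refine ⟨VecSmoothOn.smul hpow hζ₀s, fun s hs => ?_⟩
      rw [Matrix.smul_vecMul, (hZ s hs).vecMul_eq_zero, smul_zero]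
    set b : ℝ → Fin n → ℝ := fun s => ζ₀ s ᵥ* inflN I A μ s with hb
    have hbs : VecSmoothOn μ I b := (MatSmoothOn.inflN hI (hA.mono (by norm_cast; omega))).vecMul
      (hζ₀s.mono (by norm_cast; omega))
    have h1 := h _ hζ
    have hjet : ∀ (i : Fin (μ + 1)) (c : Fin n), z (i, c) *
        inflg I (fun s => ((s - t) ^ (m : ℕ) • ζ₀ s) ᵥ* inflN I A μ s) μ t (i, c)
        = if i = m then (m : ℕ).factorial * (z (m, c) * b t c) else 0 := by
      intro i c
      have e1 : inflg I (fun s => ((s - t) ^ (m : ℕ) • ζ₀ s) ᵥ* inflN I A μ s) μ t (i, c)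
          = iteratedDerivWithin i (fun s => (s - t) ^ (m : ℕ) * b s c) I t := by
        simp only [inflg, Matrix.smul_vecMul, Pi.smul_apply, smul_eq_mul, hb]
      have hlow : ContDiffOn ℝ i (fun s => b s c) I :=
        (hbs c).of_le (by exact_mod_cast Nat.lt_succ_iff.mp i.2)
      rw [e1]
      split_ifs with him
      · subst him
        rw [iteratedDerivWithin_pow_mul_self hI ht hlow]; ring
      · rcases lt_or_gt_of_ne him with h' | h'
        · rw [iteratedDerivWithin_pow_mul_eq_zero hI ht h' hlow, mul_zero]
        · rw [hm i h', zero_mul]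
    rw [dotProduct, Fintype.sum_prod_type] at h1
    simp only [hjet] at h1
    rw [Finset.sum_eq_single m (fun i _ hi => by simp [hi]) (by simp)] at h1
    simp only [if_true, ← Finset.mul_sum] at h1
    have h2 : (fun c => z (m, c)) ⬝ᵥ b t = 0 :=
      (mul_eq_zero.mp h1).resolve_left (by positivity)
    have h3 : (fun c => z (m, c)) ⬝ᵥ b t = β ⬝ᵥ β := by
      conv_rhs => rw [hβ]
      rw [← hβ, hb, hζ₀]
      simp only []
      rw [← Matrix.vecMul_transpose, Matrix.vecMul_vecMul, dotProduct_comm,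
        ← Matrix.dotProduct_mulVec]
    rw [← h3, h2]
  · have h1 := leading_vecMul_eq_zero hz hm
    rw [← Matrix.mulVec_transpose, (hEA t ht).1, Matrix.neg_mulVec, neg_eq_zero] at h1
    exact h1

end Core

/-! ### Nondegeneracy of `E` on the consistent values -/

section Nondegenerate

variable {n μ a : ℕ} {E A : ℝ → Matrix (Fin n) (Fin n) ℝ} {t t₁ t₂ : ℝ}
  {δ : Type*} [Fintype δ]

theorem inflg_congr {I : Set ℝ} (ht : t ∈ I) {f g : ℝ → Fin n → ℝ} (h : ∀ s ∈ I, f s = g s) :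
    inflg I f μ t = inflg I g μ t := by
  ext q
  exact iteratedDerivWithin_congr (fun s hs => by rw [h s hs]) ht

theorem inflg_neg {I : Set ℝ} {f : ℝ → Fin n → ℝ} :
    inflg I (fun s => -f s) μ t = -inflg I f μ t := by
  ext q
  simp only [inflg, Pi.neg_apply]
  rw [iteratedDerivWithin_fun_neg]

/-- The data of a self-adjoint DAE satisfying the hypothesis, with a smooth basis `Z` of the
left null space of `M_μ`. -/
structure IsSelfAdjointRegular (t₁ t₂ : ℝ) (E A : ℝ → Matrix (Fin n) (Fin n) ℝ) (μ a : ℕ)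
    (Z : ℝ → Matrix (Fin (μ + 1) × Fin n) (Fin a) ℝ) : Prop where
  lt : t₁ < t₂
  smooth_E : MatSmoothOn ((2 * μ + 2 : ℕ) : ℕ∞) (Set.Icc t₁ t₂) E
  smooth_A : MatSmoothOn ((2 * μ + 2 : ℕ) : ℕ∞) (Set.Icc t₁ t₂) A
  selfAdjoint : IsSelfAdjointPair (Set.Icc t₁ t₂) E A
  regular : ∀ t ∈ Set.Icc t₁ t₂, IsRegularAt (Set.Icc t₁ t₂) E A μ a t
  smooth_Z : MatSmoothOn ((2 * μ + 2 : ℕ) : ℕ∞) (Set.Icc t₁ t₂) Z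
  basis_Z : ∀ t ∈ Set.Icc t₁ t₂, IsNullBasis (Set.Icc t₁ t₂) E A μ t (Z t)

variable {Z : ℝ → Matrix (Fin (μ + 1) × Fin n) (Fin a) ℝ}

/-- The values at `t` of the adjoint solutions. -/
def adjointValues (I : Set ℝ) (E A : ℝ → Matrix (Fin n) (Fin n) ℝ) (μ : ℕ) (t : ℝ) :
    Submodule ℝ (Fin n → ℝ) :=
  Submodule.span ℝ {w | ∃ ζ : ℝ → Fin (μ + 1) × Fin n → ℝ, IsNullRow I E A ζ ∧ adjointOp I ζ t = w}

/-- Suppose `β` annihilates the image and put `z = Zβ`. The rows `ζN` are `-D y`, so their jets are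
`-(M_μ(⋯) - N y)`. Since `z M_μ = 0`, pairing with `z` leaves `β·(ZᵀN y) = 0`, and
`eq_zero_of_forall_isNullRow` yields `z = 0`. -/
theorem IsSelfAdjointRegular.map_adjointValues (h : IsSelfAdjointRegular t₁ t₂ E A μ a Z)
    (ht : t ∈ Set.Icc t₁ t₂) :
    (adjointValues (Set.Icc t₁ t₂) E A μ t).map
      ((Z t)ᵀ * inflN (Set.Icc t₁ t₂) A μ t).mulVecLin = ⊤ := by
  set I := Set.Icc t₁ t₂
  have hI : UniqueDiffOn ℝ I := uniqueDiffOn_Icc h.lt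
  by_contra hne
  obtain ⟨f, hf0, hf⟩ := Submodule.exists_le_ker_of_lt_top _ (lt_top_iff_ne_top.mpr hne)
  -- The coordinates of the functional `f`, so that `f` becomes the dot product with `β`.
  set β : Fin a → ℝ := fun i => f (Pi.single i 1) with hβ
  have hfβ : ∀ w, f w = β ⬝ᵥ w := fun w => by
    rw [LinearMap.pi_apply_eq_sum_univ f w]
    simp only [dotProduct, smul_eq_mul, hβ]
    refine Finset.sum_congr rfl fun i _ => ?_
    rw [mul_comm]
    congr 2
    ext j
    simp [Pi.single_apply, eq_comm]
  have hz : Z t *ᵥ β = 0 := by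
    apply eq_zero_of_forall_isNullRow hI ht h.smooth_A h.selfAdjoint (h.regular t ht) h.smooth_Z
      h.basis_Z ((h.basis_Z t ht).vecMul_eq_zero β)
    intro ζ hζ
    have h1 : ∀ s ∈ I, ζ s ᵥ* inflN I A μ s = -resid I E A (adjointOp I ζ) s := fun s hs => by
      rw [hζ.resid_adjointOp h.lt h.smooth_E h.smooth_A h.selfAdjoint hs, neg_neg]
    rw [inflg_congr ht h1, inflg_neg, inflg_resid hI ht (h.smooth_E.mono (by norm_cast; omega))
      (h.smooth_A.mono (by norm_cast; omega))
      ((hζ.adjointOp_smooth hI).mono (by norm_cast; omega)), dotProduct_neg, dotProduct_sub,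
      Matrix.dotProduct_mulVec, (h.basis_Z t ht).vecMul_eq_zero β, zero_dotProduct, zero_sub,
      neg_neg, ← Matrix.vecMul_transpose, ← Matrix.dotProduct_mulVec, Matrix.mulVec_mulVec, ← hfβ]
    exact hf ⟨_, Submodule.subset_span ⟨ζ, hζ, rfl⟩, rfl⟩
  have hβ0 : β = 0 := eq_zero_of_mulVec_eq_zero_of_rank
    (by rw [(h.basis_Z t ht).rank, Fintype.card_fin]) hz
  exact hf0 (LinearMap.ext fun w => by rw [hfβ, hβ0]; simp)

/-- The columns of `T` form a basis of the space of consistent values. -/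
structure IsConsistentBasis (I : Set ℝ) (E A : ℝ → Matrix (Fin n) (Fin n) ℝ) (μ : ℕ) (t : ℝ)
    (T : Matrix (Fin n) δ ℝ) : Prop where
  rank : T.rank = Fintype.card δ
  consistent : ∀ u, IsConsistent I E A μ t (T *ᵥ u)

variable {T : Matrix (Fin n) δ ℝ}

theorem IsSelfAdjointRegular.rank_transpose_mul (h : IsSelfAdjointRegular t₁ t₂ E A μ a Z)
    (ht : t ∈ Set.Icc t₁ t₂) (hT : IsConsistentBasis (Set.Icc t₁ t₂) E A μ t T) :
    (E t * T).rank = Fintype.card δ ∧ (Tᵀ * E t).rank = Fintype.card δ := by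
  have h1 : (E t * T).rank = Fintype.card δ := by
    apply rank_eq_card_of_mulVec
    intro v hv
    rw [← Matrix.mulVec_mulVec] at hv
    exact eq_zero_of_mulVec_eq_zero_of_rank hT.rank
      ((h.regular t ht).eq_zero_of_consistent _ (hT.consistent v) hv)
  refine ⟨h1, ?_⟩
  rw [← Matrix.rank_transpose, Matrix.transpose_mul, Matrix.transpose_transpose,
    (h.selfAdjoint t ht).1, Matrix.neg_mul, ← h1]
  apply le_antisymm
  · rw [show -(E t * T) = (-1 : Matrix (Fin n) (Fin n) ℝ) * (E t * T) by simp]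
    exact Matrix.rank_mul_le_right _ _
  · rw [show (E t * T).rank = ((-1 : Matrix (Fin n) (Fin n) ℝ) * -(E t * T)).rank by simp]
    exact Matrix.rank_mul_le_right _ _

/-- A dimension count: the adjoint values lie in `ker TᵀE`, of dimension `n - d = a`, and are mapped
onto `ℝᵃ`. Hence they fill this kernel, and the surjection `ZᵀN` between spaces of equal dimension
is injective. -/
theorem IsSelfAdjointRegular.adjointValues_eq (h : IsSelfAdjointRegular t₁ t₂ E A μ a Z)
    (ht : t ∈ Set.Icc t₁ t₂) (hT : IsConsistentBasis (Set.Icc t₁ t₂) E A μ t T)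
    (hcard : Fintype.card δ + a = n) :
    adjointValues (Set.Icc t₁ t₂) E A μ t = LinearMap.ker (Tᵀ * E t).mulVecLin ∧
      ∀ w, (Tᵀ * E t) *ᵥ w = 0 → ((Z t)ᵀ * inflN (Set.Icc t₁ t₂) A μ t) *ᵥ w = 0 → w = 0 := by
  set I := Set.Icc t₁ t₂ with hIdef
  set Φ := ((Z t)ᵀ * inflN I A μ t).mulVecLin with hΦ
  have hI : UniqueDiffOn ℝ I := uniqueDiffOn_Icc h.lt
  classical
  have hle : adjointValues I E A μ t ≤ LinearMap.ker (Tᵀ * E t).mulVecLin := by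
    apply Submodule.span_le.mpr
    rintro _ ⟨ζ, hζ, rfl⟩
    rw [SetLike.mem_coe, LinearMap.mem_ker, Matrix.mulVecLin_apply]
    ext i
    obtain ⟨Y, hY⟩ := (hT.consistent (Pi.single i 1)).exists_mulVec_eq (h.basis_Z t ht)
      (h.regular t ht).rank
    have h0 : inflg I (fun _ => (0 : Fin n → ℝ)) μ t = 0 := by
      ext q; simp [inflg, iteratedDerivWithin_fun_const_zero]
    have := hζ.boundary_add_eq_zero (f := fun _ => 0) h.lt h.smooth_E h.smooth_A h.selfAdjoint ht
      (by rw [h0, add_zero]; exact hY)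
    rw [boundary_eq_zero h0, add_zero, Matrix.mulVec_mulVec, Matrix.dotProduct_mulVec,
      ← Matrix.mulVec_transpose, Matrix.transpose_mul, (h.selfAdjoint t ht).1, Matrix.mul_neg,
      Matrix.neg_mulVec, neg_dotProduct] at this
    simpa using this
  have hker : Module.finrank ℝ (LinearMap.ker (Tᵀ * E t).mulVecLin) = a := by
    have h1 := (Tᵀ * E t).mulVecLin.finrank_range_add_finrank_ker
    rw [Module.finrank_fintype_fun_eq_card, Fintype.card_fin] at h1
    have h2 : Module.finrank ℝ (LinearMap.range (Tᵀ * E t).mulVecLin) = (Tᵀ * E t).rank := rfl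
    rw [(h.rank_transpose_mul ht hT).2] at h2
    omega
  have hmap := h.map_adjointValues ht
  have hge : a ≤ Module.finrank ℝ (adjointValues I E A μ t) := by
    have := Submodule.finrank_map_le Φ (adjointValues I E A μ t)
    rw [hmap, finrank_top, Module.finrank_fintype_fun_eq_card, Fintype.card_fin] at this
    exact this
  have heq : adjointValues I E A μ t = LinearMap.ker (Tᵀ * E t).mulVecLin :=
    Submodule.eq_of_le_of_finrank_le hle (by rw [hker]; exact hge)
  refine ⟨heq, ?_⟩
  have hsurj : Function.Surjective (Φ.domRestrict (LinearMap.ker (Tᵀ * E t).mulVecLin)) := by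
    rw [← LinearMap.range_eq_top, LinearMap.range_domRestrict, ← heq, hmap]
  have hinj := (LinearMap.injective_iff_surjective_of_finrank_eq_finrank
    (by rw [hker, Module.finrank_fintype_fun_eq_card, Fintype.card_fin])).mpr hsurj
  intro w hw hw'
  have : (⟨w, hw⟩ : LinearMap.ker (Tᵀ * E t).mulVecLin) = 0 := hinj (by rw [map_zero]; exact hw')
  exact congrArg Subtype.val this

/-- The restriction of `E` to the space of consistent values is nondegenerate. -/
theorem IsSelfAdjointRegular.eq_zero_of_transpose_mul_mul
    (h : IsSelfAdjointRegular t₁ t₂ E A μ a Z)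
    (ht : t ∈ Set.Icc t₁ t₂) (hT : IsConsistentBasis (Set.Icc t₁ t₂) E A μ t T)
    (hcard : Fintype.card δ + a = n) {u : δ → ℝ} (hu : (Tᵀ * E t * T) *ᵥ u = 0) : u = 0 := by
  apply eq_zero_of_mulVec_eq_zero_of_rank hT.rank
  apply (h.adjointValues_eq ht hT hcard).2
  · rw [Matrix.mulVec_mulVec, hu]
  · exact ((h.basis_Z t ht).isConsistent_iff (h.regular t ht).rank).mp (hT.consistent u)

/-- Residuals of functions satisfying the constraints lie in the range of `E T`. -/
theorem IsSelfAdjointRegular.exists_resid_sub_eq [DecidableEq δ]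
    (h : IsSelfAdjointRegular t₁ t₂ E A μ a Z)
    (ht : t ∈ Set.Icc t₁ t₂) (hT : IsConsistentBasis (Set.Icc t₁ t₂) E A μ t T)
    (hcard : Fintype.card δ + a = n) {f x : ℝ → Fin n → ℝ}
    (hf : VecSmoothOn μ (Set.Icc t₁ t₂) f) (hx : VecSmoothOn 1 (Set.Icc t₁ t₂) x)
    (hc : ∀ s ∈ Set.Icc t₁ t₂, ((Z s)ᵀ * inflN (Set.Icc t₁ t₂) A μ s) *ᵥ x s
      + (Z s)ᵀ *ᵥ inflg (Set.Icc t₁ t₂) f μ s = 0) :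
    ∃ u, resid (Set.Icc t₁ t₂) E A x t - f t = (E t * T) *ᵥ u := by
  set I := Set.Icc t₁ t₂ with hIdef
  set r := resid I E A x t - f t with hr
  set S := Tᵀ * E t * T with hS
  have hSu : IsUnit S := by
    rw [← Matrix.mulVec_injective_iff_isUnit]
    intro u v huv
    have : S *ᵥ (u - v) = 0 := by rw [Matrix.mulVec_sub]; exact sub_eq_zero.mpr huv
    exact sub_eq_zero.mp (h.eq_zero_of_transpose_mul_mul ht hT hcard this)
  have hSdet : IsUnit S.det := (Matrix.isUnit_iff_isUnit_det S).mp hSu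
  -- Every vector of `ker TᵀE` is a combination of adjoint values, each orthogonal to the residual.
  have horth : ∀ w, (Tᵀ * E t) *ᵥ w = 0 → w ⬝ᵥ r = 0 := by
    intro w hw
    have hw' : w ∈ adjointValues I E A μ t := by
      rw [(h.adjointValues_eq ht hT hcard).1]; exact hw
    refine Submodule.span_induction (p := fun w _ => w ⬝ᵥ r = 0) ?_ (zero_dotProduct _) ?_ ?_ hw'
    · rintro _ ⟨ζ, hζ, rfl⟩
      refine hζ.dotProduct_resid_sub_eq_zero h.lt h.smooth_E h.smooth_A h.selfAdjoint hf hx ?_ ht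
      intro s hs
      apply (h.basis_Z s hs).exists_mulVec_eq (h.regular s hs).rank
      rw [Matrix.mulVec_add, Matrix.mulVec_mulVec]
      exact hc s hs
    · intro v w _ _ hv hw
      rw [add_dotProduct, hv, hw, add_zero]
    · intro c v _ hv
      rw [smul_dotProduct, hv, smul_zero]
  refine ⟨S⁻¹ *ᵥ (Tᵀ *ᵥ r), sub_eq_zero.mp ?_⟩
  -- `r'` is the part of `r` with `Tᵀr' = 0`, and it is still orthogonal to `ker TᵀE`. Below, `u'`
  -- is chosen so that `r' - T u'` lies in that kernel, whence `r'·r' = u'·Tᵀr' = 0`.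
  set r' := r - (E t * T) *ᵥ (S⁻¹ *ᵥ (Tᵀ *ᵥ r)) with hr'
  have h1 : Tᵀ *ᵥ r' = 0 := by
    rw [hr', Matrix.mulVec_sub, Matrix.mulVec_mulVec, ← Matrix.mul_assoc, ← hS,
      Matrix.mulVec_mulVec, Matrix.mul_nonsing_inv S hSdet, Matrix.one_mulVec, sub_self]
  have h2 : ∀ w, (Tᵀ * E t) *ᵥ w = 0 → w ⬝ᵥ r' = 0 := by
    intro w hw
    rw [hr', dotProduct_sub, horth w hw, Matrix.dotProduct_mulVec, ← Matrix.mulVec_transpose,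
      Matrix.transpose_mul, (h.selfAdjoint t ht).1, Matrix.mul_neg, Matrix.neg_mulVec, hw]
    simp
  apply dotProduct_self_eq_zero.mp
  set u' := S⁻¹ *ᵥ ((Tᵀ * E t) *ᵥ r') with hu'
  have h3 : (Tᵀ * E t) *ᵥ (r' - T *ᵥ u') = 0 := by
    rw [Matrix.mulVec_sub, Matrix.mulVec_mulVec, ← hS, hu', Matrix.mulVec_mulVec,
      Matrix.mul_nonsing_inv S hSdet, Matrix.one_mulVec, sub_self]
  have h4 := h2 _ h3
  rw [sub_dotProduct, dotProduct_comm (T *ᵥ u'), Matrix.dotProduct_mulVec,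
    ← Matrix.mulVec_transpose, h1, zero_dotProduct, sub_zero] at h4
  exact h4

end Nondegenerate

/-! ### Global solutions of linear differential equations -/

section Existence

variable {F : Type*} [NormedAddCommGroup F] [NormedSpace ℝ F] [CompleteSpace F]

/-- Global existence for a Lipschitz right-hand side on a compact interval. -/
theorem exists_hasDerivWithinAt_of_lipschitz {t₁ t₂ : ℝ} (h12 : t₁ ≤ t₂) (v : ℝ → F → F) {K : ℝ}
    (hK : 0 ≤ K) (hv : ∀ t ∈ Set.Icc t₁ t₂, ∀ x y, ‖v t x - v t y‖ ≤ K * ‖x - y‖)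
    (hvc : ∀ x : ℝ → F, Continuous x → ContinuousOn (fun t => v t (x t)) (Set.Icc t₁ t₂))
    (x₀ : F) : ∃ x : ℝ → F, x t₁ = x₀ ∧
      ∀ t ∈ Set.Icc t₁ t₂, HasDerivWithinAt x (v t (x t)) (Set.Icc t₁ t₂) t := by
  set pr : ℝ → Set.Icc t₁ t₂ := Set.projIcc t₁ t₂ h12 with hpr
  have hprc : Continuous pr := continuous_projIcc
  -- Picard iteration in a weighted norm: for `x = w y` with `w = exp (lam (s - t₁))` the integral
  -- operator contracts by `K / lam ≤ 1/2` on the whole interval. The summand `1` keeps `lam`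
  -- positive when `K = 0`.
  set lam : ℝ := 2 * K + 1 with hlam
  have hlam0 : 0 < lam := by positivity
  set w : ℝ → ℝ := fun s => Real.exp (lam * (s - t₁)) with hw
  have hwc : Continuous w := by fun_prop
  have hwpos : ∀ s, 0 < w s := fun s => Real.exp_pos _
  set ext : C(Set.Icc t₁ t₂, F) → ℝ → F := fun y s => w s • y (pr s) with hext
  have hextc : ∀ y, Continuous (ext y) := fun y => hwc.smul (y.continuous.comp hprc)
  set rhs : C(Set.Icc t₁ t₂, F) → ℝ → F := fun y s => v (pr s) (ext y (pr s)) with hrhs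
  have hrhsc : ∀ y, Continuous (rhs y) := fun y =>
    (continuousOn_iff_continuous_domRestrict.mp (hvc _ (hextc y))).comp hprc
  set op : C(Set.Icc t₁ t₂, F) → C(Set.Icc t₁ t₂, F) := fun y =>
    ⟨fun t => (w t)⁻¹ • (x₀ + ∫ s in t₁..(t : ℝ), rhs y s), by
      have h1 : Continuous fun t : ℝ => ∫ s in t₁..t, rhs y s :=
        intervalIntegral.continuous_primitive (fun a b => (hrhsc y).intervalIntegrable a b) t₁
      exact (((hwc.inv₀ fun s => (hwpos s).ne').smul (continuous_const.add h1)).comp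
        continuous_subtype_val)⟩ with hop
  have hprI : ∀ s ∈ Set.Icc t₁ t₂, (pr s : ℝ) = s := fun s hs => by
    rw [hpr, Set.projIcc_of_mem h12 hs]
  have hcontr : ContractingWith (1 / 2) op := by
    refine ⟨by norm_num, LipschitzWith.of_dist_le_mul fun y z => ?_⟩
    rw [ContinuousMap.dist_le (by positivity)]
    intro t
    have hwd : ∀ s : ℝ,
        HasDerivAt (fun s => K * dist y z * (w s / lam)) (K * dist y z * w s) s := by
      intro s
      have h1 : HasDerivAt w (w s * lam) s := by
        have := (((hasDerivAt_id s).sub_const t₁).const_mul lam).exp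
        simpa [hw] using this
      refine ((h1.div_const lam).const_mul (K * dist y z)).congr_deriv ?_
      rw [mul_div_assoc, div_self hlam0.ne', mul_one]
    have hbound : ‖∫ s in t₁..(t : ℝ), (rhs y s - rhs z s)‖
        ≤ ∫ s in t₁..(t : ℝ), K * dist y z * w s := by
      apply intervalIntegral.norm_integral_le_of_norm_le t.2.1
      · refine Filter.Eventually.of_forall fun s hs => ?_
        have hsI : s ∈ Set.Icc t₁ t₂ := ⟨hs.1.le, hs.2.trans t.2.2⟩
        have h1 := hv (pr s) (pr s).2 (ext y (pr s)) (ext z (pr s))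
        refine h1.trans ?_
        rw [hext]
        simp only []
        rw [← smul_sub, norm_smul, Real.norm_of_nonneg (hwpos _).le, hprI s hsI, ← dist_eq_norm]
        have h2 := ContinuousMap.dist_apply_le_dist (f := y) (g := z) (pr s)
        have h3 := mul_le_mul_of_nonneg_left h2 (mul_nonneg hK (hwpos s).le)
        nlinarith [h3]
      · exact (continuous_const.mul hwc).intervalIntegrable _ _
    rw [intervalIntegral.integral_eq_sub_of_hasDerivAt (fun s _ => hwd s)
      ((continuous_const.mul hwc).intervalIntegrable _ _)] at hbound
    have hle : ‖∫ s in t₁..(t : ℝ), (rhs y s - rhs z s)‖ ≤ w t * (1 / 2 * dist y z) := by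
      refine hbound.trans ?_
      have h4 : 0 ≤ K * dist y z * (w t₁ / lam) := by
        have := hwpos t₁; positivity
      have h5 : K / lam ≤ 1 / 2 := by
        rw [div_le_iff₀ hlam0, hlam]; linarith
      have h6 : K * dist y z * (w t / lam) = K / lam * (w t * dist y z) := by ring
      have h7 := mul_le_mul_of_nonneg_right h5
        (mul_nonneg (hwpos t).le (dist_nonneg (x := y) (y := z)))
      linarith
    rw [dist_eq_norm, hop]
    simp only [ContinuousMap.coe_mk]
    rw [← smul_sub, add_sub_add_left_eq_sub, ← intervalIntegral.integral_sub
      ((hrhsc y).intervalIntegrable _ _) ((hrhsc z).intervalIntegrable _ _), norm_smul, norm_inv,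
      Real.norm_of_nonneg (hwpos _).le, inv_mul_le_iff₀ (hwpos _)]
    exact hle
  have : Nonempty C(Set.Icc t₁ t₂, F) := ⟨0⟩
  obtain ⟨y, hy⟩ : ∃ y, op y = y := ⟨_, hcontr.fixedPoint_isFixedPt⟩
  have hxt : ∀ t ∈ Set.Icc t₁ t₂, ext y t = x₀ + ∫ s in t₁..t, rhs y s := by
    intro t ht
    have h1 : y (pr t) = (w (pr t))⁻¹ • (x₀ + ∫ s in t₁..(pr t : ℝ), rhs y s) := by
      conv_lhs => rw [← hy]
      rfl
    rw [hprI t ht] at h1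
    rw [hext]
    simp only [h1]
    rw [smul_smul, mul_inv_cancel₀ (hwpos t).ne', one_smul]
  refine ⟨ext y, ?_, fun t ht => ?_⟩
  · rw [hxt t₁ (Set.left_mem_Icc.mpr h12)]; simp
  · have h1 : HasDerivAt (fun t => x₀ + ∫ s in t₁..t, rhs y s) (rhs y t) t :=
      (intervalIntegral.integral_hasDerivAt_right ((hrhsc y).intervalIntegrable _ _)
        ((hrhsc y).stronglyMeasurableAtFilter _ _) (hrhsc y).continuousAt).const_add x₀
    have h2 : rhs y t = v t (ext y t) := by
      rw [hrhs]; simp only [hprI t ht]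
    rw [← h2]
    exact h1.hasDerivWithinAt.congr hxt (hxt t ht)

end Existence

/-! ### Linear matrix differential equations -/

section LinearODE

variable {ι κ : Type*} {t₁ t₂ : ℝ}

theorem eq_left_of_matHasDeriv_zero {X : ℝ → Matrix ι κ ℝ}
    (h : ∀ t ∈ Set.Icc t₁ t₂, MatHasDeriv (Set.Icc t₁ t₂) X 0 t) {t : ℝ}
    (ht : t ∈ Set.Icc t₁ t₂) : X t = X t₁ := by
  ext i j
  rcases ht.1.eq_or_lt with h12 | h12
  · rw [h12]
  · have hI := uniqueDiffOn_Icc (h12.trans_le ht.2)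
    exact constant_of_derivWithin_zero (fun s hs => (h s hs i j).differentiableWithinAt)
      (fun s hs => (h s (Set.Ico_subset_Icc_self hs) i j).derivWithin
        (hI s (Set.Ico_subset_Icc_self hs))) t ht

variable [Fintype ι]

/-- Bootstrapping: if `X` is `C^j` and `K` is `C^j`, then `X' = K X` is `C^j`. The induction is over
finite orders so that `m = ∞` is covered too. -/
theorem MatSmoothOn.of_matHasDeriv_mul (h12 : t₁ < t₂) {m : ℕ∞} {K : ℝ → Matrix ι ι ℝ}
    {X : ℝ → Matrix ι κ ℝ} (hK : MatSmoothOn m (Set.Icc t₁ t₂) K)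
    (hX : ∀ t ∈ Set.Icc t₁ t₂, MatHasDeriv (Set.Icc t₁ t₂) X (K t * X t) t) :
    MatSmoothOn (m + 1) (Set.Icc t₁ t₂) X := by
  have hI := uniqueDiffOn_Icc h12
  have key : ∀ j : ℕ, (j : ℕ∞) ≤ m + 1 → MatSmoothOn j (Set.Icc t₁ t₂) X := by
    intro j
    induction j with
    | zero =>
      intro _ r c
      exact contDiffOn_zero.mpr fun t ht => (hX t ht r c).continuousWithinAt
    | succ j ih =>
      intro hj r c
      have hjm : (j : ℕ∞) ≤ m := by
        rw [Nat.cast_succ] at hj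
        exact (ENat.add_le_add_iff_right ENat.one_ne_top).mp hj
      have hXj := ih (hjm.trans le_self_add)
      have := (contDiffOn_succ_iff_derivWithin (n := ((j : ℕ∞) : WithTop ℕ∞)) hI
        (f := fun t => X t r c)).mpr
        ⟨fun t ht => (hX t ht r c).differentiableWithinAt, by simp,
          (((hK.mono hjm).mul hXj) r c).congr fun t ht => (hX t ht r c).derivWithin (hI t ht)⟩
      exact_mod_cast this
  intro r c
  exact contDiffOn_iff_forall_nat_le.mpr fun j hj => key j (by exact_mod_cast hj) r c

theorem exists_matHasDeriv_mul [Fintype κ] (h12 : t₁ ≤ t₂) {K : ℝ → Matrix ι ι ℝ}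
    (hK : MatSmoothOn 0 (Set.Icc t₁ t₂) K) (X₀ : Matrix ι κ ℝ) :
    ∃ X : ℝ → Matrix ι κ ℝ, X t₁ = X₀ ∧
      ∀ t ∈ Set.Icc t₁ t₂, MatHasDeriv (Set.Icc t₁ t₂) X (K t * X t) t := by
  have hbd : ∀ i j, ∃ B, 0 ≤ B ∧ ∀ t ∈ Set.Icc t₁ t₂, |K t i j| ≤ B := fun i j => by
    obtain ⟨B, hB⟩ := isCompact_Icc.exists_bound_of_continuousOn (hK i j).continuousOn
    exact ⟨max B 0, le_max_right _ _, fun t ht => (hB t ht).trans (le_max_left _ _)⟩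
  choose B hB0 hB using hbd
  set v : ℝ → (ι → κ → ℝ) → (ι → κ → ℝ) := fun t X i j => ∑ k, K t i k * X k j with hv
  have hS0 : 0 ≤ ∑ i, ∑ k, B i k :=
    Finset.sum_nonneg fun i _ => Finset.sum_nonneg fun k _ => hB0 i k
  obtain ⟨X, hX0, hX⟩ := exists_hasDerivWithinAt_of_lipschitz h12 v hS0
    (by
      intro t ht X Y
      have hnn : 0 ≤ (∑ i, ∑ k, B i k) * ‖X - Y‖ := mul_nonneg hS0 (norm_nonneg _)
      refine (pi_norm_le_iff_of_nonneg hnn).mpr fun i =>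
        (pi_norm_le_iff_of_nonneg hnn).mpr fun j => ?_
      have e1 : (v t X - v t Y) i j = ∑ k, K t i k * (X - Y) k j := by
        simp [hv, mul_sub]
      rw [e1]
      calc ‖∑ k, K t i k * (X - Y) k j‖ ≤ ∑ k, B i k * ‖X - Y‖ := by
            refine norm_sum_le_of_le _ fun k _ => ?_
            rw [norm_mul]
            exact mul_le_mul (hB i k t ht)
              ((norm_le_pi_norm ((X - Y) k) j).trans (norm_le_pi_norm (X - Y) k))
              (norm_nonneg _) (hB0 i k)
        _ = (∑ k, B i k) * ‖X - Y‖ := by rw [Finset.sum_mul]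
        _ ≤ _ := mul_le_mul_of_nonneg_right
            (Finset.single_le_sum (f := fun i => ∑ k, B i k)
              (fun i _ => Finset.sum_nonneg fun k _ => hB0 i k) (Finset.mem_univ i))
            (norm_nonneg _))
    (by
      intro x hx
      refine continuousOn_pi.mpr fun i => continuousOn_pi.mpr fun j => ?_
      refine continuousOn_finsetSum _ fun k _ => (hK i k).continuousOn.mul ?_
      exact ((continuous_apply j).comp ((continuous_apply k).comp hx)).continuousOn)
    X₀
  refine ⟨X, hX0, fun t ht i j => ?_⟩
  have h1 := hasDerivWithinAt_pi.mp (hasDerivWithinAt_pi.mp (hX t ht) i) j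
  exact h1

end LinearODE

/-! ### Smooth orthonormal frames -/

section Frames

variable {ρ ι κ₁ κ₂ : Type*} [Fintype ρ] [Fintype ι] [DecidableEq ι] [Fintype κ₁] [Fintype κ₂]
  [DecidableEq κ₁] [DecidableEq κ₂]

/-- The coordinate projector onto the first block. -/
def blockProjector (κ₁ κ₂ : Type*) [DecidableEq κ₁] : Matrix (κ₁ ⊕ κ₂) (κ₁ ⊕ κ₂) ℝ :=
  Matrix.fromBlocks 1 0 0 0

/-- Orthogonal diagonalization of an orthogonal projector. -/
theorem exists_isOrthogonal_of_projector {P : Matrix ι ι ℝ} (hs : Pᵀ = P) (hi : P * P = P)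
    (hr : P.rank = Fintype.card κ₁) (hc : Fintype.card κ₁ + Fintype.card κ₂ = Fintype.card ι) :
    ∃ O : Matrix ι (κ₁ ⊕ κ₂) ℝ, IsOrthogonal O ∧ P * O = O * blockProjector κ₁ κ₂ := by
  have hP : P.IsHermitian := by
    rw [Matrix.IsHermitian, Matrix.conjTranspose_eq_transpose_of_trivial, hs]
  set V : Matrix ι ι ℝ := (hP.eigenvectorUnitary : Matrix ι ι ℝ) with hV
  have hVV : Vᵀ * V = 1 := by
    have := Matrix.mem_unitaryGroup_iff'.mp hP.eigenvectorUnitary.2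
    rwa [Matrix.star_eq_conjTranspose, Matrix.conjTranspose_eq_transpose_of_trivial] at this
  have hPV : P * V = V * Matrix.diagonal hP.eigenvalues := by
    ext i j
    rw [Matrix.mul_diagonal]
    have := congrFun (hP.mulVec_eigenvectorBasis j) i
    simp only [Pi.smul_apply, smul_eq_mul] at this
    rw [mul_comm, hV, Matrix.IsHermitian.eigenvectorUnitary_apply, ← this]
    rfl
  -- The eigenvalues are `0` or `1`; reindexing puts the eigenvectors for `1` into the first block.
  have hev : ∀ i, hP.eigenvalues i * hP.eigenvalues i = hP.eigenvalues i := by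
    have h2 : V * (Matrix.diagonal hP.eigenvalues * Matrix.diagonal hP.eigenvalues)
        = V * Matrix.diagonal hP.eigenvalues := by
      rw [← Matrix.mul_assoc, ← hPV, Matrix.mul_assoc, ← hPV, ← Matrix.mul_assoc, hi]
    have h1 : Matrix.diagonal hP.eigenvalues * Matrix.diagonal hP.eigenvalues
        = Matrix.diagonal hP.eigenvalues := by
      have := congrArg (Vᵀ * ·) h2
      simpa only [← Matrix.mul_assoc, hVV, Matrix.one_mul] using this
    intro i
    have := congrFun (congrFun h1 i) i
    simpa using this
  have hcard₁ : Fintype.card κ₁ = Fintype.card {i // hP.eigenvalues i ≠ 0} := by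
    rw [← hr, hP.rank_eq_card_non_zero_eigs]
  have hcard₂ : Fintype.card κ₂ = Fintype.card {i // ¬ hP.eigenvalues i ≠ 0} := by
    rw [Fintype.card_subtype_compl, ← hcard₁]; omega
  set e : κ₁ ⊕ κ₂ ≃ ι := (Equiv.sumCongr (Fintype.equivOfCardEq hcard₁)
    (Fintype.equivOfCardEq hcard₂)).trans (Equiv.sumCompl _) with he
  have he₁ : ∀ q, hP.eigenvalues (e (Sum.inl q)) = 1 := fun q => by
    have h1 : hP.eigenvalues (e (Sum.inl q)) ≠ 0 := by
      simpa [he] using (Fintype.equivOfCardEq hcard₁ q).2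
    exact mul_left_cancel₀ h1 (by rw [hev, mul_one])
  have he₂ : ∀ q, hP.eigenvalues (e (Sum.inr q)) = 0 := fun q => by
    simpa [he] using (Fintype.equivOfCardEq hcard₂ q).2
  have hO1 : (V.submatrix id e)ᵀ * V.submatrix id e = 1 := by
    rw [Matrix.transpose_submatrix, ← Matrix.submatrix_mul _ _ _ _ _ Function.bijective_id, hVV,
      Matrix.submatrix_one_equiv]
  refine ⟨V.submatrix id e, ⟨hO1, (Matrix.mul_eq_one_comm_of_card_eq _ _ _
    (by rw [Fintype.card_sum, hc])).mp hO1⟩, ?_⟩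
  have h3 : P * V.submatrix id e = (V * Matrix.diagonal hP.eigenvalues).submatrix id e := by
    rw [← hPV]; rfl
  rw [h3]
  ext i q
  rw [Matrix.submatrix_apply, Matrix.mul_diagonal, Matrix.mul_apply, Fintype.sum_sum_type]
  rcases q with q | q
  · simp [blockProjector, he₁, Matrix.one_apply]
  · simp [blockProjector, he₂]

/-- Parallel transport of an orthonormal frame adapted to a smooth orthogonal projector. -/
theorem exists_smooth_isOrthogonal_of_projector {t₁ t₂ : ℝ} (h12 : t₁ < t₂) {m : ℕ∞}
    {P : ℝ → Matrix ι ι ℝ} (hP : MatSmoothOn (m + 1) (Set.Icc t₁ t₂) P)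
    (hs : ∀ t ∈ Set.Icc t₁ t₂, (P t)ᵀ = P t) (hi : ∀ t ∈ Set.Icc t₁ t₂, P t * P t = P t)
    (hr : (P t₁).rank = Fintype.card κ₁)
    (hc : Fintype.card κ₁ + Fintype.card κ₂ = Fintype.card ι) :
    ∃ O : ℝ → Matrix ι (κ₁ ⊕ κ₂) ℝ, MatSmoothOn (m + 1) (Set.Icc t₁ t₂) O ∧
      ∀ t ∈ Set.Icc t₁ t₂, IsOrthogonal (O t) ∧ P t * O t = O t * blockProjector κ₁ κ₂ := by
  set I := Set.Icc t₁ t₂ with hIdef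
  have hI : UniqueDiffOn ℝ I := uniqueDiffOn_Icc h12
  have ht₁ : t₁ ∈ I := Set.left_mem_Icc.mpr h12.le
  set D := matDeriv I P with hD
  have hPD : ∀ t ∈ I, MatHasDeriv I P (D t) t := fun t ht => hP.hasDeriv le_add_self ht
  have hDs : MatSmoothOn m I D := hP.matDeriv hI
  have hDsymm : ∀ t ∈ I, (D t)ᵀ = D t := fun t ht => by
    ext i j
    have := derivWithin_congr (s := I) (x := t) (f := fun s => P s j i) (f₁ := fun s => P s i j)
      (fun s hs' => by
        have := congrFun (congrFun (hs s hs') j) i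
        simpa using this)
      (by have := congrFun (congrFun (hs t ht) j) i
          simpa using this)
    simp only [hD, matDeriv, Matrix.transpose_apply, Matrix.of_apply]
    exact this.symm
  have hDP : ∀ t ∈ I, D t = D t * P t + P t * D t := fun t ht => by
    rw [← ((hPD t ht).mul (hPD t ht)).matDeriv_eq hI ht]
    ext i j
    exact derivWithin_congr (fun s hs' => (congrFun (congrFun (hi s hs') i) j).symm)
      (congrFun (congrFun (hi t ht) i) j).symm
  have hPDP : ∀ t ∈ I, P t * D t * P t = 0 := fun t ht => by
    have h1 : P t * D t * P t = P t * D t * P t + P t * D t * P t := by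
      conv_lhs => rw [hDP t ht]
      rw [Matrix.mul_add, Matrix.add_mul]
      congr 1
      · rw [Matrix.mul_assoc, Matrix.mul_assoc, hi t ht, ← Matrix.mul_assoc]
      · rw [← Matrix.mul_assoc, hi t ht]
    exact left_eq_add.mp h1
  -- Kato's generator `K = [Ṗ, P]`. It is skew, so solutions of `Ȯ = K O` stay orthogonal; and `P Ṗ
  -- P = 0` gives `Ṗ = [K, P]`, so `OᵀP O` stays constant.
  set K : ℝ → Matrix ι ι ℝ := fun t => D t * P t - P t * D t with hK
  have hP' : MatSmoothOn m I P := hP.mono le_self_add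
  have hKs : MatSmoothOn m I K := (hDs.mul hP').sub (hP'.mul hDs)
  have hKt : ∀ t ∈ I, (K t)ᵀ = -K t := fun t ht => by
    simp only [hK, Matrix.transpose_sub, Matrix.transpose_mul, hs t ht, hDsymm t ht, neg_sub]
  obtain ⟨O₀, hO₀, hPO₀⟩ := exists_isOrthogonal_of_projector (κ₁ := κ₁) (κ₂ := κ₂)
    (hs t₁ ht₁) (hi t₁ ht₁) hr hc
  obtain ⟨O, hO1, hO⟩ := exists_matHasDeriv_mul h12.le (hKs.mono zero_le) O₀
  have hOO : ∀ t ∈ I, (O t)ᵀ * O t = 1 := by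
    intro t ht
    rw [eq_left_of_matHasDeriv_zero (X := fun t => (O t)ᵀ * O t) (fun s hs' => ?_) ht, hO1, hO₀.1]
    have := (hO s hs').transpose.mul (hO s hs')
    rw [Matrix.transpose_mul, hKt s hs', Matrix.mul_neg, Matrix.neg_mul, Matrix.mul_assoc,
      neg_add_cancel] at this
    exact this
  have hOPO : ∀ t ∈ I, (O t)ᵀ * (P t * O t) = blockProjector κ₁ κ₂ := by
    intro t ht
    rw [eq_left_of_matHasDeriv_zero (X := fun t => (O t)ᵀ * (P t * O t)) (fun s hs' => ?_) ht, hO1,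
      hPO₀, ← Matrix.mul_assoc, hO₀.1, Matrix.one_mul]
    have h1 := (hO s hs').transpose.mul ((hPD s hs').mul (hO s hs'))
    have h2 : -(K s * P s) + D s + P s * K s = 0 := by
      have e1 : K s * P s = D s * P s := by
        simp only [hK, Matrix.sub_mul]
        rw [hPDP s hs', Matrix.mul_assoc, hi s hs', sub_zero]
      have e2 : P s * K s = -(P s * D s) := by
        simp only [hK, Matrix.mul_sub]
        rw [← Matrix.mul_assoc, hPDP s hs', ← Matrix.mul_assoc, hi s hs', zero_sub]
      rw [e1, e2]
      nth_rewrite 2 [hDP s hs']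
      abel
    have h3 : (K s * O s)ᵀ * (P s * O s) + (O s)ᵀ * (D s * O s + P s * (K s * O s))
        = (O s)ᵀ * (-(K s * P s) + D s + P s * K s) * O s := by
      rw [Matrix.transpose_mul, hKt s hs']
      simp only [Matrix.mul_add, Matrix.add_mul, Matrix.mul_neg, Matrix.neg_mul, Matrix.mul_assoc,
        add_assoc]
    rw [h3, h2, Matrix.mul_zero, Matrix.zero_mul] at h1
    exact h1
  refine ⟨O, MatSmoothOn.of_matHasDeriv_mul h12 hKs hO, fun t ht => ?_⟩
  have h1 : O t * (O t)ᵀ = 1 := (Matrix.mul_eq_one_comm_of_card_eq _ _ _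
    (by rw [Fintype.card_sum, hc])).mp (hOO t ht)
  refine ⟨⟨hOO t ht, h1⟩, ?_⟩
  rw [← hOPO t ht, ← Matrix.mul_assoc, h1, Matrix.one_mul]

/-- The coefficients are polynomials in the entries, obtained by evaluating the universal
characteristic polynomial. Eigenvalues, which need not be smooth, are avoided. -/
theorem contDiffOn_charpoly_coeff {I : Set ℝ} {m : ℕ∞} {S : ℝ → Matrix ι ι ℝ}
    (hS : MatSmoothOn m I S) (i : ℕ) :
    ContDiffOn ℝ (m : WithTop ℕ∞) (fun t => (S t).charpoly.coeff i) I := by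
  have h1 : ∀ t, (S t).charpoly.coeff i
      = MvPolynomial.eval (fun q : ι × ι => S t q.1 q.2) ((Matrix.charpoly.univ ℝ ι).coeff i) :=
    fun t => (Matrix.charpoly.univ_coeff_eval₂Hom ι (RingHom.id ℝ) (fun q => S t q.1 q.2) i).symm
  simp only [h1, MvPolynomial.eval_eq']
  exact ContDiffOn.sum fun d _ => contDiffOn_const.mul
    (contDiffOn_prod fun q _ => (hS q.1 q.2).pow _)

theorem MatSmoothOn.pow {I : Set ℝ} {m : ℕ∞} {S : ℝ → Matrix ι ι ℝ}
    (hS : MatSmoothOn m I S) (i : ℕ) : MatSmoothOn m I fun t => S t ^ i := by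
  induction i with
  | zero => simpa using MatSmoothOn.const 1
  | succ i ih => simpa only [pow_succ] using ih.mul hS

/-- The polynomial in a symmetric matrix that gives the projector onto its kernel. -/
theorem kernel_projector_of_symmetric {S : Matrix ι ι ℝ} (hs : Sᵀ = S) {k : ℕ}
    (hk : S.rank + k = Fintype.card ι) :
    S.charpoly.coeff k ≠ 0 ∧ S * (∑ i ∈ Finset.range (Fintype.card ι + 1),
      (S.charpoly.coeff (k + i)) • S ^ i) = 0 := by
  have hS : S.IsHermitian := by
    rw [Matrix.IsHermitian, Matrix.conjTranspose_eq_transpose_of_trivial, hs]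
  -- The characteristic polynomial is `X^k q` with `q(0) ≠ 0`, and its shifted coefficients are
  -- those of `q`. So `q(S)` vanishes on `range S` and is the scalar `q(0)` on `ker S`.
  set q : Polynomial ℝ := ∏ i with hS.eigenvalues i ≠ 0,
    (Polynomial.X - Polynomial.C (hS.eigenvalues i)) with hq
  have hfac : S.charpoly = Polynomial.X ^ k * q := by
    rw [hS.charpoly_eq, ← Finset.prod_filter_mul_prod_filter_not Finset.univ
      (fun i => hS.eigenvalues i ≠ 0), mul_comm]
    congr 1
    rw [Finset.prod_congr rfl (g := fun _ => Polynomial.X)]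
    · rw [Finset.prod_const]
      congr 1
      rw [← Fintype.card_subtype, Fintype.card_subtype_compl, ← hS.rank_eq_card_non_zero_eigs]
      omega
    · intro i hi
      have : hS.eigenvalues i = 0 := by simpa using hi
      simp [this]
  have hcoeff : ∀ i, S.charpoly.coeff (k + i) = q.coeff i := fun i => by
    rw [hfac, add_comm, Polynomial.coeff_X_pow_mul]
  have hq0 : q.coeff 0 ≠ 0 := by
    rw [Polynomial.coeff_zero_eq_eval_zero, hq, Polynomial.eval_prod]
    refine Finset.prod_ne_zero_iff.mpr fun i hi => ?_
    simpa using hi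
  have hdeg : q.natDegree < Fintype.card ι + 1 := by
    rw [hq, Polynomial.natDegree_prod_of_monic _ _ fun i _ => Polynomial.monic_X_sub_C _]
    simp only [Polynomial.natDegree_X_sub_C, Finset.sum_const, smul_eq_mul, mul_one]
    exact Nat.lt_succ_of_le (Finset.card_le_univ _)
  refine ⟨by simpa using (hcoeff 0).trans_ne hq0, ?_⟩
  simp only [hcoeff]
  rw [← Polynomial.aeval_eq_sum_range' hdeg]
  set X := Polynomial.aeval S q with hX
  have hkX : S ^ k * X = 0 := by
    have := Matrix.aeval_self_charpoly S
    rwa [hfac, map_mul, map_pow, Polynomial.aeval_X] at this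
  -- Powers of a symmetric matrix have the same kernel: the Gram matrix of `S^(j+1) X` is `Xᵀ S^j
  -- (S^(j+2) X)`.
  have hdown : ∀ j, S ^ (j + 1) * X = 0 → S * X = 0 := by
    intro j
    induction j with
    | zero => simp
    | succ j ih =>
      intro h
      apply ih
      rw [← Matrix.conjTranspose_mul_self_eq_zero, Matrix.conjTranspose_eq_transpose_of_trivial,
        Matrix.transpose_mul, Matrix.transpose_pow, hs, Matrix.mul_assoc, ← Matrix.mul_assoc _ _ X,
        ← pow_add, show j + 1 + (j + 1) = j + (j + 1 + 1) by ring, pow_add, Matrix.mul_assoc, h,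
        Matrix.mul_zero, Matrix.mul_zero]
  apply hdown k
  rw [pow_succ', Matrix.mul_assoc, hkX, Matrix.mul_zero]

/-- The orthogonal projector onto the kernel of a matrix function of constant rank is smooth. -/
theorem exists_smooth_kernel_projector {I : Set ℝ} {m : ℕ∞} {M : ℝ → Matrix ρ ι ℝ}
    (hM : MatSmoothOn m I M) {k : ℕ} (hk : ∀ t ∈ I, (M t).rank + k = Fintype.card ι) :
    ∃ P : ℝ → Matrix ι ι ℝ, MatSmoothOn m I P ∧ ∀ t ∈ I, (P t)ᵀ = P t ∧ P t * P t = P t ∧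
      M t * P t = 0 ∧ (P t).rank = k := by
  -- `MᵀM` is symmetric with the kernel and the rank of `M`. The projector is `q(S) / q(0)` from
  -- `kernel_projector_of_symmetric`, with `c` playing the role of `q(0)`.
  set S : ℝ → Matrix ι ι ℝ := fun t => (M t)ᵀ * M t with hS
  have hSs : MatSmoothOn m I S := hM.transpose.mul hM
  have hsymm : ∀ t, (S t)ᵀ = S t := fun t => by simp [hS, Matrix.transpose_mul]
  have hrank : ∀ t ∈ I, (S t).rank + k = Fintype.card ι := fun t ht => by
    rw [hS, Matrix.rank_transpose_mul_self, hk t ht]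
  set X : ℝ → Matrix ι ι ℝ := fun t => ∑ i ∈ Finset.range (Fintype.card ι + 1),
      ((S t).charpoly.coeff (k + i)) • S t ^ i with hX
  have hXs : MatSmoothOn m I X := fun i j => by
    simp only [hX, Matrix.sum_apply]
    exact ContDiffOn.sum fun l _ =>
      (MatSmoothOn.smul (contDiffOn_charpoly_coeff hSs (k + l)) (hSs.pow l)) i j
  set c : ℝ → ℝ := fun t => (S t).charpoly.coeff k with hc
  have hc0 : ∀ t ∈ I, c t ≠ 0 := fun t ht =>
    (kernel_projector_of_symmetric (hsymm t) (hrank t ht)).1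
  have hXY : ∀ {κ : Type _} (t : ℝ) (Y : Matrix ι κ ℝ), S t * Y = 0 → X t * Y = c t • Y := by
    intro κ t Y hY
    simp only [hX, hc, Matrix.sum_mul]
    rw [Finset.sum_eq_single 0]
    · simp
    · intro i _ hi
      obtain ⟨i, rfl⟩ := Nat.exists_eq_succ_of_ne_zero hi
      rw [pow_succ, Matrix.smul_mul, Matrix.mul_assoc, hY, Matrix.mul_zero, smul_zero]
    · simp
  refine ⟨fun t => (c t)⁻¹ • X t, MatSmoothOn.smul ((contDiffOn_charpoly_coeff hSs k).inv hc0) hXs,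
    fun t ht => ?_⟩
  have hSX : S t * X t = 0 := (kernel_projector_of_symmetric (hsymm t) (hrank t ht)).2
  have hMX : M t * X t = 0 := by
    rw [← Matrix.conjTranspose_mul_self_eq_zero, Matrix.conjTranspose_eq_transpose_of_trivial,
      Matrix.transpose_mul, Matrix.mul_assoc, ← Matrix.mul_assoc _ _ (X t)]
    change (X t)ᵀ * (S t * X t) = 0
    rw [hSX, Matrix.mul_zero]
  have hMP : M t * ((c t)⁻¹ • X t) = 0 := by rw [Matrix.mul_smul, hMX, smul_zero]
  refine ⟨?_, ?_, hMP, ?_⟩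
  · simp only [hX, Matrix.transpose_smul, Matrix.transpose_sum, Matrix.transpose_pow, hsymm t]
  · rw [Matrix.smul_mul, Matrix.mul_smul, hXY t _ hSX, smul_smul, smul_smul, mul_assoc,
      inv_mul_cancel₀ (hc0 t ht), mul_one]
  · have h1 := (M t).mulVecLin.finrank_range_add_finrank_ker
    rw [Module.finrank_fintype_fun_eq_card] at h1
    have h2 : LinearMap.range ((c t)⁻¹ • X t).mulVecLin = LinearMap.ker (M t).mulVecLin := by
      apply le_antisymm
      · rintro _ ⟨v, rfl⟩
        rw [LinearMap.mem_ker, Matrix.mulVecLin_apply, Matrix.mulVecLin_apply,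
          Matrix.mulVec_mulVec, hMP, Matrix.zero_mulVec]
      · intro v hv
        have hv' : M t *ᵥ v = 0 := hv
        refine ⟨v, ?_⟩
        have h3 : S t * Matrix.replicateCol PUnit v = 0 := by
          rw [hS, Matrix.mul_assoc, ← Matrix.replicateCol_mulVec, hv']; simp
        have h4 := hXY t _ h3
        rw [← Matrix.replicateCol_mulVec] at h4
        rw [Matrix.mulVecLin_apply, Matrix.smul_mulVec]
        ext i
        have h5 := congrFun (congrFun h4 i) PUnit.unit
        simp only [Matrix.replicateCol_apply, Matrix.smul_apply, smul_eq_mul] at h5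
        rw [Pi.smul_apply, h5, smul_eq_mul, ← mul_assoc, inv_mul_cancel₀ (hc0 t ht), one_mul]
    have h3 : Module.finrank ℝ (LinearMap.range (M t).mulVecLin) = (M t).rank := rfl
    have h4 : ((c t)⁻¹ • X t).rank
      = Module.finrank ℝ (LinearMap.range ((c t)⁻¹ • X t).mulVecLin) := rfl
    rw [h4, h2]
    have := hk t ht
    omega

/-- A matrix function of constant rank has a smooth orthonormal frame adapted to its kernel. -/
theorem exists_smooth_kernel_frame {t₁ t₂ : ℝ} (h12 : t₁ < t₂) {m : ℕ∞} {M : ℝ → Matrix ρ ι ℝ}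
    (hM : MatSmoothOn (m + 1) (Set.Icc t₁ t₂) M)
    (hk : ∀ t ∈ Set.Icc t₁ t₂, (M t).rank + Fintype.card κ₁ = Fintype.card ι)
    (hc : Fintype.card κ₁ + Fintype.card κ₂ = Fintype.card ι) :
    ∃ O : ℝ → Matrix ι (κ₁ ⊕ κ₂) ℝ, MatSmoothOn (m + 1) (Set.Icc t₁ t₂) O ∧
      ∀ t ∈ Set.Icc t₁ t₂, IsOrthogonal (O t) ∧ M t * (O t).toCols₁ = 0 := by
  obtain ⟨P, hPs, hP⟩ := exists_smooth_kernel_projector hM hk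
  obtain ⟨O, hOs, hO⟩ := exists_smooth_isOrthogonal_of_projector (κ₁ := κ₁) (κ₂ := κ₂) h12 hPs
    (fun t ht => (hP t ht).1) (fun t ht => (hP t ht).2.1)
    (hP t₁ (Set.left_mem_Icc.mpr h12.le)).2.2.2 hc
  refine ⟨O, hOs, fun t ht => ⟨(hO t ht).1, ?_⟩⟩
  have h1 : M t * (P t * O t) = 0 := by
    rw [← Matrix.mul_assoc, (hP t ht).2.2.1, Matrix.zero_mul]
  rw [(hO t ht).2] at h1
  have h2 : (O t * blockProjector κ₁ κ₂).toCols₁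
      = (O t).toCols₁ := by
    ext i j
    simp [blockProjector, Matrix.mul_apply, Fintype.sum_sum_type, Matrix.one_apply, Matrix.toCols₁]
  rw [← h2]
  ext i j
  exact congrFun (congrFun h1 i) (Sum.inl j)

end Frames

/-! ### Smooth symplectic frames -/

section Symplectic

variable {δ : Type*} [Fintype δ] {t₁ t₂ : ℝ}

theorem dotProduct_mulVec_eq_neg {F : Matrix δ δ ℝ} (hF : Fᵀ = -F) (u v : δ → ℝ) :
    u ⬝ᵥ F *ᵥ v = -(v ⬝ᵥ F *ᵥ u) := by
  rw [Matrix.dotProduct_mulVec, ← Matrix.mulVec_transpose, hF, Matrix.neg_mulVec, neg_dotProduct,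
    dotProduct_comm]

/-- A skew-symmetric form has isotropic subspaces of half the dimension. -/
theorem exists_linearIndependent_isotropic {F : Matrix δ δ ℝ} (hF : Fᵀ = -F) {q : ℕ}
    (hq : 2 * q ≤ Fintype.card δ) :
    ∃ w : Fin q → δ → ℝ, LinearIndependent ℝ w ∧ ∀ i j, w i ⬝ᵥ F *ᵥ w j = 0 := by
  induction q with
  | zero => exact ⟨fun i => i.elim0, linearIndependent_empty_type, fun i => i.elim0⟩
  | succ q ih =>
    obtain ⟨w, hw, hww⟩ := ih (by omega)
    set Λ := (Matrix.of w * F).mulVecLin with hΛ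
    have hΛi : ∀ v i, Λ v i = w i ⬝ᵥ F *ᵥ v := fun v i => by
      rw [hΛ, Matrix.mulVecLin_apply, ← Matrix.mulVec_mulVec]; rfl
    -- The `F`-orthogonal complement of `q` vectors has dimension at least `card δ - q > q`, so it
    -- is not contained in their span. Any vector is `F`-orthogonal to itself.
    obtain ⟨v, hv, hvw⟩ : ∃ v ∈ LinearMap.ker Λ, v ∉ Submodule.span ℝ (Set.range w) := by
      by_contra hcon
      push Not at hcon
      have h1 := Submodule.finrank_mono (show LinearMap.ker Λ ≤ _ from hcon)
      rw [finrank_span_eq_card hw, Fintype.card_fin] at h1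
      have h2 := Λ.finrank_range_add_finrank_ker
      have h3 := (LinearMap.range Λ).finrank_le
      rw [Module.finrank_fintype_fun_eq_card] at h2 h3
      rw [Fintype.card_fin] at h3
      omega
    have hv' : ∀ i, w i ⬝ᵥ F *ᵥ v = 0 := fun i => by
      rw [← hΛi, LinearMap.mem_ker.mp hv]; rfl
    refine ⟨Fin.cons v w, linearIndependent_finCons.mpr ⟨hw, hvw⟩, fun i j => ?_⟩
    refine Fin.cases ?_ (fun i => ?_) i <;> refine Fin.cases ?_ (fun j => ?_) j
    · have := dotProduct_mulVec_eq_neg hF v v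
      simp only [Fin.cons_zero]; linarith
    · simp only [Fin.cons_zero, Fin.cons_succ]
      rw [dotProduct_mulVec_eq_neg hF, hv' j, neg_zero]
    · simpa using hv' i
    · simpa using hww i j

variable [DecidableEq δ]

theorem det_ne_zero_of_mulVec {S : Matrix δ δ ℝ} (h : ∀ u, S *ᵥ u = 0 → u = 0) : S.det ≠ 0 := by
  have hSu : IsUnit S := by
    rw [← Matrix.mulVec_injective_iff_isUnit]
    intro u v huv
    exact sub_eq_zero.mp (h _ (by rw [Matrix.mulVec_sub]; exact sub_eq_zero.mpr huv))
  exact ((Matrix.isUnit_iff_isUnit_det S).mp hSu).ne_zero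

/-- A smooth nonsingular skew-symmetric matrix function is congruent to a constant one. -/
theorem exists_smooth_congruence (h12 : t₁ < t₂) {m : ℕ∞} {F : ℝ → Matrix δ δ ℝ}
    (hF : MatSmoothOn (m + 1) (Set.Icc t₁ t₂) F) (hs : ∀ t ∈ Set.Icc t₁ t₂, (F t)ᵀ = -F t)
    (hdet : ∀ t ∈ Set.Icc t₁ t₂, (F t).det ≠ 0) :
    ∃ S : ℝ → Matrix δ δ ℝ, MatSmoothOn (m + 1) (Set.Icc t₁ t₂) S ∧
      ∀ t ∈ Set.Icc t₁ t₂, (S t)ᵀ * F t * S t = F t₁ := by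
  set I := Set.Icc t₁ t₂ with hIdef
  have hI : UniqueDiffOn ℝ I := uniqueDiffOn_Icc h12
  set D := matDeriv I F with hD
  have hFD : ∀ t ∈ I, MatHasDeriv I F (D t) t := fun t ht => hF.hasDeriv le_add_self ht
  have hDskew : ∀ t ∈ I, (D t)ᵀ = -D t := fun t ht => by
    ext i j
    have := derivWithin_congr (s := I) (x := t) (f := fun s => -F s i j) (f₁ := fun s => F s j i)
      (fun s hs' => congrFun (congrFun (hs s hs') i) j) (congrFun (congrFun (hs t ht) i) j)
    simp only [hD, matDeriv, Matrix.transpose_apply, Matrix.of_apply, Matrix.neg_apply]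
    rw [this, derivWithin.fun_neg]
  -- Chosen so that `KᵀF = F K = -½ Ḟ`; then `SᵀF S` is constant along `Ṡ = K S`.
  set K : ℝ → Matrix δ δ ℝ := fun t => -((1 / 2 : ℝ) • ((F t)⁻¹ * D t)) with hK
  have hKs : MatSmoothOn m I K :=
    (MatSmoothOn.smul contDiffOn_const
      (((hF.mono le_self_add).inv hdet).mul (hF.matDeriv hI))).neg
  have hFK : ∀ t ∈ I, F t * K t = -((1 / 2 : ℝ) • D t) := fun t ht => by
    simp only [hK, Matrix.mul_neg, Matrix.mul_smul]
    rw [Matrix.mul_nonsing_inv_cancel_left _ _ (hdet t ht).isUnit]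
  have hKF : ∀ t ∈ I, (K t)ᵀ * F t = -((1 / 2 : ℝ) • D t) := fun t ht => by
    have h1 := congrArg Matrix.transpose (hFK t ht)
    have h2 : (-((1 / 2 : ℝ) • D t))ᵀ = (1 / 2 : ℝ) • D t := by
      rw [Matrix.transpose_neg, Matrix.transpose_smul, hDskew t ht, smul_neg, neg_neg]
    rw [Matrix.transpose_mul, hs t ht, Matrix.mul_neg, h2] at h1
    exact neg_eq_iff_eq_neg.mp h1
  obtain ⟨S, hS1, hS⟩ := exists_matHasDeriv_mul h12.le (hKs.mono zero_le) (1 : Matrix δ δ ℝ)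
  refine ⟨S, MatSmoothOn.of_matHasDeriv_mul h12 hKs hS, fun t ht => ?_⟩
  rw [eq_left_of_matHasDeriv_zero (X := fun t => (S t)ᵀ * F t * S t) (fun s hs' => ?_) ht, hS1]
  · simp
  · have h1 := ((hS s hs').transpose.mul (hFD s hs')).mul (hS s hs')
    have h2 : ((K s * S s)ᵀ * F s + (S s)ᵀ * D s) * S s + (S s)ᵀ * F s * (K s * S s)
        = (S s)ᵀ * ((K s)ᵀ * F s + D s + F s * K s) * S s := by
      simp only [Matrix.transpose_mul, Matrix.mul_add, Matrix.add_mul, Matrix.mul_assoc]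
    have h3 : -((1 / 2 : ℝ) • D s) + D s + -((1 / 2 : ℝ) • D s) = 0 := by
      ext i j
      simp only [Matrix.add_apply, Matrix.neg_apply, Matrix.smul_apply, Matrix.zero_apply,
        smul_eq_mul]
      ring
    rw [h2, hKF s hs', hFK s hs', h3, Matrix.mul_zero, Matrix.zero_mul] at h1
    exact h1

/-- A smooth orthogonal frame whose second half spans a Lagrangian subspace. -/
theorem exists_smooth_lagrangian_frame (h12 : t₁ < t₂) {m : ℕ∞} {p : ℕ}
    (hp : p + p = Fintype.card δ) {F : ℝ → Matrix δ δ ℝ}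
    (hF : MatSmoothOn (m + 1) (Set.Icc t₁ t₂) F) (hs : ∀ t ∈ Set.Icc t₁ t₂, (F t)ᵀ = -F t)
    (hdet : ∀ t ∈ Set.Icc t₁ t₂, (F t).det ≠ 0) :
    ∃ V : ℝ → Matrix δ (Fin p ⊕ Fin p) ℝ, MatSmoothOn (m + 1) (Set.Icc t₁ t₂) V ∧
      ∀ t ∈ Set.Icc t₁ t₂, IsOrthogonal (V t) ∧ (V t).toCols₂ᵀ * F t * (V t).toCols₂ = 0 := by
  have ht₁ : t₁ ∈ Set.Icc t₁ t₂ := Set.left_mem_Icc.mpr h12.le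
  obtain ⟨S, hSs, hS⟩ := exists_smooth_congruence h12 hF hs hdet
  obtain ⟨w, hw, hww⟩ := exists_linearIndependent_isotropic (hs t₁ ht₁) (q := p) (by omega)
  set W : Matrix δ (Fin p) ℝ := (Matrix.of w)ᵀ with hW
  have hWr : W.rank = p := by
    rw [hW, Matrix.rank_transpose, LinearIndependent.rank_matrix (by exact hw), Fintype.card_fin]
  have hWW : Wᵀ * F t₁ * W = 0 := by
    ext i j
    rw [Matrix.mul_assoc, Matrix.mul_apply]
    exact hww i j
  have hSinj : ∀ t ∈ Set.Icc t₁ t₂, ∀ u, S t *ᵥ u = 0 → u = 0 := fun t ht u hu => by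
    have h1 : F t₁ *ᵥ u = 0 := by rw [← hS t ht, ← Matrix.mulVec_mulVec, hu, Matrix.mulVec_zero]
    have h2 := congrArg ((F t₁)⁻¹ *ᵥ ·) h1
    simpa [Matrix.mulVec_mulVec, Matrix.nonsing_inv_mul _ (hdet t₁ ht₁).isUnit] using h2
  have hSWinj : ∀ t ∈ Set.Icc t₁ t₂, ∀ u, (S t * W) *ᵥ u = 0 → u = 0 := fun t ht u hu => by
    rw [← Matrix.mulVec_mulVec] at hu
    exact eq_zero_of_mulVec_eq_zero_of_rank (by rw [hWr, Fintype.card_fin]) (hSinj t ht _ hu)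
  -- `S` carries the constant Lagrangian `W` of `F(t₁)` to a Lagrangian `S W` of `F(t)`. The first
  -- block of `V` spans the orthogonal complement of `range (S W)`, so the second block spans that
  -- range itself: `S W = V₂ Y` with `Y` invertible.
  obtain ⟨V, hVs, hV⟩ := exists_smooth_kernel_frame (κ₁ := Fin p) (κ₂ := Fin p) h12
    (M := fun t => (S t * W)ᵀ) (hSs.mul (MatSmoothOn.const W)).transpose
    (fun t ht => by
      rw [Matrix.rank_transpose, rank_eq_card_of_mulVec (hSWinj t ht), Fintype.card_fin, hp])
    (by rw [Fintype.card_fin, hp])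
  refine ⟨V, hVs, fun t ht => ⟨(hV t ht).1, ?_⟩⟩
  set V₁ := (V t).toCols₁ with hV₁
  set V₂ := (V t).toCols₂ with hV₂
  have hVV : V t = Matrix.fromCols V₁ V₂ := (Matrix.fromCols_toCols (V t)).symm
  set Y := V₂ᵀ * (S t * W) with hY
  have h1 : V₁ᵀ * (S t * W) = 0 := by
    rw [← Matrix.transpose_transpose (S t * W), ← Matrix.transpose_mul, (hV t ht).2,
      Matrix.transpose_zero]
  have h2 : S t * W = V₂ * Y := by
    have h3 := (hV t ht).1.2
    rw [hVV, Matrix.transpose_fromCols, Matrix.fromCols_mul_fromRows] at h3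
    calc S t * W = (V₁ * V₁ᵀ + V₂ * V₂ᵀ) * (S t * W) := by rw [h3, Matrix.one_mul]
      _ = V₂ * Y := by
        rw [Matrix.add_mul, Matrix.mul_assoc, h1, Matrix.mul_zero, zero_add, Matrix.mul_assoc]
  have hYdet : IsUnit Y.det := (det_ne_zero_of_mulVec fun u hu => hSWinj t ht u (by
    rw [h2, ← Matrix.mulVec_mulVec, hu, Matrix.mulVec_zero])).isUnit
  have h4 : Yᵀ * (V₂ᵀ * F t * V₂) * Y = 0 := by
    have h5 : (S t * W)ᵀ * F t * (S t * W) = 0 := by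
      rw [Matrix.transpose_mul]
      calc Wᵀ * (S t)ᵀ * F t * (S t * W) = Wᵀ * ((S t)ᵀ * F t * S t) * W := by
            simp only [Matrix.mul_assoc]
        _ = 0 := by rw [hS t ht, hWW]
    rw [h2, Matrix.transpose_mul] at h5
    rw [← h5]
    simp only [Matrix.mul_assoc]
  have h6 : Yᵀ * (V₂ᵀ * F t * V₂) = 0 := by
    have := congrArg (· * Y⁻¹) h4
    simpa [Matrix.mul_nonsing_inv_cancel_right _ _ hYdet] using this
  have h7 : IsUnit Yᵀ.det := by rwa [Matrix.det_transpose]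
  have := congrArg (Yᵀ⁻¹ * ·) h6
  simpa [Matrix.nonsing_inv_mul_cancel_left _ _ h7] using this

/-- The non-orthogonal factor of the restricted class. -/
def lowerFactor {p : ℕ} (H G : Matrix (Fin p) (Fin p) ℝ) :
    Matrix (Fin p ⊕ Fin p) (Fin p ⊕ Fin p) ℝ :=
  Matrix.fromBlocks 1 0 (-((1 / 2 : ℝ) • (G⁻¹ * H))) G⁻¹

/-- A completion of the square: `G⁻¹` normalizes the off-diagonal blocks, and the two entries `-½
G⁻¹H` each remove half of the skew block `H`. The lower right block must be zero, which is why a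
Lagrangian frame is needed. -/
theorem lowerFactor_congruence {p : ℕ} {H G : Matrix (Fin p) (Fin p) ℝ} (hH : Hᵀ = -H)
    (hG : IsUnit G.det) :
    (lowerFactor H G)ᵀ * Matrix.fromBlocks H G (-Gᵀ) 0 * lowerFactor H G = sympJ p := by
  have h1 : G * (G⁻¹ * H) = H := Matrix.mul_nonsing_inv_cancel_left _ _ hG
  have h2 : G * G⁻¹ = 1 := Matrix.mul_nonsing_inv _ hG
  have h3 : (G⁻¹)ᵀ * Gᵀ = 1 := by rw [← Matrix.transpose_mul, h2, Matrix.transpose_one]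
  have h4 : (G⁻¹ * H)ᵀ * Gᵀ = -H := by rw [← Matrix.transpose_mul, h1, hH]
  rw [Matrix.mul_assoc, lowerFactor, Matrix.fromBlocks_multiply, Matrix.fromBlocks_transpose,
    Matrix.fromBlocks_multiply, sympJ]
  simp only [Matrix.mul_one, Matrix.mul_neg, Matrix.mul_smul, h1, h2, Matrix.mul_zero,
    Matrix.zero_mul, add_zero, zero_add, Matrix.transpose_one, Matrix.one_mul, Matrix.transpose_neg,
    Matrix.transpose_smul, Matrix.neg_mul, Matrix.smul_mul, h4, Matrix.transpose_zero, h3,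
    smul_zero, neg_zero]
  congr 1
  ext i j
  simp only [Matrix.add_apply, Matrix.neg_apply, Matrix.smul_apply, Matrix.zero_apply,
    smul_eq_mul]
  ring

theorem lowerFactor_mul_inv {p : ℕ} {H G : Matrix (Fin p) (Fin p) ℝ} (hG : IsUnit G.det) :
    lowerFactor H G * Matrix.fromBlocks 1 0 ((1 / 2 : ℝ) • H) G = 1 := by
  rw [lowerFactor, Matrix.fromBlocks_multiply, ← Matrix.fromBlocks_one]
  simp [Matrix.nonsing_inv_mul _ hG]

theorem mul_fromBlocks_toCols₁ {ι κ σ α : Type*} [Fintype κ] [Fintype α] [DecidableEq α]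
    (U : Matrix ι (κ ⊕ α) ℝ) (B : Matrix κ σ ℝ) :
    (U * Matrix.fromBlocks B 0 0 (1 : Matrix α α ℝ)).toCols₁ = U.toCols₁ * B := by
  ext i j
  simp [Matrix.toCols₁, Matrix.mul_apply]

theorem MatSmoothOn.fromBlocks {ι κ σ α : Type*} {m : ℕ∞} {I : Set ℝ} {X : ℝ → Matrix ι κ ℝ}
    {Y : ℝ → Matrix ι σ ℝ} {Z : ℝ → Matrix α κ ℝ} {W : ℝ → Matrix α σ ℝ}
    (hX : MatSmoothOn m I X) (hY : MatSmoothOn m I Y) (hZ : MatSmoothOn m I Z)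
    (hW : MatSmoothOn m I W) :
    MatSmoothOn m I fun t => Matrix.fromBlocks (X t) (Y t) (Z t) (W t) := by
  rintro (i | i) (j | j)
  · exact hX i j
  · exact hY i j
  · exact hZ i j
  · exact hW i j

theorem MatSmoothOn.toCols₁ {ι κ σ : Type*} {m : ℕ∞} {I : Set ℝ} {X : ℝ → Matrix ι (κ ⊕ σ) ℝ}
    (hX : MatSmoothOn m I X) : MatSmoothOn m I fun t => (X t).toCols₁ :=
  fun i j => hX i (Sum.inl j)

theorem MatSmoothOn.toCols₂ {ι κ σ : Type*} {m : ℕ∞} {I : Set ℝ} {X : ℝ → Matrix ι (κ ⊕ σ) ℝ}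
    (hX : MatSmoothOn m I X) : MatSmoothOn m I fun t => (X t).toCols₂ :=
  fun i j => hX i (Sum.inr j)

theorem IsOrthogonal.mul {ι κ σ : Type*} [Fintype ι] [Fintype κ] [Fintype σ] [DecidableEq ι]
    [DecidableEq κ] [DecidableEq σ] {X : Matrix ι κ ℝ} {Y : Matrix κ σ ℝ} (hX : IsOrthogonal X)
    (hY : IsOrthogonal Y) : IsOrthogonal (X * Y) := by
  constructor
  · rw [Matrix.transpose_mul, Matrix.mul_assoc, ← Matrix.mul_assoc Xᵀ, hX.1, Matrix.one_mul, hY.1]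
  · rw [Matrix.transpose_mul, Matrix.mul_assoc, ← Matrix.mul_assoc Y, hY.2, Matrix.one_mul, hX.2]

/-- The transformation from the restricted class that normalizes the leading block to `J`. -/
theorem exists_restrictedTransformation (h12 : t₁ < t₂) {m : ℕ∞} {n p a : ℕ}
    {E : ℝ → Matrix (Fin n) (Fin n) ℝ} {U : ℝ → Matrix (Fin n) ((Fin p ⊕ Fin p) ⊕ Fin a) ℝ}
    (hE : MatSmoothOn (m + 1) (Set.Icc t₁ t₂) E) (hs : ∀ t ∈ Set.Icc t₁ t₂, (E t)ᵀ = -E t)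
    (hU : MatSmoothOn (m + 1) (Set.Icc t₁ t₂) U) (hUo : ∀ t ∈ Set.Icc t₁ t₂, IsOrthogonal (U t))
    (hnd : ∀ t ∈ Set.Icc t₁ t₂, ∀ u, ((U t).toCols₁ᵀ * E t * (U t).toCols₁) *ᵥ u = 0 → u = 0) :
    ∃ Q : ℝ → Matrix (Fin n) ((Fin p ⊕ Fin p) ⊕ Fin a) ℝ, MatSmoothOn (m + 1) (Set.Icc t₁ t₂) Q ∧
      IsRestrictedTransformation (m + 1) (Set.Icc t₁ t₂) Q ∧ ∀ t ∈ Set.Icc t₁ t₂,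
        IsNonsingular (Q t) ∧ (Q t).toCols₁ᵀ * E t * (Q t).toCols₁ = sympJ p ∧
        ∃ B : Matrix (Fin p ⊕ Fin p) (Fin p ⊕ Fin p) ℝ, (Q t).toCols₁ = (U t).toCols₁ * B := by
  set I := Set.Icc t₁ t₂ with hIdef
  set T : ℝ → Matrix (Fin n) (Fin p ⊕ Fin p) ℝ := fun t => (U t).toCols₁ with hT
  have hTs : MatSmoothOn (m + 1) I T := hU.toCols₁
  set F : ℝ → Matrix (Fin p ⊕ Fin p) (Fin p ⊕ Fin p) ℝ := fun t => (T t)ᵀ * E t * T t with hF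
  have hFs : MatSmoothOn (m + 1) I F := (hTs.transpose.mul hE).mul hTs
  have hFskew : ∀ t ∈ I, (F t)ᵀ = -F t := fun t ht => by
    simp only [hF, Matrix.transpose_mul, Matrix.transpose_transpose, hs t ht, Matrix.neg_mul,
      Matrix.mul_neg, Matrix.mul_assoc]
  have hFdet : ∀ t ∈ I, (F t).det ≠ 0 := fun t ht => det_ne_zero_of_mulVec (hnd t ht)
  obtain ⟨V, hVs, hV⟩ := exists_smooth_lagrangian_frame (p := p) h12 (by simp) hFs hFskew hFdet
  set H : ℝ → Matrix (Fin p) (Fin p) ℝ := fun t => (V t).toCols₁ᵀ * F t * (V t).toCols₁ with hH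
  set G : ℝ → Matrix (Fin p) (Fin p) ℝ := fun t => (V t).toCols₁ᵀ * F t * (V t).toCols₂ with hG
  have hHs : MatSmoothOn (m + 1) I H := (hVs.toCols₁.transpose.mul hFs).mul hVs.toCols₁
  have hGs : MatSmoothOn (m + 1) I G := (hVs.toCols₁.transpose.mul hFs).mul hVs.toCols₂
  have hHskew : ∀ t ∈ I, (H t)ᵀ = -H t := fun t ht => by
    simp only [hH, Matrix.transpose_mul, Matrix.transpose_transpose, hFskew t ht, Matrix.neg_mul,
      Matrix.mul_neg, Matrix.mul_assoc]
  have hVFV : ∀ t ∈ I, (V t)ᵀ * F t * V t = Matrix.fromBlocks (H t) (G t) (-(G t)ᵀ) 0 := by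
    intro t ht
    have h1 : (V t).toCols₂ᵀ * F t * (V t).toCols₁ = -(G t)ᵀ := by
      simp only [hG, Matrix.transpose_mul, Matrix.transpose_transpose, hFskew t ht,
        Matrix.neg_mul, Matrix.mul_neg, Matrix.mul_assoc, neg_neg]
    conv_lhs => rw [← Matrix.fromCols_toCols (V t)]
    rw [Matrix.transpose_fromCols, Matrix.fromRows_mul, Matrix.fromRows_mul_fromCols, h1,
      (hV t ht).2]
  -- A kernel vector `u` of `G` gives the kernel vector `(0, u)` of `VᵀF V`, again because the lower
  -- right block is zero.
  have hGdet : ∀ t ∈ I, IsUnit (G t).det := fun t ht => by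
    refine (det_ne_zero_of_mulVec fun u hu => ?_).isUnit
    have h1 : ((V t)ᵀ * F t * V t) *ᵥ Sum.elim 0 u = 0 := by
      rw [hVFV t ht, Matrix.fromBlocks_mulVec]
      simp only [Sum.elim_comp_inl, Sum.elim_comp_inr, Matrix.mulVec_zero, hu,
        Matrix.zero_mulVec, add_zero]
      ext i; rcases i with i | i <;> rfl
    have h2 : F t *ᵥ (V t *ᵥ Sum.elim 0 u) = 0 := by
      have := congrArg (V t *ᵥ ·) h1
      simp only [← Matrix.mulVec_mulVec, Matrix.mulVec_zero] at this
      rwa [Matrix.mulVec_mulVec _ (V t) (V t)ᵀ, (hV t ht).1.2, Matrix.one_mulVec] at this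
    have h3 := hnd t ht _ h2
    have h4 := congrArg ((V t)ᵀ *ᵥ ·) h3
    simp only [Matrix.mulVec_mulVec, (hV t ht).1.1, Matrix.one_mulVec, Matrix.mulVec_zero] at h4
    ext i
    exact congrFun h4 (Sum.inr i)
  set W : ℝ → Matrix (Fin p ⊕ Fin p) (Fin p ⊕ Fin p) ℝ := fun t => lowerFactor (H t) (G t) with hW
  have hGis : MatSmoothOn (m + 1) I fun t => (G t)⁻¹ := hGs.inv fun t ht => (hGdet t ht).ne_zero
  have hWs : MatSmoothOn (m + 1) I W := MatSmoothOn.fromBlocks (MatSmoothOn.const 1)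
    (MatSmoothOn.const 0) (MatSmoothOn.smul contDiffOn_const (hGis.mul hHs)).neg hGis
  set D : ℝ → Matrix ((Fin p ⊕ Fin p) ⊕ Fin a) ((Fin p ⊕ Fin p) ⊕ Fin a) ℝ := fun t =>
    Matrix.fromBlocks (V t) 0 0 1 with hD
  set D' : ℝ → Matrix ((Fin p ⊕ Fin p) ⊕ Fin a) ((Fin p ⊕ Fin p) ⊕ Fin a) ℝ := fun t =>
    Matrix.fromBlocks (W t) 0 0 1 with hD'
  have hDs : MatSmoothOn (m + 1) I D := MatSmoothOn.fromBlocks hVs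
    (MatSmoothOn.const 0) (MatSmoothOn.const 0) (MatSmoothOn.const 1)
  have hDs' : MatSmoothOn (m + 1) I D' := MatSmoothOn.fromBlocks hWs
    (MatSmoothOn.const 0) (MatSmoothOn.const 0) (MatSmoothOn.const 1)
  have hDo : ∀ t ∈ I, IsOrthogonal (D t) := fun t ht => by
    constructor <;>
    simp [hD, Matrix.fromBlocks_transpose, Matrix.fromBlocks_multiply, (hV t ht).1.1,
      (hV t ht).1.2]
  have hOo : ∀ t ∈ I, IsOrthogonal (U t * D t) := fun t ht => (hUo t ht).mul (hDo t ht)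
  have hWinv : ∀ t ∈ I, W t * Matrix.fromBlocks 1 0 ((1 / 2 : ℝ) • H t) (G t) = 1 :=
    fun t ht => lowerFactor_mul_inv (hGdet t ht)
  refine ⟨fun t => U t * D t * D' t, (hU.mul hDs).mul hDs',
    ⟨fun t => U t * D t, H, G, hU.mul hDs, hHs, hGs, fun t ht => ⟨hOo t ht, hHskew t ht,
      ⟨(G t)⁻¹, Matrix.mul_nonsing_inv _ (hGdet t ht), Matrix.nonsing_inv_mul _ (hGdet t ht)⟩,
      rfl⟩⟩, fun t ht => ⟨?_, ?_, V t * W t, ?_⟩⟩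
  · set D'' : Matrix ((Fin p ⊕ Fin p) ⊕ Fin a) ((Fin p ⊕ Fin p) ⊕ Fin a) ℝ :=
      Matrix.fromBlocks (Matrix.fromBlocks 1 0 ((1 / 2 : ℝ) • H t) (G t)) 0 0 1 with hD''
    have h1 : D' t * D'' = 1 := by
      rw [hD', hD'', Matrix.fromBlocks_multiply, hWinv t ht]
      simp
    have h2 : D'' * D' t = 1 := (Matrix.mul_eq_one_comm_of_card_eq _ _ _ rfl).mp h1
    refine ⟨D'' * (U t * D t)ᵀ, ?_, ?_⟩
    · rw [Matrix.mul_assoc, ← Matrix.mul_assoc (D' t), h1, Matrix.one_mul, (hOo t ht).2]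
    · rw [Matrix.mul_assoc, ← Matrix.mul_assoc _ (U t * D t), (hOo t ht).1, Matrix.one_mul, h2]
  · simp only [hD, hD']
    rw [mul_fromBlocks_toCols₁, mul_fromBlocks_toCols₁, Matrix.transpose_mul, Matrix.transpose_mul,
      ← lowerFactor_congruence (hHskew t ht) (hGdet t ht), ← hVFV t ht]
    simp only [hF, hT, hW, Matrix.mul_assoc]
  · simp only [hD, hD']
    rw [mul_fromBlocks_toCols₁, mul_fromBlocks_toCols₁, Matrix.mul_assoc]

end Symplectic

/-! ### Smooth bases from the rank conditions -/

section Bases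

variable {n μ a : ℕ} {I : Set ℝ} {E A : ℝ → Matrix (Fin n) (Fin n) ℝ} {t t₁ t₂ : ℝ}
  {δ : Type*} [Fintype δ]

theorem mulVec_sumElim {ι κ σ : Type*} [Fintype κ] [Fintype σ] (X : Matrix ι (κ ⊕ σ) ℝ)
    (u : κ → ℝ) (v : σ → ℝ) : X *ᵥ Sum.elim u v = X.toCols₁ *ᵥ u + X.toCols₂ *ᵥ v := by
  conv_lhs => rw [← Matrix.fromCols_toCols X]
  exact Matrix.fromCols_mulVec_sumElim _ _ _ _

theorem IsNonsingular.eq_zero_of_mulVec {ι κ : Type*} [Fintype ι] [Fintype κ] [DecidableEq ι]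
    [DecidableEq κ] {X : Matrix ι κ ℝ} (hX : IsNonsingular X) {v : κ → ℝ} (hv : X *ᵥ v = 0) :
    v = 0 := by
  obtain ⟨Y, -, hY⟩ := hX
  rw [← Matrix.one_mulVec v, ← hY, ← Matrix.mulVec_mulVec, hv, Matrix.mulVec_zero]

theorem isNonsingular_of_mulVec [DecidableEq δ] {S : Matrix δ δ ℝ}
    (h : ∀ u, S *ᵥ u = 0 → u = 0) : IsNonsingular S :=
  ⟨S⁻¹, Matrix.mul_nonsing_inv S (det_ne_zero_of_mulVec h).isUnit,
    Matrix.nonsing_inv_mul S (det_ne_zero_of_mulVec h).isUnit⟩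

theorem IsOrthogonal.rank_toCols₁ {ι κ σ : Type*} [Fintype ι] [Fintype κ] [Fintype σ]
    [DecidableEq ι] [DecidableEq κ] [DecidableEq σ] {O : Matrix ι (κ ⊕ σ) ℝ}
    (hO : IsOrthogonal O) : O.toCols₁.rank = Fintype.card κ := by
  apply rank_eq_card_of_mulVec
  intro v hv
  have h := IsNonsingular.eq_zero_of_mulVec ⟨Oᵀ, hO.2, hO.1⟩ (v := Sum.elim v 0)
    (by rw [mulVec_sumElim, hv, Matrix.mulVec_zero, add_zero])
  ext i
  exact congrFun h (Sum.inl i)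

theorem HypMatrices.isNullBasis {Z₂ : Matrix (Fin (μ + 1) × Fin n) (Fin a) ℝ}
    {T₂ Z₁ : Matrix (Fin n) δ ℝ} (h : HypMatrices I E A μ t Z₂ T₂ Z₁) :
    IsNullBasis I E A μ t Z₂ :=
  ⟨by rw [h.rank_Z₂, Fintype.card_fin], h.Z₂_M⟩

theorem HypMatrices.isConsistentBasis {Z₂ : Matrix (Fin (μ + 1) × Fin n) (Fin a) ℝ}
    {T₂ Z₁ : Matrix (Fin n) δ ℝ} (h : HypMatrices I E A μ t Z₂ T₂ Z₁)
    (hr : (inflM I E A μ t).rank + a = (μ + 1) * n) : IsConsistentBasis I E A μ t T₂ :=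
  ⟨h.rank_T₂, fun u => (h.isNullBasis.isConsistent_iff hr).mpr <| by
    rw [Matrix.mulVec_mulVec, h.A₂_T₂, Matrix.zero_mulVec]⟩

theorem SatisfiesHyp.isRegularAt {d : ℕ} (h : SatisfiesHyp I E A μ a d) (ht : t ∈ I) :
    IsRegularAt I E A μ a t := by
  obtain ⟨hr, Z₂, T₂, Z₁, hm⟩ := h.2 t ht
  refine ⟨hr, fun z hz hzN => ?_, fun v hv hEv => ?_⟩
  · obtain ⟨β, rfl⟩ := hm.isNullBasis.exists_eq hr hz
    have hβ : (Z₂ᵀ * inflN I A μ t)ᵀ *ᵥ β = 0 := by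
      rw [Matrix.mulVec_transpose, ← Matrix.vecMul_vecMul, Matrix.vecMul_transpose, hzN]
    rw [eq_zero_of_mulVec_eq_zero_of_rank (by rw [Matrix.rank_transpose, hm.rank_A₂]) hβ,
      Matrix.mulVec_zero]
  · obtain ⟨u, rfl⟩ := exists_mulVec_eq_of_mulVec_eq_zero hm.A₂_T₂
      (by rw [hm.rank_A₂, hm.rank_T₂]; simp only [Fintype.card_fin]; have := h.1; omega)
      ((hm.isNullBasis.isConsistent_iff hr).mp hv)
    rw [Matrix.mulVec_mulVec] at hEv
    rw [eq_zero_of_mulVec_eq_zero_of_rank hm.rank_E_T₂ hEv, Matrix.mulVec_zero]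

theorem IsRegularAt.rank_transpose_mul_inflN (h : IsRegularAt I E A μ a t)
    {Z : Matrix (Fin (μ + 1) × Fin n) (Fin a) ℝ} (hZ : IsNullBasis I E A μ t Z) :
    (Zᵀ * inflN I A μ t).rank = a := by
  rw [← Matrix.rank_transpose]
  refine (rank_eq_card_of_mulVec fun β hβ => ?_).trans (Fintype.card_fin a)
  apply eq_zero_of_mulVec_eq_zero_of_rank (hZ.rank.trans (Fintype.card_fin a).symm)
  apply h.eq_zero_of_null _ (hZ.vecMul_eq_zero β)
  rw [← Matrix.vecMul_transpose, Matrix.vecMul_vecMul, ← Matrix.mulVec_transpose, hβ]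

theorem IsConsistentBasis.exists_eq {T : Matrix (Fin n) δ ℝ} (hT : IsConsistentBasis I E A μ t T)
    (h : IsRegularAt I E A μ a t) {Z : Matrix (Fin (μ + 1) × Fin n) (Fin a) ℝ}
    (hZ : IsNullBasis I E A μ t Z) (hcard : Fintype.card δ + a = n) {v : Fin n → ℝ}
    (hv : (Zᵀ * inflN I A μ t) *ᵥ v = 0) : ∃ u, T *ᵥ u = v := by
  classical
  refine exists_mulVec_eq_of_mulVec_eq_zero ?_ ?_ hv
  · apply Matrix.ext_of_mulVec_single
    intro i
    rw [← Matrix.mulVec_mulVec, (hZ.isConsistent_iff h.rank).mp (hT.consistent _),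
      Matrix.zero_mulVec]
  · rw [h.rank_transpose_mul_inflN hZ, hT.rank, Fintype.card_fin]; omega

theorem exists_smooth_nullBasis (h12 : t₁ < t₂) {m : ℕ∞}
    (hM : MatSmoothOn (m + 1) (Set.Icc t₁ t₂) (inflM (Set.Icc t₁ t₂) E A μ))
    (hr : ∀ t ∈ Set.Icc t₁ t₂, (inflM (Set.Icc t₁ t₂) E A μ t).rank + a = (μ + 1) * n) :
    ∃ Z : ℝ → Matrix (Fin (μ + 1) × Fin n) (Fin a) ℝ, MatSmoothOn (m + 1) (Set.Icc t₁ t₂) Z ∧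
      ∀ t ∈ Set.Icc t₁ t₂, IsNullBasis (Set.Icc t₁ t₂) E A μ t (Z t) := by
  have h0 := hr t₁ (Set.left_mem_Icc.mpr h12.le)
  obtain ⟨O, hO, hOp⟩ := exists_smooth_kernel_frame (κ₁ := Fin a)
    (κ₂ := Fin ((μ + 1) * n - a)) h12 hM.transpose
    (fun t ht => by rw [Matrix.rank_transpose, Fintype.card_fin, hr t ht]; simp)
    (by simp; omega)
  refine ⟨fun t => (O t).toCols₁, hO.toCols₁, fun t ht => ⟨?_, ?_⟩⟩
  · rw [(hOp t ht).1.rank_toCols₁, Fintype.card_fin]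
  · rw [← Matrix.transpose_transpose (inflM (Set.Icc t₁ t₂) E A μ t), ← Matrix.transpose_mul,
      (hOp t ht).2, Matrix.transpose_zero]

theorem exists_smooth_consistent_frame [DecidableEq δ] (h12 : t₁ < t₂) {m : ℕ∞}
    (hN : MatSmoothOn (m + 1) (Set.Icc t₁ t₂) (inflN (Set.Icc t₁ t₂) A μ))
    (hreg : ∀ t ∈ Set.Icc t₁ t₂, IsRegularAt (Set.Icc t₁ t₂) E A μ a t)
    {Z : ℝ → Matrix (Fin (μ + 1) × Fin n) (Fin a) ℝ} (hZ : MatSmoothOn (m + 1) (Set.Icc t₁ t₂) Z)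
    (hZb : ∀ t ∈ Set.Icc t₁ t₂, IsNullBasis (Set.Icc t₁ t₂) E A μ t (Z t))
    (hcard : Fintype.card δ + a = n) :
    ∃ U : ℝ → Matrix (Fin n) (δ ⊕ Fin a) ℝ, MatSmoothOn (m + 1) (Set.Icc t₁ t₂) U ∧
      ∀ t ∈ Set.Icc t₁ t₂, IsOrthogonal (U t) ∧
        IsConsistentBasis (Set.Icc t₁ t₂) E A μ t (U t).toCols₁ := by
  obtain ⟨U, hU, hUp⟩ := exists_smooth_kernel_frame (κ₁ := δ) (κ₂ := Fin a) h12
    (hZ.transpose.mul hN)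
    (fun t ht => by
      rw [(hreg t ht).rank_transpose_mul_inflN (hZb t ht), Fintype.card_fin]; omega)
    (by simpa using hcard)
  refine ⟨U, hU, fun t ht => ⟨(hUp t ht).1, (hUp t ht).1.rank_toCols₁, fun u => ?_⟩⟩
  rw [(hZb t ht).isConsistent_iff (hreg t ht).rank, Matrix.mulVec_mulVec, (hUp t ht).2,
    Matrix.zero_mulVec]

theorem even_of_transpose_eq_neg {d : ℕ} {F : Matrix (Fin d) (Fin d) ℝ} (hF : Fᵀ = -F)
    (hdet : F.det ≠ 0) : Even d := by
  by_contra hd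
  have h := Matrix.det_transpose F
  rw [hF, Matrix.det_neg, Fintype.card_fin, (Nat.not_even_iff_odd.mp hd).neg_one_pow] at h
  exact hdet (by linarith)

theorem transpose_mul_mul_skew {ι κ : Type*} [Fintype ι] {S : Matrix ι ι ℝ} (hS : Sᵀ = -S)
    (T : Matrix ι κ ℝ) : (Tᵀ * S * T)ᵀ = -(Tᵀ * S * T) := by
  simp [Matrix.transpose_mul, hS, Matrix.mul_assoc]

theorem sympJ_mul_self (p : ℕ) : sympJ p * sympJ p = -1 := by
  rw [sympJ, Matrix.fromBlocks_multiply, ← Matrix.fromBlocks_one, Matrix.fromBlocks_neg]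
  simp

theorem sympJ_inv (p : ℕ) : (sympJ p)⁻¹ = -sympJ p := by
  apply Matrix.inv_eq_right_inv
  rw [Matrix.mul_neg, sympJ_mul_self, neg_neg]

theorem sympJ_transpose (p : ℕ) : (sympJ p)ᵀ = -sympJ p := by
  rw [sympJ, Matrix.fromBlocks_transpose, Matrix.fromBlocks_neg]
  simp

theorem inv_sympJ_mul (p : ℕ) : (sympJ p)⁻¹ * sympJ p = 1 := by
  rw [sympJ_inv, Matrix.neg_mul, sympJ_mul_self, neg_neg]

end Bases

/-! ### Symplectic flows -/

section Flow

variable {p : ℕ} {t₁ t₂ : ℝ} {C : ℝ → Matrix (Fin p ⊕ Fin p) (Fin p ⊕ Fin p) ℝ}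

/-- The form `J` is invariant under linear Hamiltonian differential equations. -/
theorem transpose_mul_sympJ_mul_eq_left (hC : ∀ t ∈ Set.Icc t₁ t₂, (C t)ᵀ = C t)
    {Φ : ℝ → Matrix (Fin p ⊕ Fin p) (Fin p ⊕ Fin p) ℝ}
    (hΦ : ∀ t ∈ Set.Icc t₁ t₂, MatHasDeriv (Set.Icc t₁ t₂) Φ ((sympJ p)⁻¹ * C t * Φ t) t)
    {t : ℝ} (ht : t ∈ Set.Icc t₁ t₂) :
    (Φ t)ᵀ * sympJ p * Φ t = (Φ t₁)ᵀ * sympJ p * Φ t₁ := by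
  refine eq_left_of_matHasDeriv_zero (X := fun s => (Φ s)ᵀ * sympJ p * Φ s) (fun s hs => ?_) ht
  have hJ : MatHasDeriv (Set.Icc t₁ t₂) (fun _ => sympJ p) 0 s :=
    fun i j => hasDerivWithinAt_const _ _ _
  have h := ((hΦ s hs).transpose.mul hJ).mul (hΦ s hs)
  convert h using 1
  simp only [Matrix.transpose_mul, hC s hs, sympJ_inv, Matrix.transpose_neg, sympJ_transpose,
    neg_neg, Matrix.mul_zero, add_zero, Matrix.neg_mul, Matrix.mul_neg]
  have h1 : (Φ s)ᵀ * (C s * sympJ p) * sympJ p * Φ s = -((Φ s)ᵀ * C s * Φ s) := by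
    rw [show (Φ s)ᵀ * (C s * sympJ p) * sympJ p * Φ s
      = (Φ s)ᵀ * C s * (sympJ p * sympJ p) * Φ s by simp only [Matrix.mul_assoc], sympJ_mul_self]
    simp
  have h2 : (Φ s)ᵀ * sympJ p * (sympJ p * C s * Φ s) = -((Φ s)ᵀ * C s * Φ s) := by
    rw [show (Φ s)ᵀ * sympJ p * (sympJ p * C s * Φ s)
      = (Φ s)ᵀ * (sympJ p * sympJ p) * (C s * Φ s) by simp only [Matrix.mul_assoc], sympJ_mul_self]
    simp [Matrix.mul_assoc]
  rw [h1, h2]; simp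

theorem isSymplectic_of_isFlow (hC : ∀ t ∈ Set.Icc t₁ t₂, (C t)ᵀ = C t)
    {L Φ : ℝ → Matrix (Fin p ⊕ Fin p) (Fin p ⊕ Fin p) ℝ}
    (hL : ∀ t ∈ Set.Icc t₁ t₂, L t = (sympJ p)⁻¹ * C t) {t₀ t : ℝ} (ht₀ : t₀ ∈ Set.Icc t₁ t₂)
    (hΦ : IsFlow (Set.Icc t₁ t₂) L t₀ Φ) (ht : t ∈ Set.Icc t₁ t₂) : IsSymplectic (Φ t) := by
  have hΦ' : ∀ s ∈ Set.Icc t₁ t₂,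
      MatHasDeriv (Set.Icc t₁ t₂) Φ ((sympJ p)⁻¹ * C s * Φ s) s := fun s hs => by
    rw [← hL s hs]; exact hΦ.2 s hs
  rw [IsSymplectic, transpose_mul_sympJ_mul_eq_left hC hΦ' ht,
    ← transpose_mul_sympJ_mul_eq_left hC hΦ' ht₀, hΦ.1]
  simp

theorem exists_isFlow (h12 : t₁ ≤ t₂) (hCs : MatSmoothOn 0 (Set.Icc t₁ t₂) C)
    (hC : ∀ t ∈ Set.Icc t₁ t₂, (C t)ᵀ = C t)
    {L : ℝ → Matrix (Fin p ⊕ Fin p) (Fin p ⊕ Fin p) ℝ}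
    (hL : ∀ t ∈ Set.Icc t₁ t₂, L t = (sympJ p)⁻¹ * C t) {t₀ : ℝ} (ht₀ : t₀ ∈ Set.Icc t₁ t₂) :
    ∃ Φ, IsFlow (Set.Icc t₁ t₂) L t₀ Φ := by
  obtain ⟨Ψ, hΨ1, hΨ⟩ := exists_matHasDeriv_mul h12
    (K := fun t => (sympJ p)⁻¹ * C t) ((MatSmoothOn.const _).mul hCs)
    (1 : Matrix (Fin p ⊕ Fin p) (Fin p ⊕ Fin p) ℝ)
  have hs := transpose_mul_sympJ_mul_eq_left hC hΨ ht₀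
  rw [hΨ1, Matrix.transpose_one, Matrix.one_mul, Matrix.mul_one] at hs
  -- The symplectic inverse of `Ψ t₀`. Multiplying the solution based at `t₁` by it on the right
  -- moves the base point to `t₀`.
  set Y := (sympJ p)⁻¹ * (Ψ t₀)ᵀ * sympJ p with hY
  have hinv : Ψ t₀ * Y = 1 := by
    rw [mul_eq_one_comm, hY, Matrix.mul_assoc, Matrix.mul_assoc, ← Matrix.mul_assoc (Ψ t₀)ᵀ,
      hs, inv_sympJ_mul]
  refine ⟨fun t => Ψ t * Y, hinv, fun t ht => ?_⟩
  have hconst : MatHasDeriv (Set.Icc t₁ t₂) (fun _ => Y) 0 t :=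
    fun i j => hasDerivWithinAt_const _ _ _
  have h := (hΨ t ht).mul hconst
  rw [Matrix.mul_zero, add_zero, Matrix.mul_assoc, ← hL t ht] at h
  exact h

end Flow

/-! ### The inherent ODE of a symplectically normalized transformation -/

section Inherent

variable {n μ a p : ℕ} {E A : ℝ → Matrix (Fin n) (Fin n) ℝ} {t t₁ t₂ : ℝ}

/-- A transformation of class `C^m` whose first block of columns spans the space of consistent
values and transforms `E` to `J`. -/
structure IsNormalizing (m : ℕ∞) (I : Set ℝ) (E A : ℝ → Matrix (Fin n) (Fin n) ℝ) (μ : ℕ)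
    (Q : ℝ → Matrix (Fin n) ((Fin p ⊕ Fin p) ⊕ Fin a) ℝ) : Prop where
  smooth : MatSmoothOn m I Q
  nonsingular : ∀ t ∈ I, IsNonsingular (Q t)
  consistent : ∀ t ∈ I, IsConsistentBasis I E A μ t (Q t).toCols₁
  normalized : ∀ t ∈ I, (Q t).toCols₁ᵀ * E t * (Q t).toCols₁ = sympJ p

variable {Q : ℝ → Matrix (Fin n) ((Fin p ⊕ Fin p) ⊕ Fin a) ℝ}
  {Z Z₂ : ℝ → Matrix (Fin (μ + 1) × Fin n) (Fin a) ℝ} {T Z₁ : ℝ → Matrix (Fin n) (Fin p ⊕ Fin p) ℝ}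
  {m : ℕ∞} {I : Set ℝ}

theorem card_sum_add (hQ : IsNonsingular (Q t)) : Fintype.card (Fin p ⊕ Fin p) + a = n := by
  obtain ⟨Y, h1, h2⟩ := hQ
  have h := Matrix.square_of_invertible (Q t) Y h1 h2
  simpa using h.symm

theorem IsNormalizing.hatA₂₁_eq_zero (hQ : IsNormalizing m I E A μ Q) (ht : t ∈ I)
    (hreg : IsRegularAt I E A μ a t) (hZ : IsNullBasis I E A μ t (Z₂ t)) :
    hatA₂₁ I A μ Z₂ Q t = 0 := by
  apply Matrix.ext_of_mulVec_single
  intro i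
  rw [hatA₂₁, ← Matrix.mulVec_mulVec,
    (hZ.isConsistent_iff hreg.rank).mp ((hQ.consistent t ht).consistent _), Matrix.zero_mulVec]

/-- The kernel of `Â₂` is exactly the span of the first block of `Q`, which the second block meets
only in zero. -/
theorem IsNormalizing.eq_zero_of_hatA₂₂ (hQ : IsNormalizing m I E A μ Q) (ht : t ∈ I)
    (hreg : IsRegularAt I E A μ a t) (hZ : IsNullBasis I E A μ t (Z₂ t)) {v : Fin a → ℝ}
    (hv : hatA₂₂ I A μ Z₂ Q t *ᵥ v = 0) : v = 0 := by
  rw [hatA₂₂, ← Matrix.mulVec_mulVec] at hv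
  obtain ⟨w, hw⟩ := (hQ.consistent t ht).exists_eq hreg hZ (card_sum_add (hQ.nonsingular t ht)) hv
  have h := (hQ.nonsingular t ht).eq_zero_of_mulVec (v := Sum.elim (-w) v)
    (by rw [mulVec_sumElim, Matrix.mulVec_neg, hw, neg_add_cancel])
  ext i
  exact congrFun h (Sum.inr i)

theorem IsNormalizing.elimR_eq_zero (hQ : IsNormalizing m I E A μ Q) (ht : t ∈ I)
    (hreg : IsRegularAt I E A μ a t) (hZ : IsNullBasis I E A μ t (Z₂ t)) :
    elimR I A μ Z₂ Q t = 0 := by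
  rw [elimR, hQ.hatA₂₁_eq_zero ht hreg hZ, Matrix.mul_zero, neg_zero]

theorem IsNormalizing.elimE_eq (hQ : IsNormalizing m I E A μ Q) (ht : t ∈ I)
    (hreg : IsRegularAt I E A μ a t) (hZ : IsNullBasis I E A μ t (Z₂ t)) :
    elimE I E A μ Z₂ Z₁ Q t = (Z₁ t)ᵀ * E t * (Q t).toCols₁ := by
  rw [elimE, hQ.elimR_eq_zero ht hreg hZ, Matrix.mul_zero, add_zero]

/-- The first block of `Q` and the `T` of the given choice span the same space of consistent values,
so the rank condition on `Z₁ᵀE T` transfers. -/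
theorem IsNormalizing.eq_zero_of_elimE (hQ : IsNormalizing m I E A μ Q) (ht : t ∈ I)
    (hreg : IsRegularAt I E A μ a t) (hc : HypMatrices I E A μ t (Z₂ t) (T t) (Z₁ t))
    {u : Fin p ⊕ Fin p → ℝ} (hu : elimE I E A μ Z₂ Z₁ Q t *ᵥ u = 0) : u = 0 := by
  rw [hQ.elimE_eq ht hreg hc.isNullBasis, ← Matrix.mulVec_mulVec] at hu
  obtain ⟨w, hw⟩ := (hc.isConsistentBasis hreg.rank).exists_eq hreg hc.isNullBasis
    (card_sum_add (hQ.nonsingular t ht))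
    ((hc.isNullBasis.isConsistent_iff hreg.rank).mp ((hQ.consistent t ht).consistent u))
  rw [← hw, Matrix.mulVec_mulVec] at hu
  rw [eq_zero_of_mulVec_eq_zero_of_rank hc.rank_E₁_T₂ hu, Matrix.mulVec_zero] at hw
  exact eq_zero_of_mulVec_eq_zero_of_rank (hQ.consistent t ht).rank hw.symm

/-- The symmetric coefficient of the Hamiltonian inherent ODE. -/
def hamiltonianCoeff (I : Set ℝ) (E A : ℝ → Matrix (Fin n) (Fin n) ℝ)
    (Q : ℝ → Matrix (Fin n) ((Fin p ⊕ Fin p) ⊕ Fin a) ℝ) (t : ℝ) :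
    Matrix (Fin p ⊕ Fin p) (Fin p ⊕ Fin p) ℝ :=
  (Q t).toCols₁ᵀ * (A t * (Q t).toCols₁ - E t * (matDeriv I Q t).toCols₁)

theorem IsNormalizing.hamiltonianCoeff_smooth (hI : UniqueDiffOn ℝ I)
    (hQ : IsNormalizing (m + 1) I E A μ Q) (hE : MatSmoothOn m I E) (hA : MatSmoothOn m I A) :
    MatSmoothOn m I (hamiltonianCoeff I E A Q) := by
  have hQ1 : MatSmoothOn m I fun t => (Q t).toCols₁ := (hQ.smooth.mono le_self_add).toCols₁
  exact hQ1.transpose.mul ((hA.mul hQ1).sub (hE.mul (hQ.smooth.matDeriv hI).toCols₁))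

/-- By self-adjointness `Cᵀ - C` is the derivative of `T₂ᵀE T₂`, which is the constant `J`. -/
theorem IsNormalizing.hamiltonianCoeff_transpose (hI : UniqueDiffOn ℝ I)
    (hQ : IsNormalizing (m + 1) I E A μ Q) (hE : MatSmoothOn (m + 1) I E)
    (hEA : IsSelfAdjointPair I E A) (ht : t ∈ I) :
    (hamiltonianCoeff I E A Q t)ᵀ = hamiltonianCoeff I E A Q t := by
  have hm : (1 : ℕ∞) ≤ m + 1 := le_add_self
  have hT := hQ.smooth.toCols₁.hasDeriv hm ht
  have h := (hT.transpose.mul (hE.hasDeriv hm ht)).mul hT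
  have h0 : MatHasDeriv I (fun s => (Q s).toCols₁ᵀ * E s * (Q s).toCols₁) 0 t := fun i j =>
    (hasDerivWithinAt_const t I (sympJ p i j)).congr
      (fun s hs => congrFun (congrFun (hQ.normalized s hs) i) j)
      (congrFun (congrFun (hQ.normalized t ht) i) j)
  have h1 := (h.matDeriv_eq hI ht).symm.trans (h0.matDeriv_eq hI ht)
  have h2 : matDeriv I (fun s => (Q s).toCols₁) t = (matDeriv I Q t).toCols₁ := rfl
  rw [h2] at h1
  rw [hamiltonianCoeff, Matrix.transpose_mul, Matrix.transpose_transpose, Matrix.transpose_sub,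
    Matrix.transpose_mul, Matrix.transpose_mul, (hEA t ht).1, (hEA t ht).2, ← sub_eq_zero, ← h1]
  simp only [Matrix.mul_neg, Matrix.neg_mul, Matrix.mul_add, Matrix.add_mul, Matrix.mul_sub,
    Matrix.sub_mul, Matrix.mul_assoc]
  abel

/-- Since `T₂ᵀE T₂ = J`, the matrix `E T₂ J⁻¹ T₂ᵀ` is a projector onto `range (E T₂)`. -/
theorem IsNormalizing.mul_inv_sympJ_mul_mulVec (hQ : IsNormalizing m I E A μ Q) (ht : t ∈ I)
    {r : Fin n → ℝ} (hr : ∃ u, r = (E t * (Q t).toCols₁) *ᵥ u) :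
    (E t * (Q t).toCols₁) *ᵥ ((sympJ p)⁻¹ *ᵥ ((Q t).toCols₁ᵀ *ᵥ r)) = r := by
  obtain ⟨u, rfl⟩ := hr
  rw [Matrix.mulVec_mulVec u, ← Matrix.mul_assoc, hQ.normalized t ht, Matrix.mulVec_mulVec u,
    inv_sympJ_mul, Matrix.one_mulVec]

/-- For constant `v` the function `T₂ v` satisfies the homogeneous constraints at all times, so its
residual lies in `range (E T₂)`, where the projector `E T₂ J⁻¹ T₂ᵀ` is the identity. -/
theorem IsNormalizing.mul_inv_sympJ_mul_hamiltonianCoeff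
    (hQ : IsNormalizing (m + 1) (Set.Icc t₁ t₂) E A μ Q)
    (h : IsSelfAdjointRegular t₁ t₂ E A μ a Z) (ht : t ∈ Set.Icc t₁ t₂) :
    E t * (Q t).toCols₁ * ((sympJ p)⁻¹ * hamiltonianCoeff (Set.Icc t₁ t₂) E A Q t)
      = A t * (Q t).toCols₁ - E t * (matDeriv (Set.Icc t₁ t₂) Q t).toCols₁ := by
  set I := Set.Icc t₁ t₂ with hIdef
  have hI : UniqueDiffOn ℝ I := uniqueDiffOn_Icc h.lt
  have hm : (1 : ℕ∞) ≤ m + 1 := le_add_self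
  apply Matrix.ext_of_mulVec_single
  intro i
  set v : Fin p ⊕ Fin p → ℝ := Pi.single i 1
  set r := (A t * (Q t).toCols₁ - E t * (matDeriv I Q t).toCols₁) *ᵥ v with hr
  have hxs : VecSmoothOn (m + 1) I fun s => (Q s).toCols₁ *ᵥ v :=
    hQ.smooth.toCols₁.mulVec fun _ => contDiffOn_const
  have hx' : vecDeriv I (fun s => (Q s).toCols₁ *ᵥ v) t = (matDeriv I Q t).toCols₁ *ᵥ v := by
    have hv : VecHasDeriv I (fun _ => v) 0 t := fun i => hasDerivWithinAt_const _ _ _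
    have := ((hQ.smooth.toCols₁.hasDeriv hm ht).mulVec hv).vecDeriv_eq hI ht
    rw [this, Matrix.mulVec_zero, add_zero]
    rfl
  obtain ⟨u, hu⟩ := h.exists_resid_sub_eq ht (hQ.consistent t ht)
    (card_sum_add (hQ.nonsingular t ht)) (f := fun _ => 0) (fun _ => contDiffOn_const)
    (hxs.mono hm) (fun s hs => by
      rw [((h.basis_Z s hs).isConsistent_iff (h.regular s hs).rank).mp
        ((hQ.consistent s hs).consistent v), zero_add]
      have : inflg I (fun _ => (0 : Fin n → ℝ)) μ s = 0 := by
        ext q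
        simp only [inflg, Pi.zero_apply]
        rw [iteratedDerivWithin_fun_const_zero]
      rw [this, Matrix.mulVec_zero])
  have hru : r = (E t * (Q t).toCols₁) *ᵥ (-u) := by
    rw [Matrix.mulVec_neg, ← hu, sub_zero, resid, hx', hr, Matrix.sub_mulVec,
      Matrix.mulVec_mulVec, Matrix.mulVec_mulVec, neg_sub]
  rw [← hQ.mul_inv_sympJ_mul_mulVec ht ⟨_, hru⟩, hr]
  simp only [hamiltonianCoeff, Matrix.mulVec_mulVec, Matrix.mul_assoc]

/-- With `R = 0` on all of `I`, hence `Ṙ = 0`, the coefficient is `(Z₁ᵀE T₂)⁻¹ Z₁ᵀ(A T₂ - E Ṫ₂)`.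
The last factor equals `E T₂ J⁻¹ C`, so `Z₁` cancels. -/
theorem IsNormalizing.inherentCoeff_eq
    (hQ : IsNormalizing (m + 1) (Set.Icc t₁ t₂) E A μ Q)
    (h : IsSelfAdjointRegular t₁ t₂ E A μ a Z)
    (hc : ∀ t ∈ Set.Icc t₁ t₂, HypMatrices (Set.Icc t₁ t₂) E A μ t (Z₂ t) (T t) (Z₁ t))
    (ht : t ∈ Set.Icc t₁ t₂) :
    inherentCoeff (Set.Icc t₁ t₂) E A μ Z₂ Z₁ Q t
      = (sympJ p)⁻¹ * hamiltonianCoeff (Set.Icc t₁ t₂) E A Q t := by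
  set I := Set.Icc t₁ t₂ with hIdef
  have hI : UniqueDiffOn ℝ I := uniqueDiffOn_Icc h.lt
  have hR : ∀ s ∈ I, elimR I A μ Z₂ Q s = 0 := fun s hs =>
    hQ.elimR_eq_zero hs (h.regular s hs) (hc s hs).isNullBasis
  have hR' : matDeriv I (elimR I A μ Z₂ Q) t = 0 := by
    refine MatHasDeriv.matDeriv_eq hI ht fun i j => ?_
    exact (hasDerivWithinAt_const t I (0 : ℝ)).congr (fun s hs => by rw [hR s hs]; rfl)
      (by rw [hR t ht]; rfl)
  have hdet : IsUnit (elimE I E A μ Z₂ Z₁ Q t).det := (det_ne_zero_of_mulVec fun u hu =>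
    hQ.eq_zero_of_elimE ht (h.regular t ht) (hc t ht) hu).isUnit
  rw [inherentCoeff, hR', hR t ht, Matrix.mul_zero, Matrix.mul_zero, add_zero, sub_zero, hatA₁₁,
    Matrix.mul_assoc, Matrix.mul_assoc, ← Matrix.mul_sub,
    ← hQ.mul_inv_sympJ_mul_hamiltonianCoeff h ht, ← Matrix.mul_assoc (Z₁ t)ᵀ,
    ← Matrix.mul_assoc (Z₁ t)ᵀ, ← hQ.elimE_eq (Z₁ := Z₁) ht (h.regular t ht) (hc t ht).isNullBasis,
    ← Matrix.mul_assoc, Matrix.nonsing_inv_mul _ hdet, Matrix.one_mul]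

/-- The algebraic part `ρ` of the solution does not depend on the basis of the null space. -/
theorem IsNormalizing.elimρ_eq (hQ : IsNormalizing m I E A μ Q) (f : ℝ → Fin n → ℝ) (ht : t ∈ I)
    (hreg : IsRegularAt I E A μ a t) (hZ : IsNullBasis I E A μ t (Z t))
    (hZ₂ : IsNullBasis I E A μ t (Z₂ t)) : elimρ I A f μ Z₂ Q t = elimρ I A f μ Z Q t := by
  -- `ρ` is determined by the condition that `N T₂'ρ + g_μ` lie in the range of `M_μ`, which refers
  -- to no basis.
  have key : ∀ {Y : ℝ → Matrix (Fin (μ + 1) × Fin n) (Fin a) ℝ}, IsNullBasis I E A μ t (Y t) →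
      (Y t)ᵀ *ᵥ (inflN I A μ t *ᵥ ((Q t).toCols₂ *ᵥ elimρ I A f μ Y Q t) + inflg I f μ t) = 0 := by
    intro Y hY
    have hdet : IsUnit (hatA₂₂ I A μ Y Q t).det := (det_ne_zero_of_mulVec fun u hu =>
      hQ.eq_zero_of_hatA₂₂ ht hreg hY hu).isUnit
    rw [Matrix.mulVec_add, Matrix.mulVec_mulVec, Matrix.mulVec_mulVec, ← hatA₂₂, elimρ,
      Matrix.mulVec_neg, Matrix.mulVec_mulVec, Matrix.mul_nonsing_inv _ hdet, Matrix.one_mulVec,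
      neg_add_cancel]
  obtain ⟨Y, hY⟩ := hZ.exists_mulVec_eq hreg.rank (key hZ)
  have h1 := key hZ₂
  have h2 : (Z₂ t)ᵀ *ᵥ (inflN I A μ t *ᵥ ((Q t).toCols₂ *ᵥ elimρ I A f μ Z Q t)
      + inflg I f μ t) = 0 := by
    rw [← hY, Matrix.mulVec_mulVec, hZ₂.mul_eq_zero, Matrix.zero_mulVec]
  refine sub_eq_zero.mp (hQ.eq_zero_of_hatA₂₂ ht hreg hZ₂ ?_)
  rw [Matrix.mulVec_add] at h1 h2
  rw [hatA₂₂, Matrix.mulVec_sub]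
  simp only [Matrix.mulVec_mulVec, ← Matrix.mul_assoc] at h1 h2
  rw [eq_neg_of_add_eq_zero_left h1, eq_neg_of_add_eq_zero_left h2, sub_self]

theorem IsNormalizing.elimρ_smooth (hQ : IsNormalizing m I E A μ Q) {f : ℝ → Fin n → ℝ}
    (hI : UniqueDiffOn ℝ I) (hreg : ∀ t ∈ I, IsRegularAt I E A μ a t)
    (hZ : MatSmoothOn m I Z) (hZb : ∀ t ∈ I, IsNullBasis I E A μ t (Z t))
    (hA : MatSmoothOn (m + μ) I A) (hf : VecSmoothOn (m + μ) I f) :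
    VecSmoothOn m I (elimρ I A f μ Z Q) := by
  have hg : VecSmoothOn m I (inflg I f μ) := fun q => by
    have hi : ((q.1 : ℕ) : ℕ∞) ≤ μ := by exact_mod_cast Nat.lt_succ_iff.mp q.1.2
    exact VecSmoothOn.jet (m := m) (i := q.1) hI (hf.mono (add_le_add_right hi m)) q.2
  have hinv : MatSmoothOn m I fun t => (hatA₂₂ I A μ Z Q t)⁻¹ :=
    MatSmoothOn.inv ((hZ.transpose.mul (hA.inflN hI)).mul hQ.smooth.toCols₂) fun t ht =>
      det_ne_zero_of_mulVec fun u hu => hQ.eq_zero_of_hatA₂₂ ht (hreg t ht) (hZb t ht) hu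
  exact (hinv.mulVec (hZ.transpose.mulVec hg)).neg

/-- The algebraic part `T₂' ρ` of the solutions. -/
def algebraicPart (I : Set ℝ) (A : ℝ → Matrix (Fin n) (Fin n) ℝ) (f : ℝ → Fin n → ℝ) (μ : ℕ)
    (Z : ℝ → Matrix (Fin (μ + 1) × Fin n) (Fin a) ℝ)
    (Q : ℝ → Matrix (Fin n) ((Fin p ⊕ Fin p) ⊕ Fin a) ℝ) (t : ℝ) : Fin n → ℝ :=
  (Q t).toCols₂ *ᵥ elimρ I A f μ Z Q t

/-- The bracket in the inhomogeneity is `Z₁ᵀ(f - D(T₂'ρ))`. Since `T₂'ρ` satisfies the constraints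
for `f`, this residual lies in `range (E T₂)`, and `Z₁ᵀE T₂` cancels as in the homogeneous case. -/
theorem IsNormalizing.inherentInhom_eq
    (hQ : IsNormalizing (m + 1) (Set.Icc t₁ t₂) E A μ Q) {f : ℝ → Fin n → ℝ}
    (h : IsSelfAdjointRegular t₁ t₂ E A μ a Z)
    (hc : ∀ t ∈ Set.Icc t₁ t₂, HypMatrices (Set.Icc t₁ t₂) E A μ t (Z₂ t) (T t) (Z₁ t))
    (hZ : MatSmoothOn (m + 1) (Set.Icc t₁ t₂) Z) (hA : MatSmoothOn (m + 1 + μ) (Set.Icc t₁ t₂) A)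
    (hf : VecSmoothOn (m + 1 + μ) (Set.Icc t₁ t₂) f) (ht : t ∈ Set.Icc t₁ t₂) :
    inherentInhom (Set.Icc t₁ t₂) E A f μ Z₂ Z₁ Q t
      = (sympJ p)⁻¹ *ᵥ ((Q t).toCols₁ᵀ *ᵥ (f t - resid (Set.Icc t₁ t₂) E A
        (algebraicPart (Set.Icc t₁ t₂) A f μ Z Q) t)) := by
  set I := Set.Icc t₁ t₂ with hIdef
  have hI : UniqueDiffOn ℝ I := uniqueDiffOn_Icc h.lt
  have hm : (1 : ℕ∞) ≤ m + 1 := le_add_self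
  set ρ := elimρ I A f μ Z Q with hρ
  have hρs : VecSmoothOn (m + 1) I ρ := hQ.elimρ_smooth hI h.regular hZ h.basis_Z hA hf
  have hρeq : ∀ s ∈ I, elimρ I A f μ Z₂ Q s = ρ s := fun s hs =>
    hQ.elimρ_eq f hs (h.regular s hs) (h.basis_Z s hs) (hc s hs).isNullBasis
  have hρ' : vecDeriv I (elimρ I A f μ Z₂ Q) t = vecDeriv I ρ t := by
    ext i
    exact derivWithin_congr (fun s hs => by rw [hρeq s hs]) (by rw [hρeq t ht])
  set x := algebraicPart I A f μ Z Q with hx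
  have hxs : VecSmoothOn (m + 1) I x := hQ.smooth.toCols₂.mulVec hρs
  have hx' : vecDeriv I x t = (matDeriv I Q t).toCols₂ *ᵥ ρ t + (Q t).toCols₂ *ᵥ vecDeriv I ρ t :=
    ((hQ.smooth.toCols₂.hasDeriv hm ht).mulVec (hρs.hasDeriv hm ht)).vecDeriv_eq hI ht
  have hdet : IsUnit (elimE I E A μ Z₂ Z₁ Q t).det := (det_ne_zero_of_mulVec fun u hu =>
    hQ.eq_zero_of_elimE ht (h.regular t ht) (hc t ht) hu).isUnit
  obtain ⟨u, hu⟩ := h.exists_resid_sub_eq ht (hQ.consistent t ht)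
    (card_sum_add (hQ.nonsingular t ht)) (hf.mono le_add_self) (hxs.mono hm) (fun s hs => by
      have hd : IsUnit (hatA₂₂ I A μ Z Q s).det := (det_ne_zero_of_mulVec fun u hu =>
        hQ.eq_zero_of_hatA₂₂ hs (h.regular s hs) (h.basis_Z s hs) hu).isUnit
      rw [hx, algebraicPart, Matrix.mulVec_mulVec, ← hatA₂₂, elimρ,
        Matrix.mulVec_neg, Matrix.mulVec_mulVec, Matrix.mul_nonsing_inv _ hd, Matrix.one_mulVec,
        neg_add_cancel])
  have hru : f t - resid I E A x t = (E t * (Q t).toCols₁) *ᵥ (-u) := by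
    rw [Matrix.mulVec_neg, ← hu, neg_sub]
  have hrhs : (Z₁ t)ᵀ *ᵥ f t + hatA₁₂ I E A Z₁ Q t *ᵥ ρ t
      - ((Z₁ t)ᵀ * E t * (Q t).toCols₂) *ᵥ vecDeriv I ρ t
      = (Z₁ t)ᵀ *ᵥ (f t - resid I E A x t) := by
    rw [resid, hx', hx, algebraicPart, hatA₁₂]
    simp only [Matrix.mulVec_sub, Matrix.sub_mulVec, Matrix.mulVec_add, ← Matrix.mulVec_mulVec]
    abel
  rw [inherentInhom, hρ', hρeq t ht, hrhs]
  conv_lhs => rw [← hQ.mul_inv_sympJ_mul_mulVec ht ⟨_, hru⟩]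
  rw [Matrix.mulVec_mulVec _ (Z₁ t)ᵀ, ← Matrix.mul_assoc,
    ← hQ.elimE_eq (Z₁ := Z₁) ht (h.regular t ht) (hc t ht).isNullBasis, Matrix.mulVec_mulVec,
    Matrix.nonsing_inv_mul _ hdet, Matrix.one_mulVec]

theorem IsNormalizing.isHypChoice (hQ : IsNormalizing m (Set.Icc t₁ t₂) E A μ Q)
    (h : IsSelfAdjointRegular t₁ t₂ E A μ a Z) (hZ : MatSmoothOn m (Set.Icc t₁ t₂) Z) :
    IsHypChoice m (Set.Icc t₁ t₂) E A μ Z (fun t => (Q t).toCols₁) (fun t => (Q t).toCols₁) where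
  smooth_Z₂ := hZ
  smooth_T₂ := hQ.smooth.toCols₁
  smooth_Z₁ := hQ.smooth.toCols₁
  matrices t ht :=
    { rank_Z₂ := by rw [(h.basis_Z t ht).rank, Fintype.card_fin]
      Z₂_M := (h.basis_Z t ht).mul_eq_zero
      rank_A₂ := by rw [(h.regular t ht).rank_transpose_mul_inflN (h.basis_Z t ht),
        Fintype.card_fin]
      rank_T₂ := (hQ.consistent t ht).rank
      A₂_T₂ := hQ.hatA₂₁_eq_zero ht (h.regular t ht) (h.basis_Z t ht)
      rank_E_T₂ := (h.rank_transpose_mul ht (hQ.consistent t ht)).1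
      rank_Z₁ := (hQ.consistent t ht).rank
      rank_E₁_T₂ := rank_eq_card_of_mulVec fun _ hu => h.eq_zero_of_transpose_mul_mul ht
        (hQ.consistent t ht) (card_sum_add (hQ.nonsingular t ht)) hu }

end Inherent

/-! ### Existence of normalizing transformations -/

section Existence

variable {n μ a : ℕ} {E A : ℝ → Matrix (Fin n) (Fin n) ℝ} {t₁ t₂ : ℝ}

theorem IsRestrictedTransformation.mono {p : ℕ} {m k : ℕ∞} {I : Set ℝ}
    {Q : ℝ → Matrix (Fin n) ((Fin p ⊕ Fin p) ⊕ Fin a) ℝ}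
    (hQ : IsRestrictedTransformation m I Q) (h : k ≤ m) : IsRestrictedTransformation k I Q := by
  obtain ⟨O, H, G, hO, hH, hG, hQ⟩ := hQ
  exact ⟨O, H, G, hO.mono h, hH.mono h, hG.mono h, hQ⟩

/-- A self-adjoint DAE satisfying the hypothesis has an even number of differential components. -/
theorem IsSelfAdjointRegular.even {Z : ℝ → Matrix (Fin (μ + 1) × Fin n) (Fin a) ℝ}
    (h : IsSelfAdjointRegular t₁ t₂ E A μ a Z) {d : ℕ} {t : ℝ} (ht : t ∈ Set.Icc t₁ t₂)
    {T : Matrix (Fin n) (Fin d) ℝ} (hT : IsConsistentBasis (Set.Icc t₁ t₂) E A μ t T)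
    (hd : d + a = n) : Even d :=
  even_of_transpose_eq_neg (transpose_mul_mul_skew (h.selfAdjoint t ht).1 T)
    (det_ne_zero_of_mulVec fun _ hu => h.eq_zero_of_transpose_mul_mul ht hT (by simpa using hd) hu)

theorem IsSelfAdjointRegular.exists_isNormalizing
    {Z : ℝ → Matrix (Fin (μ + 1) × Fin n) (Fin a) ℝ}
    (h : IsSelfAdjointRegular t₁ t₂ E A μ a Z) {m : ℕ∞} {p : ℕ}
    (hE : MatSmoothOn (m + 1) (Set.Icc t₁ t₂) E) (hZ : MatSmoothOn (m + 1) (Set.Icc t₁ t₂) Z)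
    (hN : MatSmoothOn (m + 1) (Set.Icc t₁ t₂) (inflN (Set.Icc t₁ t₂) A μ)) (hp : 2 * p + a = n) :
    ∃ Q : ℝ → Matrix (Fin n) ((Fin p ⊕ Fin p) ⊕ Fin a) ℝ,
      IsNormalizing (m + 1) (Set.Icc t₁ t₂) E A μ Q ∧
      IsRestrictedTransformation (m + 1) (Set.Icc t₁ t₂) Q := by
  have hcard : Fintype.card (Fin p ⊕ Fin p) + a = n := by simp; omega
  obtain ⟨U, hU, hUp⟩ := exists_smooth_consistent_frame (δ := Fin p ⊕ Fin p) h.lt hN h.regular hZ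
    h.basis_Z hcard
  obtain ⟨Q, hQ, hQr, hQp⟩ := exists_restrictedTransformation h.lt hE
    (fun t ht => (h.selfAdjoint t ht).1) hU (fun t ht => (hUp t ht).1)
    (fun t ht u hu => h.eq_zero_of_transpose_mul_mul ht (hUp t ht).2 hcard hu)
  refine ⟨Q, ⟨hQ, fun t ht => (hQp t ht).1, fun t ht => ⟨?_, fun u => ?_⟩,
    fun t ht => (hQp t ht).2.1⟩, hQr⟩
  -- Full column rank of `T₂` follows from the invertibility of `T₂ᵀE T₂ = J`.
  · apply rank_eq_card_of_mulVec
    intro u hu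
    rw [← Matrix.one_mulVec u, ← inv_sympJ_mul, ← (hQp t ht).2.1, ← Matrix.mulVec_mulVec,
      ← Matrix.mulVec_mulVec, hu, Matrix.mulVec_zero, Matrix.mulVec_zero]
  · obtain ⟨B, hB⟩ := (hQp t ht).2.2
    rw [hB, ← Matrix.mulVec_mulVec]
    exact (hUp t ht).2.consistent _

end Existence

end

end LinDAE

theorem theorem4p2 (n μ : ℕ) :
    -- `k` derivatives are lost, with `k` depending on `n` and `μ` only
    ∃ k : ℕ, ∀ (s : ℕ∞) (t₁ t₂ : ℝ), t₁ < t₂ →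
      ∀ (E A : ℝ → Matrix (Fin n) (Fin n) ℝ),
        LinDAE.MatSmoothOn (s + k) (Set.Icc t₁ t₂) E →
        LinDAE.MatSmoothOn (s + k) (Set.Icc t₁ t₂) A →
      ∀ a d : ℕ, LinDAE.SatisfiesHyp (Set.Icc t₁ t₂) E A μ a d →
        LinDAE.IsSelfAdjointPair (Set.Icc t₁ t₂) E A →
      ∃ p : ℕ, d = 2 * p ∧
      ∃ Q : ℝ → Matrix (Fin n) ((Fin p ⊕ Fin p) ⊕ Fin a) ℝ,
        -- `Q` is smooth, pointwise nonsingular, and from the restricted class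
        LinDAE.MatSmoothOn (s + 1) (Set.Icc t₁ t₂) Q ∧
        (∀ t ∈ Set.Icc t₁ t₂, LinDAE.IsNonsingular (Q t)) ∧
        LinDAE.IsRestrictedTransformation (s + 1) (Set.Icc t₁ t₂) Q ∧
        -- the first block `T₂` of `Q` satisfies `T₂ᵀ E T₂ = J`, and it is a possible choice
        -- both for `T₂` and for `Z₁` in the regularity hypothesis
        (∀ t ∈ Set.Icc t₁ t₂,
          (Q t).toCols₁ᵀ * E t * (Q t).toCols₁ = LinDAE.sympJ p) ∧
        (∃ Z₂ : ℝ → Matrix (Fin (μ + 1) × Fin n) (Fin a) ℝ,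
          LinDAE.IsHypChoice (s + 1) (Set.Icc t₁ t₂) E A μ Z₂
            (fun t => (Q t).toCols₁) (fun t => (Q t).toCols₁)) ∧
        -- the inherent ODE fixed by `Q` is Hamiltonian and its flow is symplectic,
        -- for every choice of the matrix functions in the regularity hypothesis
        (∃ C : ℝ → Matrix (Fin p ⊕ Fin p) (Fin p ⊕ Fin p) ℝ,
          LinDAE.MatSmoothOn s (Set.Icc t₁ t₂) C ∧
          (∀ t ∈ Set.Icc t₁ t₂, (C t)ᵀ = C t) ∧
          ∀ (Z₂ : ℝ → Matrix (Fin (μ + 1) × Fin n) (Fin a) ℝ)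
            (T Z₁ : ℝ → Matrix (Fin n) (Fin p ⊕ Fin p) ℝ),
            LinDAE.IsHypChoice 1 (Set.Icc t₁ t₂) E A μ Z₂ T Z₁ →
            (∀ t ∈ Set.Icc t₁ t₂,
              LinDAE.IsNonsingular (LinDAE.hatA₂₂ (Set.Icc t₁ t₂) A μ Z₂ Q t) ∧
              LinDAE.IsNonsingular (LinDAE.elimE (Set.Icc t₁ t₂) E A μ Z₂ Z₁ Q t) ∧
              LinDAE.inherentCoeff (Set.Icc t₁ t₂) E A μ Z₂ Z₁ Q t
                = (LinDAE.sympJ p)⁻¹ * C t) ∧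
            ∀ t₀ ∈ Set.Icc t₁ t₂,
              (∃ Φ, LinDAE.IsFlow (Set.Icc t₁ t₂)
                (LinDAE.inherentCoeff (Set.Icc t₁ t₂) E A μ Z₂ Z₁ Q) t₀ Φ) ∧
              ∀ Φ, LinDAE.IsFlow (Set.Icc t₁ t₂)
                (LinDAE.inherentCoeff (Set.Icc t₁ t₂) E A μ Z₂ Z₁ Q) t₀ Φ →
                ∀ t ∈ Set.Icc t₁ t₂, LinDAE.IsSymplectic (Φ t)) ∧
        -- its inhomogeneity is a well-defined function for every sufficiently smooth `f`
        (∀ f : ℝ → Fin n → ℝ, LinDAE.VecSmoothOn (s + k) (Set.Icc t₁ t₂) f →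
          ∃ f₁ : ℝ → (Fin p ⊕ Fin p) → ℝ, LinDAE.VecSmoothOn s (Set.Icc t₁ t₂) f₁ ∧
          ∀ (Z₂ : ℝ → Matrix (Fin (μ + 1) × Fin n) (Fin a) ℝ)
            (T Z₁ : ℝ → Matrix (Fin n) (Fin p ⊕ Fin p) ℝ),
            LinDAE.IsHypChoice 1 (Set.Icc t₁ t₂) E A μ Z₂ T Z₁ →
            ∀ t ∈ Set.Icc t₁ t₂,
              LinDAE.inherentInhom (Set.Icc t₁ t₂) E A f μ Z₂ Z₁ Q t = f₁ t) := by
  -- With `m = s + 2μ + 3` the data are `C^(m+1+μ)`. The derivative array costs `μ` orders, so `Z`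
  -- and `Q` are `C^(m+1)`, which covers both the `2μ + 2` orders needed for null rows and the
  -- required `s + 1`. The coefficient `C` and the inhomogeneity cost one more.
  refine ⟨3 * μ + 4, fun s t₁ t₂ h12 E A hE hA a d hyp hEA => ?_⟩
  set I := Set.Icc t₁ t₂ with hIdef
  have hI : UniqueDiffOn ℝ I := uniqueDiffOn_Icc h12
  set m : ℕ∞ := s + ((2 * μ + 3 : ℕ) : ℕ∞) with hm
  have hk : s + ((3 * μ + 4 : ℕ) : ℕ∞) = m + 1 + μ := by
    rw [hm, add_assoc, add_assoc]
    congr 1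
    norm_cast
    ring
  rw [hk] at hE hA
  have hsm : s ≤ m := le_self_add
  have hs1 : s + 1 ≤ m + 1 := add_le_add_left hsm 1
  have hμ : ((2 * μ + 2 : ℕ) : ℕ∞) ≤ m + 1 := by
    refine le_trans ?_ (add_le_add_left (le_add_self : ((2 * μ + 3 : ℕ) : ℕ∞) ≤ m) 1)
    norm_cast
    omega
  have hE1 : LinDAE.MatSmoothOn (m + 1) I E := hE.mono le_self_add
  have hA1 : LinDAE.MatSmoothOn (m + 1) I A := hA.mono le_self_add
  have hreg : ∀ t ∈ I, LinDAE.IsRegularAt I E A μ a t := fun t ht => hyp.isRegularAt ht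
  obtain ⟨Z, hZ, hZb⟩ := LinDAE.exists_smooth_nullBasis h12 (LinDAE.MatSmoothOn.inflM hI hE hA)
    fun t ht => (hreg t ht).rank
  have h : LinDAE.IsSelfAdjointRegular t₁ t₂ E A μ a Z :=
    ⟨h12, hE1.mono hμ, hA1.mono hμ, hEA, hreg, hZ.mono hμ, hZb⟩
  have ht₁ : t₁ ∈ I := Set.left_mem_Icc.mpr h12.le
  obtain ⟨p, rfl⟩ : ∃ p, d = 2 * p := by
    obtain ⟨Z₂, T₂, Z₁, hc⟩ := (hyp.2 t₁ ht₁).2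
    exact (h.even ht₁ (hc.isConsistentBasis (hreg t₁ ht₁).rank) hyp.1).exists_two_nsmul
  obtain ⟨Q, hQ, hQr⟩ := h.exists_isNormalizing hE1 hZ (LinDAE.MatSmoothOn.inflN hI hA) hyp.1
  have hQc := hQ.isHypChoice h hZ
  have hCs : LinDAE.MatSmoothOn m I (LinDAE.hamiltonianCoeff I E A Q) :=
    hQ.hamiltonianCoeff_smooth hI (hE1.mono le_self_add) (hA1.mono le_self_add)
  have hCsymm : ∀ t ∈ I, (LinDAE.hamiltonianCoeff I E A Q t)ᵀ = LinDAE.hamiltonianCoeff I E A Q t :=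
    fun t ht => hQ.hamiltonianCoeff_transpose hI hE1 hEA ht
  refine ⟨p, rfl, Q, hQ.smooth.mono hs1, hQ.nonsingular, hQr.mono hs1, hQ.normalized,
    ⟨Z, hQc.smooth_Z₂.mono hs1, hQc.smooth_T₂.mono hs1, hQc.smooth_Z₁.mono hs1, hQc.matrices⟩,
    ⟨LinDAE.hamiltonianCoeff I E A Q, hCs.mono hsm, hCsymm, fun Z₂ T Z₁ hc => ?_⟩,
    fun f hf => ?_⟩
  · have hL : ∀ t ∈ I, LinDAE.inherentCoeff I E A μ Z₂ Z₁ Q t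
        = (LinDAE.sympJ p)⁻¹ * LinDAE.hamiltonianCoeff I E A Q t :=
      fun t ht => hQ.inherentCoeff_eq h hc.matrices ht
    refine ⟨fun t ht => ⟨?_, ?_, hL t ht⟩, fun t₀ ht₀ =>
      ⟨LinDAE.exists_isFlow h12.le (hCs.mono zero_le) hCsymm hL ht₀,
        fun Φ hΦ t ht => LinDAE.isSymplectic_of_isFlow hCsymm hL ht₀ hΦ ht⟩⟩
    · exact LinDAE.isNonsingular_of_mulVec fun u hu =>
        hQ.eq_zero_of_hatA₂₂ ht (hreg t ht) (hc.matrices t ht).isNullBasis hu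
    · exact LinDAE.isNonsingular_of_mulVec fun u hu =>
        hQ.eq_zero_of_elimE ht (hreg t ht) (hc.matrices t ht) hu
  · rw [hk] at hf
    set x := LinDAE.algebraicPart I A f μ Z Q
    have hxs : LinDAE.VecSmoothOn (m + 1) I x :=
      hQ.smooth.toCols₂.mulVec (hQ.elimρ_smooth hI hreg hZ hZb hA hf)
    refine ⟨fun t => (LinDAE.sympJ p)⁻¹ *ᵥ ((Q t).toCols₁ᵀ *ᵥ (f t - LinDAE.resid I E A x t)),
      ?_, fun Z₂ T Z₁ hc t ht => hQ.inherentInhom_eq h hc.matrices hZ hA hf ht⟩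
    have hres : LinDAE.VecSmoothOn m I (LinDAE.resid I E A x) :=
      ((hE1.mono le_self_add).mulVec (hxs.vecDeriv hI)).sub
        ((hA1.mono le_self_add).mulVec (hxs.mono le_self_add))
    have hfr : LinDAE.VecSmoothOn m I fun t => f t - LinDAE.resid I E A x t :=
      (hf.mono (le_self_add.trans le_self_add)).sub hres
    have hQ1 : LinDAE.MatSmoothOn m I fun t => (Q t).toCols₁ᵀ :=
      (hQ.smooth.toCols₁.mono le_self_add).transpose
    exact ((LinDAE.MatSmoothOn.const _).mulVec (hQ1.mulVec hfr)).mono hsm
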